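/- Let $n\ge 1$, let $G$ be a Lie group, and let $M$ be an oriented Riemannian manifold of dimension $n+1$ on which $G$ acts smoothly by orientation-preserving isometries. Let $\omega$ be a closed $G$-invariant two-form on $M$. Write $C_k$ for the real Clifford algebra of $\mathbb R^k$ with $v^2=-\|v\|^2$, and $$Spin^c(k)=\{c\,v_1\cdots v_l : c\in U(1),\ v_i\in\mathbb R^k,\ \|v_i\|=1,\ l\ge 0\text{ even}\}\subset C_k\otimes\mathbb C ,$$ with $Spin(k)\subset Spin^c(k)$ the elements with $c=1$, and $\lambda^c:Spin^c(k)\to SO(k)$, $\lambda^c(X)y=XyX^{-1}$. A *$G$-equivariant spin$^c$ prequantization* for an oriented Riemannian $m$-manifold $(N,\sigma)$ with an action of $G$ by orientation-preserving isometries and a closed $G$-invariant two-form $\sigma$ is a pair $(P,\theta)$ of the following kind. 1. $P$ is a $G$-equivariant spin$^c$ structure: a principal $Spin^c(m)$-bundle $\pi:P\to N$ (with right action), with a smooth map $\Lambda:P\to SOF(N)$ to the bundle of oriented orthonormal frames over $N$, such that $\Lambda(p\cdot X)=\Lambda(p)\cdot\lambda^c(X)$, together with a smooth left action of $G$ on $P$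 that commutes with $Spin^c(m)$ and for which $\Lambda$ is equivariant. 2. $\theta\in\Omega^1(P;\mathfrak u(1))$, $\mathfrak u(1)=i\mathbb R$, is a connection one-form on the circle bundle $P\to SOF(N)$ that is invariant under $G$ and $Spin^c(m)$ and satisfies $\theta(\zeta_P)=0$ for all $\zeta\in\mathfrak{spin}(m)$ and $d\theta=\pi^*(-i\,\sigma)$. Let $(P,\theta)$ be a $G$-equivariant spin$^c$ prequantization for $(M,\omega)$. Let $Z\subset M$ be a $G$-invariant embedded submanifold of codimension one with a $G$-invariant co-orientation, and let $v$ be its field of positive unit normal vectors (so $g_*v=v$ for all $g\in G$). Give $Z$ the induced Riemannian metric and the orientation for which $(w_1,\dots,w_n)$ is positive in $T_zZ$ if and only if $(w_1,\dots,w_n,v_z)$ is positive in $T_zM$. Let $$i:SOF(Z)\to SOF(M),\qquad i(f)(a_1,\dots,a_{n+1})=f(a_1,\dots,a_n)+a_{n+1}v_z\quad (f \text{ a frame at } z),$$ let $P_Z=i^*(P)=\{(f,p)\in SOF(Z)\times P : i(f)=\Lambda(p)\}$, let $i':P_Z\to P$ be the projection $(f,p)\mapsto p$, and let $\theta_Z=(i')^*\theta$.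 Then $P_Z$, with the subspace topology, is a smooth manifold, with a $G$-action and a right $Spin^c(n)$-action, such that $i'$ is a smooth embedding, is $G$-equivariant, and is equivariant along the natural inclusion $Spin^c(n)\hookrightarrow Spin^c(n+1)$. With the projection $P_Z\to SOF(Z)$ as its structure map, $(P_Z,\theta_Z)$ is a $G$-equivariant spin$^c$ prequantization for $(Z,\omega|_Z)$; in particular $G$ acts smoothly on $Z$ by orientation-preserving isometries, and $\omega|_Z$ is a closed $G$-invariant two-form. -/

import Mathlib

open scoped Manifold ContDiff TensorProduct RealInnerProductSpace

noncomputable section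

namespace SpinCPreq

/-- The Euclidean space `ℝ^k`. -/
abbrev Euc (k : ℕ) : Type := EuclideanSpace ℝ (Fin k)

/-! ### The Clifford algebra, the spin group and the spin^c group -/

/-- The quadratic form `v ↦ -‖v‖²` of minus the standard inner product on `ℝ^k`. -/
def negSq (k : ℕ) : QuadraticForm ℝ (Euc k) :=
  -(LinearMap.BilinMap.toQuadraticMap (innerₗ (Euc k)))

theorem negSq_apply (k : ℕ) (v : Euc k) : negSq k v = -‖v‖ ^ 2 := by
  simp [negSq, LinearMap.BilinMap.toQuadraticMap_apply]

/-- The real Clifford algebra `C_k`, in which `v * v = -‖v‖²`. -/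
abbrev Cl (k : ℕ) : Type := CliffordAlgebra (negSq k)

/-- The complex Clifford algebra `C_k ⊗ ℂ`. -/
abbrev ClC (k : ℕ) : Type := ℂ ⊗[ℝ] Cl k

/-- The standard basis of `C_k` over `ℝ`. -/
def clBasis (k : ℕ) : Module.Basis (Finset (Fin k)) ℝ (Cl k) :=
  ((EuclideanSpace.basisFun (Fin k) ℝ).toBasis.ExteriorAlgebra).map
    (CliffordAlgebra.equivExterior (negSq k)).symm

/-- A basis of `C_k ⊗ ℂ` over `ℝ`. -/
def clCBasis (k : ℕ) : Module.Basis (Fin 2 × Finset (Fin k)) ℝ (ClC k) :=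
  Complex.basisOneI.tensorProduct (clBasis k)

/-- `C_k ⊗ ℂ` is a finite-dimensional real vector space; it is normed by its coordinates. (All norms
on it are equivalent, and the norm only serves to speak of smooth maps.) -/
instance (k : ℕ) : NormedAddCommGroup (ClC k) :=
  NormedAddCommGroup.induced (ClC k) (Fin 2 × Finset (Fin k) → ℝ)
    (clCBasis k).equivFun.toLinearMap (clCBasis k).equivFun.injective

instance (k : ℕ) : NormedSpace ℝ (ClC k) :=
  NormedSpace.induced ℝ (ClC k) (Fin 2 × Finset (Fin k) → ℝ) (clCBasis k).equivFun.toLinearMap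

/-- The spin group as a subset of `C_k`: products of an even number of unit vectors. -/
def spinSet (k : ℕ) : Set (Cl k) :=
  {x | ∃ l : List (Euc k), (∀ v ∈ l, ‖v‖ = 1) ∧ Even l.length ∧
    x = (l.map (CliffordAlgebra.ι (negSq k))).prod}

theorem one_mem_spinSet (k : ℕ) : (1 : Cl k) ∈ spinSet k := ⟨[], by simp, by simp, by simp⟩

theorem mul_mem_spinSet {k : ℕ} {x y : Cl k} (hx : x ∈ spinSet k) (hy : y ∈ spinSet k) :
    x * y ∈ spinSet k := by
  obtain ⟨l, hl, hl', rfl⟩ := hx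
  obtain ⟨l₁, hl₁, hl₁', rfl⟩ := hy
  refine ⟨l ++ l₁, ?_, ?_, by simp⟩
  · intro v hv
    rcases List.mem_append.1 hv with h | h
    exacts [hl v h, hl₁ v h]
  · rw [List.length_append]; exact hl'.add hl₁'

theorem prod_mul_prod_reverse {k : ℕ} (l : List (Euc k)) (hl : ∀ v ∈ l, ‖v‖ = 1) :
    (l.map (CliffordAlgebra.ι (negSq k))).prod *
      (l.reverse.map (CliffordAlgebra.ι (negSq k))).prod = (-1) ^ l.length := by
  induction l with
  | nil => simp
  | cons v l ih =>
    have hv : CliffordAlgebra.ι (negSq k) v * CliffordAlgebra.ι (negSq k) v = -1 := by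
      rw [CliffordAlgebra.ι_sq_scalar, negSq_apply, hl v (by simp)]; simp
    have ih' := ih (fun w hw => hl w (by simp [hw]))
    simp only [List.map_cons, List.prod_cons, List.reverse_cons, List.map_append, List.prod_append,
      List.map_nil, List.prod_nil, mul_one, List.length_cons]
    rw [mul_assoc, ← mul_assoc _ _ (CliffordAlgebra.ι (negSq k) v), ih', pow_succ]
    rcases neg_one_pow_eq_or (Cl k) l.length with h | h <;> rw [h] <;> simp [hv]

theorem exists_inv_spinSet {k : ℕ} {x : Cl k} (hx : x ∈ spinSet k) :
    ∃ y ∈ spinSet k, x * y = 1 ∧ y * x = 1 := by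
  obtain ⟨l, hl, hl', rfl⟩ := hx
  have hr : ∀ v ∈ l.reverse, ‖v‖ = 1 := fun v hv => hl v (List.mem_reverse.1 hv)
  refine ⟨_, ⟨l.reverse, hr, by simpa using hl', rfl⟩, ?_, ?_⟩
  · rw [prod_mul_prod_reverse l hl, hl'.neg_one_pow]
  · have := prod_mul_prod_reverse l.reverse hr
    rwa [List.reverse_reverse, List.length_reverse, hl'.neg_one_pow] at this

/-- The group `Spin^c(k)`: the elements `c • v₁ ⋯ v_l` of `C_k ⊗ ℂ` with `c ∈ U(1)`, unit vectors
`v_i ∈ ℝ^k` and `l` even. This is a compact subgroup of the group of units of `C_k ⊗ ℂ`. -/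
def SpinC (k : ℕ) : Subgroup (ClC k)ˣ where
  carrier := {u | ∃ c : Circle, ∃ x ∈ spinSet k, (u : ClC k) = (c : ℂ) ⊗ₜ[ℝ] x}
  one_mem' := ⟨1, 1, one_mem_spinSet k, by simp [Algebra.TensorProduct.one_def]⟩
  mul_mem' := by
    rintro u w ⟨c, x, hx, hu⟩ ⟨e, y, hy, hw⟩
    exact ⟨c * e, x * y, mul_mem_spinSet hx hy, by simp [hu, hw]⟩
  inv_mem' := by
    rintro u ⟨c, x, hx, hu⟩
    obtain ⟨y, hy, hxy, -⟩ := exists_inv_spinSet hx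
    refine ⟨c⁻¹, y, hy, ?_⟩
    rw [Units.inv_eq_of_mul_eq_one_right]
    rw [hu, Algebra.TensorProduct.tmul_mul_tmul, hxy, Algebra.TensorProduct.one_def]
    congr 1
    simp

/-- The inclusion `Spin^c(k) ⊆ C_k ⊗ ℂ`. -/
def toClC {k : ℕ} (X : SpinC k) : ClC k := ((X : (ClC k)ˣ) : ClC k)

/-- Membership of an element of `Spin^c(k)` in the subgroup `Spin(k)`. -/
def InSpin {k : ℕ} (X : SpinC k) : Prop := ∃ x ∈ spinSet k, toClC X = (1 : ℂ) ⊗ₜ[ℝ] x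

/-- The inclusion `U(1) → Spin^c(k)`, `z ↦ [1, z]`. -/
def circleIncl (k : ℕ) (c : Circle) : SpinC k :=
  ⟨⟨(c : ℂ) ⊗ₜ[ℝ] 1, ((c⁻¹ : Circle) : ℂ) ⊗ₜ[ℝ] 1,
    by simp [Algebra.TensorProduct.one_def], by simp [Algebra.TensorProduct.one_def]⟩,
    c, 1, one_mem_spinSet k, rfl⟩

/-- The inclusion `ℝ^k ⊆ C_k ⊗ ℂ`. -/
def vecC {k : ℕ} (y : Euc k) : ClC k := (1 : ℂ) ⊗ₜ[ℝ] CliffordAlgebra.ι (negSq k) y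

theorem exists_conj {k : ℕ} (l : List (Euc k)) (y : Euc k) :
    ∃ w : Euc k, CliffordAlgebra.ι (negSq k) w =
      (l.map (CliffordAlgebra.ι (negSq k))).prod * CliffordAlgebra.ι (negSq k) y *
        (l.reverse.map (CliffordAlgebra.ι (negSq k))).prod := by
  induction l with
  | nil => exact ⟨y, by simp⟩
  | cons v l ih =>
    obtain ⟨w, hw⟩ := ih
    refine ⟨QuadraticMap.polar (negSq k) v w • v - negSq k v • w, ?_⟩
    rw [← CliffordAlgebra.ι_mul_ι_mul_ι, hw]
    simp [mul_assoc]

theorem exists_rot {k : ℕ} (X : SpinC k) (y : Euc k) :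
    ∃ w : Euc k, vecC w = toClC X * vecC y * toClC X⁻¹ := by
  obtain ⟨u, c, x, ⟨l, hl, hl', rfl⟩, hu⟩ := X
  obtain ⟨w, hw⟩ := exists_conj l y
  have hinv : ((u⁻¹ : (ClC k)ˣ) : ClC k) = ((c⁻¹ : Circle) : ℂ) ⊗ₜ[ℝ]
      (l.reverse.map (CliffordAlgebra.ι (negSq k))).prod := by
    refine Units.inv_eq_of_mul_eq_one_right ?_
    rw [hu, Algebra.TensorProduct.tmul_mul_tmul, prod_mul_prod_reverse l hl, hl'.neg_one_pow,
      Algebra.TensorProduct.one_def]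
    congr 1
    simp
  refine ⟨w, ?_⟩
  change vecC w = (u : ClC k) * vecC y * ((u⁻¹ : (ClC k)ˣ) : ClC k)
  rw [hinv, hu, vecC, vecC, Algebra.TensorProduct.tmul_mul_tmul,
    Algebra.TensorProduct.tmul_mul_tmul, hw]
  congr 1
  simp

/-- The covering `λ^c : Spin^c(k) → SO(k)`, as an action on `ℝ^k`: `λ^c(X) y = X y X⁻¹`, which for
`X = [x, z]` is `x y x^t`. -/
def rot {k : ℕ} (X : SpinC k) (y : Euc k) : Euc k := (exists_rot X y).choose

theorem vecC_rot {k : ℕ} (X : SpinC k) (y : Euc k) :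
    vecC (rot X y) = toClC X * vecC y * toClC X⁻¹ := (exists_rot X y).choose_spec

/-- The inclusion `ℝ^n → ℝ^(n+1)`, `a ↦ (a, 0)`. -/
def appendZero (n : ℕ) : Euc n →ₗ[ℝ] Euc (n + 1) where
  toFun a := WithLp.toLp 2 (Fin.snoc (α := fun _ => ℝ) a 0)
  map_add' a b := by
    ext i; refine Fin.lastCases ?_ (fun j => ?_) i <;> simp
  map_smul' c a := by
    ext i; refine Fin.lastCases ?_ (fun j => ?_) i <;> simp

theorem norm_appendZero (n : ℕ) (a : Euc n) : ‖appendZero n a‖ = ‖a‖ := by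
  simp [appendZero, EuclideanSpace.norm_eq, Fin.sum_univ_castSucc]

/-- The induced homomorphism `C_n → C_(n+1)`. -/
def clIncl (n : ℕ) : Cl n →ₐ[ℝ] Cl (n + 1) :=
  CliffordAlgebra.map
    { appendZero n with
      map_app' := fun a => by
        have := norm_appendZero n a
        simp [negSq_apply] at this ⊢
        rw [this] }

theorem clIncl_mem_spinSet {n : ℕ} {x : Cl n} (hx : x ∈ spinSet n) :
    clIncl n x ∈ spinSet (n + 1) := by
  obtain ⟨l, hl, hl', rfl⟩ := hx
  refine ⟨l.map (appendZero n), ?_, by simpa using hl', ?_⟩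
  · intro v hv
    obtain ⟨w, hw, rfl⟩ := List.mem_map.1 hv
    rw [norm_appendZero, hl w hw]
  · rw [map_list_prod, List.map_map, List.map_map]
    congr 1
    refine List.map_congr_left fun v _ => ?_
    simp only [Function.comp_apply, clIncl, CliffordAlgebra.map_apply_ι]
    rfl

/-- The natural inclusion `Spin^c(n) → Spin^c(n+1)`. -/
def spinCIncl (n : ℕ) : SpinC n →* SpinC (n + 1) :=
  ((Units.map (Algebra.TensorProduct.map (AlgHom.id ℝ ℂ) (clIncl n) :
      ClC n →* ClC (n + 1))).comp (SpinC n).subtype).codRestrict (SpinC (n + 1)) (by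
    rintro ⟨u, c, x, hx, hu⟩
    exact ⟨c, clIncl n x, clIncl_mem_spinSet hx, by simp [hu]⟩)

/-! ### Differential forms on manifolds -/

/-- A (not necessarily smooth) `F`-valued differential `q`-form on an `m`-dimensional manifold. -/
abbrev Form (m : ℕ) (X : Type*) [TopologicalSpace X] [ChartedSpace (Euc m) X] (q : ℕ)
    (F : Type*) [NormedAddCommGroup F] [NormedSpace ℝ F] : Type _ :=
  ∀ x : X, (TangentSpace (𝓡 m) x) [⋀^Fin q]→L[ℝ] F

namespace Form

section
variable {m m' : ℕ} {X Y : Type*} [TopologicalSpace X] [ChartedSpace (Euc m) X]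
  [TopologicalSpace Y] [ChartedSpace (Euc m') Y] {q : ℕ}
  {F : Type*} [NormedAddCommGroup F] [NormedSpace ℝ F]

/-- The pullback `f^* η`. -/
def pullback (f : X → Y) (η : Form m' Y q F) : Form m X q F :=
  fun x => (η (f x)).compContinuousLinearMap (mfderiv (𝓡 m) (𝓡 m') f x)

/-- The form `η` written in the preferred chart at `x₀`. -/
def inChart (η : Form m X q F) (x₀ : X) (y : Euc m) : (Euc m) [⋀^Fin q]→L[ℝ] F :=
  (η ((extChartAt (𝓡 m) x₀).symm y)).compContinuousLinearMap
    (mfderiv (𝓡 m) (𝓡 m) (extChartAt (𝓡 m) x₀).symm y)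

/-- Smoothness of a form: its coefficients are smooth in charts. -/
def Smooth (η : Form m X q F) : Prop :=
  ∀ x₀ : X, ContDiffOn ℝ ∞ (η.inChart x₀) (extChartAt (𝓡 m) x₀).target

/-- The exterior derivative, computed at `x` in the preferred chart at `x`. -/
def d (η : Form m X q F) : Form m X (q + 1) F :=
  fun x => (extDeriv (η.inChart x) (extChartAt (𝓡 m) x x)).compContinuousLinearMap
    (mfderiv (𝓡 m) (𝓡 m) (extChartAt (𝓡 m) x) x)

/-- The form `-i η`, with values in `u(1) = iℝ ⊆ ℂ`, for a real form `η`. -/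
def negI (η : Form m X q ℝ) : Form m X q ℂ :=
  fun x => (-Complex.I) • Complex.ofRealCLM.compContinuousAlternatingMap (η x)

end

end Form

/-! ### Oriented Riemannian manifolds and their frame bundles -/

/-- The tuple `w` is positive with respect to the orientation `o`. -/
def PositiveTuple {V : Type*} [AddCommGroup V] [Module ℝ V] {k : ℕ}
    (o : Orientation ℝ V (Fin k)) (w : Fin k → V) : Prop :=
  ∃ (Ω : V [⋀^Fin k]→ₗ[ℝ] ℝ) (hΩ : Ω ≠ 0), o = rayOfNeZero ℝ Ω hΩ ∧ 0 < Ω w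

section Riemannian

variable {m : ℕ} {M : Type*} [TopologicalSpace M] [ChartedSpace (Euc m) M]

variable (m M) in
/-- A bilinear form on each tangent space. -/
abbrev Metric : Type _ := ∀ x : M, LinearMap.BilinForm ℝ (TangentSpace (𝓡 m) x)

variable (m M) in
/-- An orientation of each tangent space. -/
abbrev Orient : Type _ := ∀ x : M, Orientation ℝ (TangentSpace (𝓡 m) x) (Fin m)

/-- `g` is a smooth Riemannian metric. -/
def IsRiemannianMetric [IsManifold (𝓡 m) ∞ M] (g : Metric m M) : Prop :=
  ∃ γ : Bundle.ContMDiffRiemannianMetric (𝓡 m) ∞ (Euc m)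
      (fun x : M => TangentSpace (𝓡 m) x), ∀ x u w, γ.inner x u w = g x u w

/-- `o` is an orientation of the manifold: near each point there is a smooth positive frame. -/
def IsManifoldOrientation [IsManifold (𝓡 m) ∞ M] (o : Orient m M) : Prop :=
  ∀ x₀ : M, ∃ U : Set M, IsOpen U ∧ x₀ ∈ U ∧
    ∃ e : Fin m → ∀ x : M, TangentSpace (𝓡 m) x,
      (∀ i, ContMDiffOn (𝓡 m) (𝓡 m).tangent ∞ (fun x => (⟨x, e i x⟩ : TangentBundle (𝓡 m) M)) U) ∧
      ∀ x ∈ U, PositiveTuple (o x) (fun i => e i x)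

/-- A point of the bundle `SOF(M)` of oriented orthonormal frames: a base point `x` together with an
orientation-preserving isometry `ℝ^m → T_x M`. -/
structure SOF (g : Metric m M) (o : Orient m M) where
  /-- the base point -/
  base : M
  /-- the frame -/
  frame : Euc m →ₗ[ℝ] TangentSpace (𝓡 m) base
  isometry : ∀ a b, g base (frame a) (frame b) = ⟪a, b⟫
  positive : PositiveTuple (o base) (fun i => frame (EuclideanSpace.basisFun (Fin m) ℝ i))

namespace SOF

variable {g : Metric m M} {o : Orient m M}

/-- The value `f(a)` of a frame, as a point of the tangent bundle. -/
def vec (f : SOF g o) (a : Euc m) : TangentBundle (𝓡 m) M := ⟨f.base, f.frame a⟩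

/-- The topology of the frame bundle, as a subspace of the space of maps `ℝ^m → TM`. -/
instance [IsManifold (𝓡 m) ∞ M] : TopologicalSpace (SOF g o) := TopologicalSpace.induced (fun f (a : Euc m) => f.vec a) inferInstance

/-- Smoothness of a map into the frame bundle: since `SOF(M)` is an embedded submanifold of
`TM ⊕ ⋯ ⊕ TM`, a map `Λ` into it is smooth if and only if `p ↦ Λ(p)(a)` is a smooth map into `TM`
for every `a ∈ ℝ^m`. -/
def SmoothMap [IsManifold (𝓡 m) ∞ M] {d : ℕ} {P : Type*} [TopologicalSpace P] [ChartedSpace (Euc d) P]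
    (Λ : P → SOF g o) : Prop :=
  ∀ a, ContMDiff (𝓡 d) (𝓡 m).tangent ∞ (fun p => (Λ p).vec a)

end SOF

end Riemannian

/-! ### Principal `Spin^c(k)`-bundles

`Spin^c(k)` is a compact, hence embedded, subgroup of the finite-dimensional algebra `C_k ⊗ ℂ`.
A map into it is smooth if and only if it is smooth as a map into `C_k ⊗ ℂ`, and a map on
`P × Spin^c(k)` is smooth if and only if it is smooth as a map on that subset of
`P × (C_k ⊗ ℂ)`. -/

section Bundles

variable {m d : ℕ} {M P : Type*} [TopologicalSpace M] [ChartedSpace (Euc m) M]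
  [TopologicalSpace P] [ChartedSpace (Euc d) P]

/-- `π : P → M` with the given right action of `Spin^c(k)` is a smooth principal
`Spin^c(k)`-bundle. The action is smooth, and over a neighbourhood `U` of each point the map
`(x, X) ↦ s(x) · X` given by some smooth section `s` is an (equivariant) diffeomorphism
`U × Spin^c(k) → π⁻¹(U)`, with inverse `p ↦ (π(p), τ(p))`. -/
structure IsPrincipalSpinCBundle (k : ℕ) [MulAction (SpinC k)ᵐᵒᵖ P] (π : P → M) : Prop where
  smooth_proj : ContMDiff (𝓡 d) (𝓡 m) ∞ π
  smooth_action : ∃ F : P × ClC k → P,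
    ContMDiffOn ((𝓡 d).prod 𝓘(ℝ, ClC k)) (𝓡 d) ∞ F (Set.univ ×ˢ Set.range toClC) ∧
    ∀ (p : P) (X : SpinC k), F (p, toClC X) = MulOpposite.op X • p
  proj_action : ∀ (p : P) (X : SpinC k), π (MulOpposite.op X • p) = π p
  locally_trivial : ∀ x₀ : M, ∃ U : Set M, IsOpen U ∧ x₀ ∈ U ∧
    ∃ (s : M → P) (τ : P → SpinC k),
      ContMDiffOn (𝓡 m) (𝓡 d) ∞ s U ∧
      ContMDiffOn (𝓡 d) 𝓘(ℝ, ClC k) ∞ (fun p => toClC (τ p)) (π ⁻¹' U) ∧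
      (∀ x ∈ U, π (s x) = x) ∧
      (∀ p, π p ∈ U → MulOpposite.op (τ p) • s (π p) = p) ∧
      (∀ x ∈ U, ∀ X : SpinC k, τ (MulOpposite.op X • s x) = X)

/-- The velocity at `t = 0` of the curve `t ↦ p · γ(t)`. -/
def orbitVelocity {k : ℕ} [MulAction (SpinC k)ᵐᵒᵖ P] (p : P) (γ : ℝ → SpinC k) :
    TangentSpace (𝓡 d) (MulOpposite.op (γ 0) • p) :=
  mfderiv 𝓘(ℝ, ℝ) (𝓡 d) (fun t : ℝ => MulOpposite.op (γ t) • p) 0 (1 : ℝ)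

/-- `γ` is a smooth one-parameter subgroup of `Spin(k) ⊆ Spin^c(k)`, i.e. `γ(t) = exp(tζ)` for some
`ζ ∈ spin(k)`. Then `orbitVelocity p γ` is the value at `p` of the vector field `ζ_P`. -/
structure IsSpinOneParameterSubgroup {k : ℕ} (γ : ℝ → SpinC k) : Prop where
  map_add : ∀ s t, γ (s + t) = γ s * γ t
  smooth : ContDiff ℝ ∞ (fun t => toClC (γ t))
  inSpin : ∀ t, InSpin (γ t)

end Bundles

/-! ### Equivariant spin^c structures and spin^c prequantizations -/

section Prequantization

variable {r m d : ℕ}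
  (G : Type*) [TopologicalSpace G] [ChartedSpace (Euc r) G] [Group G]
  {M : Type*} [TopologicalSpace M] [ChartedSpace (Euc m) M] [MulAction G M]
  {P : Type*} [TopologicalSpace P] [ChartedSpace (Euc d) P] [MulAction G P]

/-- `G` acts smoothly on the oriented Riemannian manifold `(M, g, o)` by orientation preserving
isometries. -/
structure IsOrientedRiemannianAction [IsManifold (𝓡 m) ∞ M] (g : Metric m M) (o : Orient m M) :
    Prop where
  riemannian : IsRiemannianMetric g
  orientation : IsManifoldOrientation o
  smooth_smul : ContMDiffSMul (𝓡 r) (𝓡 m) ∞ G M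
  isometry : ∀ (a : G) (x : M) (u w : TangentSpace (𝓡 m) x),
    g (a • x) (mfderiv (𝓡 m) (𝓡 m) (fun y : M => a • y) x u)
      (mfderiv (𝓡 m) (𝓡 m) (fun y : M => a • y) x w) = g x u w
  preserves_orientation : ∀ (a : G) (x : M) (w : Fin m → TangentSpace (𝓡 m) x),
    PositiveTuple (o x) w →
      PositiveTuple (o (a • x)) (fun i => mfderiv (𝓡 m) (𝓡 m) (fun y : M => a • y) x (w i))

/-- `Λ : P → SOF(M)` is a `G`-equivariant spin^c structure on the oriented Riemannian `G`-manifold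
`(M, g, o)`. Here `G` acts on `SOF(M)` by `(a · f)(y) = da(f(y))`, and `SO(m)` by composition. -/
structure IsEquivariantSpinCStructure [IsManifold (𝓡 m) ∞ M] [MulAction (SpinC m)ᵐᵒᵖ P] {g : Metric m M} {o : Orient m M}
    (Λ : P → SOF g o) : Prop where
  smooth : SOF.SmoothMap (d := d) Λ
  principal : IsPrincipalSpinCBundle (m := m) (d := d) m (fun p => (Λ p).base)
  map_action : ∀ (p : P) (X : SpinC m) (y : Euc m),
    (Λ (MulOpposite.op X • p)).vec y = (Λ p).vec (rot X y)
  smooth_smul : ContMDiffSMul (𝓡 r) (𝓡 d) ∞ G P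
  map_smul : ∀ (a : G) (p : P) (y : Euc m),
    (Λ (a • p)).vec y = tangentMap (𝓡 m) (𝓡 m) (fun x : M => a • x) ((Λ p).vec y)
  commute : ∀ (a : G) (p : P) (X : SpinC m),
    a • (MulOpposite.op X • p) = MulOpposite.op X • (a • p)

/-- `(P, θ)`, with the structure map `Λ : P → SOF(M)` of `P`, is a `G`-equivariant spin^c
prequantization for `(M, Ω)`, with respect to the metric `g` and the orientation `o`. The Lie
algebra `u(1)` is `iℝ ⊆ ℂ`. -/
structure IsSpinCPrequantization [IsManifold (𝓡 m) ∞ M] [MulAction (SpinC m)ᵐᵒᵖ P]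
    (g : Metric m M) (o : Orient m M) (Ω : Form m M 2 ℝ) (Λ : P → SOF g o) (θ : Form d P 1 ℂ) :
    Prop where
  /-- `G` acts by orientation preserving isometries -/
  action : IsOrientedRiemannianAction (r := r) G g o
  /-- `Ω` is a smooth, closed, `G`-invariant two-form -/
  smooth_omega : Ω.Smooth
  closed_omega : Ω.d = 0
  invariant_omega : ∀ a : G, Form.pullback (fun x : M => a • x) Ω = Ω
  /-- `P → SOF(M) → M` is a `G`-equivariant spin^c structure -/
  spinC : IsEquivariantSpinCStructure (r := r) (d := d) G Λ
  /-- `θ` is a smooth one-form with values in `u(1)` -/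
  smooth_theta : θ.Smooth
  imaginary : ∀ (p : P) (u : Fin 1 → TangentSpace (𝓡 d) p), (θ p u).re = 0
  /-- `θ` reproduces the generators of the circle action on `P → SOF(M)`; together with the
  invariance under `U(1) ⊆ Spin^c(m)` this says that `θ` is a connection on `P → SOF(M)` -/
  connection : ∀ (p : P) (b : ℝ),
    θ _ ![orbitVelocity (d := d) p (fun t => circleIncl m (Circle.exp (t * b)))] = b * Complex.I
  /-- `θ` is invariant under `G` and under `Spin^c(m)` -/
  invariant_G : ∀ a : G, Form.pullback (fun p : P => a • p) θ = θ
  invariant_spinC : ∀ X : SpinC m, Form.pullback (fun p : P => MulOpposite.op X • p) θ = θ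
  /-- `θ(ζ_P) = 0` for `ζ ∈ spin(m)` -/
  vanishes_spin : ∀ (p : P) (γ : ℝ → SpinC m), IsSpinOneParameterSubgroup γ →
    θ _ ![orbitVelocity (d := d) p γ] = 0
  /-- `dθ = π^*(-i Ω)` -/
  curvature : θ.d = Form.pullback (fun p => (Λ p).base) Ω.negI

end Prequantization

/-! ### Co-oriented hypersurfaces and the restriction of a spin^c structure -/

/-- The map `w ↦ Ω(L w₁, …, L w_n, v)`. -/
def contractLast {V W : Type*} [AddCommGroup V] [Module ℝ V] [AddCommGroup W] [Module ℝ W] {n : ℕ}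
    (Ω : W [⋀^Fin (n + 1)]→ₗ[ℝ] ℝ) (L : V →ₗ[ℝ] W) (v : W) : V [⋀^Fin n]→ₗ[ℝ] ℝ where
  toFun w := Ω (Fin.snoc (α := fun _ => W) (fun i => L (w i)) v)
  map_update_add' := by
    intro inst w i x y
    obtain rfl : inst = instDecidableEqFin n := Subsingleton.elim _ _
    have h : ∀ z, Fin.snoc (α := fun _ => W) (fun j => L (Function.update w i z j)) v =
        Function.update (Fin.snoc (α := fun _ => W) (fun j => L (w j)) v) i.castSucc (L z) := by
      intro z
      rw [← Fin.snoc_update]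
      congr 1
      funext j
      by_cases hj : j = i
      · subst hj; simp
      · rw [Function.update_of_ne hj, Function.update_of_ne hj]
    simp only [h, map_add, AlternatingMap.map_update_add]
  map_update_smul' := by
    intro inst w i c y
    obtain rfl : inst = instDecidableEqFin n := Subsingleton.elim _ _
    have h : ∀ z, Fin.snoc (α := fun _ => W) (fun j => L (Function.update w i z j)) v =
        Function.update (Fin.snoc (α := fun _ => W) (fun j => L (w j)) v) i.castSucc (L z) := by
      intro z
      rw [← Fin.snoc_update]
      congr 1
      funext j
      by_cases hj : j = i
      · subst hj; simp
      · rw [Function.update_of_ne hj, Function.update_of_ne hj]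
    simp only [h, map_smul, AlternatingMap.map_update_smul]
  map_eq_zero_of_eq' := by
    intro w i j hw hij
    refine Ω.map_eq_zero_of_eq _ (i := i.castSucc) (j := j.castSucc) ?_ ?_
    · simp [hw]
    · simpa using hij

open Classical in
/-- The orientation on `V` induced by the orientation `o` on `W`, an injection `L : V → W` of
codimension one and a transversal vector `v`: a tuple `w` is positive if and only if
`(L w₁, …, L w_n, v)` is positive (see `positiveTuple_inducedOrientation`). The last argument is a
junk value, which is only used if `L` is not injective or `v` not transversal. -/
def inducedOrientation {V W : Type*} [AddCommGroup V] [Module ℝ V] [AddCommGroup W] [Module ℝ W]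
    {n : ℕ} (o : Orientation ℝ W (Fin (n + 1))) (L : V →ₗ[ℝ] W) (v : W)
    (junk : Orientation ℝ V (Fin n)) : Orientation ℝ V (Fin n) :=
  if h : contractLast o.someVector L v ≠ 0 then rayOfNeZero ℝ _ h else junk

theorem positiveTuple_rayOfNeZero {V : Type*} [AddCommGroup V] [Module ℝ V] {k : ℕ}
    {Ω : V [⋀^Fin k]→ₗ[ℝ] ℝ} (hΩ : Ω ≠ 0) (w : Fin k → V) :
    PositiveTuple (rayOfNeZero ℝ Ω hΩ) w ↔ 0 < Ω w := by
  constructor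
  · rintro ⟨Ω', hΩ', h, hw⟩
    obtain ⟨a, b, ha, hb, hab⟩ := ((ray_eq_iff hΩ hΩ').1 h).exists_pos hΩ hΩ'
    have := congrArg (fun f => f w) hab
    simp only [AlternatingMap.smul_apply, smul_eq_mul] at this
    have h2 : 0 < a * Ω w := this ▸ mul_pos hb hw
    exact pos_of_mul_pos_right h2 ha.le
  · exact fun h => ⟨Ω, hΩ, rfl, h⟩

theorem positiveTuple_inducedOrientation {V W : Type*} [AddCommGroup V] [Module ℝ V]
    [AddCommGroup W] [Module ℝ W] {n : ℕ} (o : Orientation ℝ W (Fin (n + 1))) (L : V →ₗ[ℝ] W)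
    (v : W) (junk : Orientation ℝ V (Fin n)) (h : contractLast o.someVector L v ≠ 0)
    (w : Fin n → V) :
    PositiveTuple (inducedOrientation o L v junk) w ↔
      PositiveTuple o (Fin.snoc (α := fun _ => W) (fun i => L (w i)) v) := by
  have ho : o = rayOfNeZero ℝ o.someVector o.someVector_ne_zero := o.someVector_ray.symm
  rw [inducedOrientation, dif_pos h, positiveTuple_rayOfNeZero]
  conv_rhs => rw [ho]
  rw [positiveTuple_rayOfNeZero]
  rfl

section Hypersurface

variable {n : ℕ} {M Z : Type*} [TopologicalSpace M] [ChartedSpace (Euc (n + 1)) M]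
  [TopologicalSpace Z] [ChartedSpace (Euc n) Z]

/-- The metric on `Z` induced by the metric `g` on `M` along `ι : Z → M`. -/
def inducedMetric (g : Metric (n + 1) M) (ι : Z → M) : Metric n Z :=
  fun z => LinearMap.BilinForm.comp (g (ι z)) (mfderiv (𝓡 n) (𝓡 (n + 1)) ι z).toLinearMap
    (mfderiv (𝓡 n) (𝓡 (n + 1)) ι z).toLinearMap

/-- The orientation on `Z` induced by the orientation `o` of `M` and a normal field `ν`: a tuple `w`
in `T_z Z` is positive if and only if `(dι(w₁), …, dι(w_n), ν(z))` is positive. -/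
def inducedOrient (o : Orient (n + 1) M) (ι : Z → M) (ν : ∀ z, TangentSpace (𝓡 (n + 1)) (ι z)) :
    Orient n Z :=
  fun z => inducedOrientation (o (ι z)) (mfderiv (𝓡 n) (𝓡 (n + 1)) ι z).toLinearMap (ν z)
    (EuclideanSpace.basisFun (Fin n) ℝ).toBasis.orientation

/-- `ν` is a smooth field of unit vectors along `ι : Z → M` orthogonal to `TZ`. A co-orientation of
the hypersurface `Z` is the same thing as such a field, the field of positive unit normals. -/
structure IsUnitNormalField [IsManifold (𝓡 (n + 1)) ∞ M] (g : Metric (n + 1) M) (ι : Z → M)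
    (ν : ∀ z, TangentSpace (𝓡 (n + 1)) (ι z)) : Prop where
  smooth : ContMDiff (𝓡 n) (𝓡 (n + 1)).tangent ∞
    (fun z => (⟨ι z, ν z⟩ : TangentBundle (𝓡 (n + 1)) M))
  unit : ∀ z, g (ι z) (ν z) (ν z) = 1
  orthogonal : ∀ z (u : TangentSpace (𝓡 n) z),
    g (ι z) (mfderiv (𝓡 n) (𝓡 (n + 1)) ι z u) (ν z) = 0

/-- The projection `ℝ^(n+1) → ℝ^n` onto the first `n` coordinates. -/
def dropLast (n : ℕ) : Euc (n + 1) →ₗ[ℝ] Euc n where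
  toFun a := WithLp.toLp 2 (fun i : Fin n => a i.castSucc)
  map_add' a b := by ext i; simp
  map_smul' c a := by ext i; simp

variable {g : Metric (n + 1) M} {o : Orient (n + 1) M} {ι : Z → M}
  {ν : ∀ z, TangentSpace (𝓡 (n + 1)) (ι z)}

/-- The linear map `ℝ^(n+1) → T_(ι z) M`, `a ↦ dι(f(a₁, …, a_n)) + a_(n+1) ν(z)`, for a frame `f` of
`Z` at `z`. -/
def extendFrame (f : SOF (inducedMetric g ι) (inducedOrient o ι ν)) :
    Euc (n + 1) →ₗ[ℝ] TangentSpace (𝓡 (n + 1)) (ι f.base) :=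
  (mfderiv (𝓡 n) (𝓡 (n + 1)) ι f.base).toLinearMap ∘ₗ f.frame ∘ₗ dropLast n +
    LinearMap.toSpanSingleton ℝ (TangentSpace (𝓡 (n + 1)) (ι f.base)) (ν f.base) ∘ₗ
      (EuclideanSpace.proj (Fin.last n) : Euc (n + 1) →L[ℝ] ℝ).toLinearMap

theorem extendFrame_apply (f : SOF (inducedMetric g ι) (inducedOrient o ι ν)) (a : Euc (n + 1)) :
    extendFrame f a = mfderiv (𝓡 n) (𝓡 (n + 1)) ι f.base (f.frame (dropLast n a)) +
      a (Fin.last n) • ν f.base := rfl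

theorem extendFrame_isometry [IsManifold (𝓡 (n + 1)) ∞ M] (hg : IsRiemannianMetric g)
    (hν : IsUnitNormalField g ι ν) (f : SOF (inducedMetric g ι) (inducedOrient o ι ν))
    (a b : Euc (n + 1)) :
    g (ι f.base) (extendFrame f a) (extendFrame f b) = ⟪a, b⟫ := by
  obtain ⟨γ, hγ⟩ := hg
  have hsymm : ∀ x u w, g x u w = g x w u := fun x u w => by rw [← hγ, ← hγ, γ.symm]
  have h1 := f.isometry (dropLast n a) (dropLast n b)
  have h2 := hν.orthogonal f.base (f.frame (dropLast n a))
  have h3 := hν.orthogonal f.base (f.frame (dropLast n b))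
  have h4 := hν.unit f.base
  rw [hsymm] at h3
  change g (ι f.base) (mfderiv (𝓡 n) (𝓡 (n + 1)) ι f.base (f.frame (dropLast n a)))
    (mfderiv (𝓡 n) (𝓡 (n + 1)) ι f.base (f.frame (dropLast n b))) = _ at h1
  rw [extendFrame_apply, extendFrame_apply, map_add, map_smul, map_add, map_smul,
    LinearMap.add_apply, LinearMap.add_apply, LinearMap.smul_apply, LinearMap.smul_apply, h1, h2,
    h3, h4]
  simp [PiLp.inner_apply, Fin.sum_univ_castSucc, dropLast]

theorem extendFrame_basis (f : SOF (inducedMetric g ι) (inducedOrient o ι ν)) :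
    (fun i => extendFrame f (EuclideanSpace.basisFun (Fin (n + 1)) ℝ i)) =
      Fin.snoc (α := fun _ => TangentSpace (𝓡 (n + 1)) (ι f.base))
        (fun i => (mfderiv (𝓡 n) (𝓡 (n + 1)) ι f.base).toLinearMap
          (f.frame (EuclideanSpace.basisFun (Fin n) ℝ i))) (ν f.base) := by
  funext i
  refine Fin.lastCases ?_ (fun j => ?_) i
  · have h : dropLast n (EuclideanSpace.basisFun (Fin (n + 1)) ℝ (Fin.last n)) = 0 := by
      ext j; simp [dropLast, Fin.castSucc_ne_last]
    rw [extendFrame_apply, h, Fin.snoc_last, map_zero, map_zero, zero_add]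
    simp
  · have h : dropLast n (EuclideanSpace.basisFun (Fin (n + 1)) ℝ j.castSucc) =
        EuclideanSpace.basisFun (Fin n) ℝ j := by
      ext i; simp [dropLast]
    rw [extendFrame_apply, h, Fin.snoc_castSucc]
    simp

theorem extendFrame_positive [IsManifold (𝓡 (n + 1)) ∞ M] (hg : IsRiemannianMetric g)
    (hν : IsUnitNormalField g ι ν) (f : SOF (inducedMetric g ι) (inducedOrient o ι ν)) :
    PositiveTuple (o (ι f.base))
      (fun i => extendFrame f (EuclideanSpace.basisFun (Fin (n + 1)) ℝ i)) := by
  have hli : LinearIndependent ℝ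
      (fun i => extendFrame f (EuclideanSpace.basisFun (Fin (n + 1)) ℝ i)) := by
    refine LinearMap.BilinForm.linearIndependent_of_iIsOrtho (B := g (ι f.base)) ?_ ?_
    · rw [LinearMap.BilinForm.iIsOrtho_def]
      intro i j hij
      rw [extendFrame_isometry hg hν]
      exact (EuclideanSpace.basisFun (Fin (n + 1)) ℝ).inner_eq_zero hij
    · intro i hi
      change g (ι f.base) (extendFrame f (EuclideanSpace.basisFun (Fin (n + 1)) ℝ i))
        (extendFrame f (EuclideanSpace.basisFun (Fin (n + 1)) ℝ i)) = 0 at hi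
      rw [extendFrame_isometry hg hν] at hi
      exact one_ne_zero (((EuclideanSpace.basisFun (Fin (n + 1)) ℝ).inner_eq_one i).symm.trans hi)
  let B : Module.Basis (Fin (n + 1)) ℝ (TangentSpace (𝓡 (n + 1)) (ι f.base)) :=
    basisOfLinearIndependentOfCardEqFinrank hli
      ((Fintype.card_fin _).trans (finrank_euclideanSpace_fin (𝕜 := ℝ) (n := n + 1)).symm)
  have hB : ⇑B = fun i => extendFrame f (EuclideanSpace.basisFun (Fin (n + 1)) ℝ i) :=
    coe_basisOfLinearIndependentOfCardEqFinrank _ _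
  have hne : (o (ι f.base)).someVector B ≠ 0 := by
    intro h
    exact (o (ι f.base)).someVector_ne_zero
      ((AlternatingMap.map_basis_eq_zero_iff B _).1 h)
  rw [hB, extendFrame_basis] at hne
  rw [extendFrame_basis]
  refine (positiveTuple_inducedOrientation (o (ι f.base))
    (mfderiv (𝓡 n) (𝓡 (n + 1)) ι f.base).toLinearMap (ν f.base) _ (fun h => hne ?_) _).1 f.positive
  exact congrArg (fun F => F fun i => f.frame (EuclideanSpace.basisFun (Fin n) ℝ i)) h

/-- The natural map `i : SOF(Z) → SOF(M)`, `i(f)(a) = dι(f(a₁, …, a_n)) + a_(n+1) ν`. -/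
def frameInclusion [IsManifold (𝓡 (n + 1)) ∞ M] (hg : IsRiemannianMetric g)
    (hν : IsUnitNormalField g ι ν) (f : SOF (inducedMetric g ι) (inducedOrient o ι ν)) :
    SOF g o where
  base := ι f.base
  frame := extendFrame f
  isometry := extendFrame_isometry hg hν f
  positive := extendFrame_positive hg hν f

/-- The pullback `P_Z = i^*(P)` of `Λ : P → SOF(M)` under `i : SOF(Z) → SOF(M)`: the space of pairs
`(f, p)` with `i(f) = Λ(p)`. -/
abbrev PullbackSpace [IsManifold (𝓡 (n + 1)) ∞ M] [IsManifold (𝓡 n) ∞ Z]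
    (hg : IsRiemannianMetric g) (hν : IsUnitNormalField g ι ν) {P : Type*} (Λ : P → SOF g o) :
    Type _ :=
  {q : SOF (inducedMetric g ι) (inducedOrient o ι ν) × P // frameInclusion hg hν q.1 = Λ q.2}

end Hypersurface

/-- The dimension of the total space of a principal `Spin^c(m)`-bundle on an `m`-manifold: the group
`Spin^c(m)` has dimension `m(m-1)/2 + 1`. -/
abbrev spinCBundleDim (m : ℕ) : ℕ := m + (m.choose 2 + 1)

end SpinCPreq

end

open scoped Manifold ContDiff TensorProduct RealInnerProductSpace

noncomputable section

namespace SpinCPreq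

/-! ### Algebra of the spin^c groups -/

/-! Write e for the last basis vector of ℝ^(n+1). A frame of M at ι z whose last vector is ν(z) maps
ℝ^n isometrically onto the orthogonal complement of ν(z), which is T_zZ by dimension, and it is
positive exactly when its restriction to ℝ^n is. It therefore comes from a unique frame of Z. Hence
i' is injective, and its image consists of the points p whose frame Λ(p) sends e to some ν(z)
(`exists_frameInclusion_eq`, `mem_range_snd_iff`). This image is preserved by G because ν is
invariant, and by Spin^c(n) because Spin^c(n) fixes e. So both actions on P_Z are restrictions of
actions on P.

For the smooth structure, P is trivialized near a point of Z by a section s whose frames have last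
vector ν along Z. Such sections exist because Spin^c(n+1) acts transitively on the unit sphere, with
smooth local sections (`exists_rotor`, `exists_adapted_trivialization`). Writing p = s(x)·τ, the
image of P_Z is given by two conditions: x lies in Z, and λ^c(τ) fixes e. The first is one equation.
The second says that the point λ^c(τ)e of the upper hemisphere has vanishing first n coordinates.
Together they are the zero set of a submersion to ℝ × ℝ^n (`exists_slice_chart`), so P_Z is cut out
by slice charts and is an embedded submanifold (`exists_isSmoothEmbedding_of_slices`).

The structure group is Spin^c(n) because that is the whole stabilizer of e (`exists_spinCIncl_eq`).
Up to the scalar in U(1), an element is a product of unit vectors, and all of them but the first can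
be moved into ℝ^n; commuting with e then forces the first one into ℝ^n too. Consequently the adapted
trivializations of P restrict to trivializations of P_Z (`IsRestriction.principal`).

The rest is naturality. Smoothness of a map into P_Z, Z or TZ can be tested in P, M or TM by means
of local smooth retractions. The exterior derivative commutes with pullback (`Form.d_pullback`), i'
carries the infinitesimal action of Spin^c(n) to that of Spin^c(n+1) (`tangentMap_orbitVelocity`),
and the projections of P_Z and P are intertwined by ι. So each condition on θ restricts to θ_Z
(`IsSpinCPrequantization.restrict`). -/

theorem ι_mul_self {k : ℕ} (v : Euc k) :
    CliffordAlgebra.ι (negSq k) v * CliffordAlgebra.ι (negSq k) v =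
      algebraMap ℝ (Cl k) (-‖v‖ ^ 2) := by
  rw [CliffordAlgebra.ι_sq_scalar, negSq_apply]

theorem polar_negSq {k : ℕ} (v w : Euc k) :
    QuadraticMap.polar (negSq k) v w = -(2 * ⟪v, w⟫) := by
  rw [QuadraticMap.polar, negSq_apply, negSq_apply, negSq_apply, norm_add_sq_real]
  ring

/-- Nontriviality makes the scalars ℝ embed in the algebra, so that norms can be read off from
squares of vectors. -/
instance (k : ℕ) : Nontrivial (Cl k) := (clBasis k).repr.toEquiv.nontrivial

instance (k : ℕ) : Nontrivial (ClC k) := (clCBasis k).repr.toEquiv.nontrivial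

instance (k : ℕ) : FiniteDimensional ℝ (ClC k) := (clCBasis k).finiteDimensional_of_finite

/-- The inclusion `ℝ^k ⊆ C_k ⊗ ℂ` as a linear map. -/
def vecCL (k : ℕ) : Euc k →ₗ[ℝ] ClC k :=
  (Algebra.TensorProduct.includeRight : Cl k →ₐ[ℝ] ClC k).toLinearMap ∘ₗ
    CliffordAlgebra.ι (negSq k)

@[simp] theorem vecCL_apply {k : ℕ} (v : Euc k) : vecCL k v = vecC v := rfl

theorem vecC_mul_self {k : ℕ} (v : Euc k) :
    vecC v * vecC v = algebraMap ℝ (ClC k) (-‖v‖ ^ 2) := by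
  rw [vecC, Algebra.TensorProduct.tmul_mul_tmul, ι_mul_self, mul_one]
  exact (Algebra.TensorProduct.includeRight : Cl k →ₐ[ℝ] ClC k).commutes _

theorem ι_mul_self_of_unit {k : ℕ} {v : Euc k} (hv : ‖v‖ = 1) :
    CliffordAlgebra.ι (negSq k) v * CliffordAlgebra.ι (negSq k) v = -1 := by
  rw [ι_mul_self, hv]; simp

theorem vecC_mul_vecC {k : ℕ} (v w : Euc k) : vecC v * vecC w =
    (1 : ℂ) ⊗ₜ[ℝ] (CliffordAlgebra.ι (negSq k) v * CliffordAlgebra.ι (negSq k) w) := by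
  simp [vecC]

theorem ι_mul_ι_mul_rev {k : ℕ} {u w : Euc k} (hu : ‖u‖ = 1) (hw : ‖w‖ = 1) :
    CliffordAlgebra.ι (negSq k) u * CliffordAlgebra.ι (negSq k) w *
      (CliffordAlgebra.ι (negSq k) w * CliffordAlgebra.ι (negSq k) u) = 1 := by
  rw [mul_assoc, ← mul_assoc (CliffordAlgebra.ι (negSq k) w), ι_mul_self_of_unit hw, neg_one_mul,
    mul_neg, ι_mul_self_of_unit hu, neg_neg]

theorem vecCL_injective (k : ℕ) : Function.Injective (vecCL k) := by
  rw [← LinearMap.ker_eq_bot, LinearMap.ker_eq_bot']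
  intro v hv
  have h := vecC_mul_self v
  rw [vecCL_apply] at hv
  rw [hv, zero_mul, eq_comm, map_eq_zero_iff _ (algebraMap ℝ (ClC k)).injective] at h
  simpa using h

theorem vecC_injective (k : ℕ) : Function.Injective (vecC : Euc k → ClC k) := vecCL_injective k

theorem toClC_mul {k : ℕ} (X Y : SpinC k) : toClC (X * Y) = toClC X * toClC Y := rfl

@[simp] theorem toClC_one {k : ℕ} : toClC (1 : SpinC k) = 1 := rfl

theorem toClC_injective (k : ℕ) : Function.Injective (toClC : SpinC k → ClC k) :=
  fun _ _ h => Subtype.ext (Units.ext h)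

@[simp] theorem toClC_mul_inv {k : ℕ} (X : SpinC k) : toClC X * toClC X⁻¹ = 1 := by
  rw [← toClC_mul, mul_inv_cancel, toClC_one]

@[simp] theorem toClC_inv_mul {k : ℕ} (X : SpinC k) : toClC X⁻¹ * toClC X = 1 := by
  rw [← toClC_mul, inv_mul_cancel, toClC_one]

/-! #### The covering `λ^c` -/

/-- Since `rot` is defined by choice, it is accessible only through injectivity of `vecC`. This
inverse-free criterion is the form in which its values are computed. -/
theorem rot_eq_of_mul {k : ℕ} {X : SpinC k} {y w : Euc k}
    (h : vecC w * toClC X = toClC X * vecC y) : rot X y = w := by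
  apply vecC_injective
  rw [vecC_rot, ← h, mul_assoc, toClC_mul_inv, mul_one]

theorem vecC_rot_mul {k : ℕ} (X : SpinC k) (y : Euc k) :
    vecC (rot X y) * toClC X = toClC X * vecC y := by
  rw [vecC_rot, mul_assoc, toClC_inv_mul, mul_one]

@[simp] theorem rot_one {k : ℕ} (y : Euc k) : rot (1 : SpinC k) y = y :=
  rot_eq_of_mul (by simp)

theorem rot_mul {k : ℕ} (X Y : SpinC k) (y : Euc k) : rot (X * Y) y = rot X (rot Y y) :=
  rot_eq_of_mul (by
    rw [toClC_mul, ← mul_assoc, vecC_rot_mul, mul_assoc, vecC_rot_mul, mul_assoc])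

theorem rot_inv_rot {k : ℕ} (X : SpinC k) (y : Euc k) : rot X⁻¹ (rot X y) = y := by
  rw [← rot_mul, inv_mul_cancel, rot_one]

/-- The square of a vector is the scalar -‖y‖², which is central and hence unchanged by conjugation.
-/
theorem norm_rot {k : ℕ} (X : SpinC k) (y : Euc k) : ‖rot X y‖ = ‖y‖ := by
  have h : vecC (rot X y) * vecC (rot X y) = vecC y * vecC y := by
    rw [vecC_mul_self y, vecC_rot, show ∀ a b c : ClC k, a * b * c * (a * b * c) =
      a * (b * (c * a) * b) * c from fun a b c => by simp only [mul_assoc], toClC_inv_mul, mul_one,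
      vecC_mul_self, ← Algebra.commutes, mul_assoc, toClC_mul_inv, mul_one]
  rw [vecC_mul_self, vecC_mul_self] at h
  have h := (algebraMap ℝ (ClC k)).injective h
  exact (sq_eq_sq₀ (norm_nonneg _) (norm_nonneg _)).1 (neg_injective h)

/-! #### Reflections -/

/-- The reflection in the hyperplane orthogonal to the unit vector `u`. -/
def refl {k : ℕ} (u y : Euc k) : Euc k := y - (2 * ⟪u, y⟫) • u

/-- As u² = -1, the inverse of u is -u. So u y u is minus the conjugate of y by u, which is the
reflection itself without a sign. -/
theorem ι_mul_ι_mul_ι_of_unit {k : ℕ} {u : Euc k} (hu : ‖u‖ = 1) (y : Euc k) :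
    CliffordAlgebra.ι (negSq k) u * CliffordAlgebra.ι (negSq k) y * CliffordAlgebra.ι (negSq k) u =
      CliffordAlgebra.ι (negSq k) (refl u y) := by
  rw [CliffordAlgebra.ι_mul_ι_mul_ι, polar_negSq, negSq_apply, hu, refl]
  congr 1
  module

theorem vecC_mul_vecC_mul_vecC {k : ℕ} {u : Euc k} (hu : ‖u‖ = 1) (y : Euc k) :
    vecC u * vecC y * vecC u = vecC (refl u y) := by
  simp only [vecC, Algebra.TensorProduct.tmul_mul_tmul, mul_one, ι_mul_ι_mul_ι_of_unit hu]

/-- The element `u w` of `Spin(k)`, for unit vectors `u` and `w`. -/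
def vecPair {k : ℕ} (u w : Euc k) (hu : ‖u‖ = 1) (hw : ‖w‖ = 1) : SpinC k :=
  ⟨⟨vecC u * vecC w, vecC w * vecC u,
    by simp [vecC_mul_vecC, ι_mul_ι_mul_rev hu hw, Algebra.TensorProduct.one_def],
    by simp [vecC_mul_vecC, ι_mul_ι_mul_rev hw hu, Algebra.TensorProduct.one_def]⟩,
    1, CliffordAlgebra.ι (negSq k) u * CliffordAlgebra.ι (negSq k) w,
    ⟨[u, w], by simp [hu, hw], by simp, by simp⟩, by simp [vecC]⟩

theorem rot_vecPair {k : ℕ} {u w : Euc k} (hu : ‖u‖ = 1) (hw : ‖w‖ = 1) (y : Euc k) :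
    rot (vecPair u w hu hw) y = refl u (refl w y) := by
  apply vecC_injective
  rw [vecC_rot, ← vecC_mul_vecC_mul_vecC hu, ← vecC_mul_vecC_mul_vecC hw]
  change vecC u * vecC w * vecC y * (vecC w * vecC u) = _
  simp only [mul_assoc]

/-- Two vectors of equal length are mirror images in the hyperplane that bisects them, whose normal
is c - b. -/
theorem refl_normalize_sub {k : ℕ} {c b : Euc k} (h : ‖c‖ = ‖b‖) (hcb : c ≠ b) :
    refl (‖c - b‖⁻¹ • (c - b)) c = b := by
  have h0 : ‖c - b‖ ≠ 0 := norm_ne_zero_iff.2 (sub_ne_zero.2 hcb)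
  have h1 : ‖c - b‖ ^ 2 = 2 * ⟪c - b, c⟫ := by
    rw [norm_sub_sq_real, inner_sub_left, real_inner_self_eq_norm_sq, ← h, real_inner_comm]; ring
  have h2 : 2 * (‖c - b‖⁻¹ * ⟪c - b, c⟫) * ‖c - b‖⁻¹ = 1 := by
    field_simp; linarith
  rw [refl, real_inner_smul_left, smul_smul, h2, one_smul, sub_sub_cancel]

/-! #### The inclusion `Spin^c(n) → Spin^c(n+1)` -/

/-- The last standard basis vector of `ℝ^(n+1)`. -/
def eLast (n : ℕ) : Euc (n + 1) := EuclideanSpace.single (Fin.last n) 1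

@[simp] theorem norm_eLast (n : ℕ) : ‖eLast n‖ = 1 := by simp [eLast]

@[simp] theorem inner_eLast {n : ℕ} (y : Euc (n + 1)) : ⟪y, eLast n⟫ = y (Fin.last n) := by
  simp [eLast, EuclideanSpace.inner_single_right]

@[simp] theorem appendZero_last {n : ℕ} (a : Euc n) : appendZero n a (Fin.last n) = 0 := by
  simp [appendZero]

@[simp] theorem appendZero_castSucc {n : ℕ} (a : Euc n) (i : Fin n) :
    appendZero n a i.castSucc = a i := by
  simp [appendZero]

@[simp] theorem dropLast_appendZero {n : ℕ} (a : Euc n) : dropLast n (appendZero n a) = a := by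
  ext i; simp [dropLast]

@[simp] theorem dropLast_eLast (n : ℕ) : dropLast n (eLast n) = 0 := by
  ext i; simp [dropLast, eLast]

@[simp] theorem eLast_last (n : ℕ) : eLast n (Fin.last n) = 1 := by simp [eLast]

theorem appendZero_dropLast_add {n : ℕ} (y : Euc (n + 1)) :
    appendZero n (dropLast n y) + y (Fin.last n) • eLast n = y := by
  ext i
  refine Fin.lastCases ?_ (fun j => ?_) i <;> simp [dropLast, eLast]

theorem appendZero_dropLast {n : ℕ} {y : Euc (n + 1)} (h : y (Fin.last n) = 0) :
    appendZero n (dropLast n y) = y := by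
  simpa [h] using appendZero_dropLast_add y

@[simp] theorem clIncl_ι {n : ℕ} (a : Euc n) : clIncl n (CliffordAlgebra.ι (negSq n) a) =
    CliffordAlgebra.ι (negSq (n + 1)) (appendZero n a) := by
  simp only [clIncl, CliffordAlgebra.map_apply_ι]; rfl

theorem norm_sq_eq_dropLast {n : ℕ} (y : Euc (n + 1)) :
    ‖y‖ ^ 2 = ‖dropLast n y‖ ^ 2 + y (Fin.last n) ^ 2 := by
  simp [EuclideanSpace.norm_sq_eq, Fin.sum_univ_castSucc, dropLast]

/-- The image of a vector under the representation of `C_(n+1)` by `2 × 2`-matrices over `C_n`. -/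
def vecMatrix (n : ℕ) : Euc (n + 1) →ₗ[ℝ] Matrix (Fin 2) (Fin 2) (Cl n) where
  toFun v := !![CliffordAlgebra.ι (negSq n) (dropLast n v), -algebraMap ℝ (Cl n) (v (Fin.last n));
    algebraMap ℝ (Cl n) (v (Fin.last n)), -CliffordAlgebra.ι (negSq n) (dropLast n v)]
  map_add' v w := by
    rw [map_add, map_add, PiLp.add_apply, map_add, neg_add, neg_add]
    simp
  map_smul' c v := by
    rw [map_smul, map_smul, PiLp.smul_apply, smul_eq_mul, map_mul, ← Algebra.smul_def]
    simp

/-- The off-diagonal entries of the square cancel because the scalar s commutes with a, and both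
diagonal entries are a² - s². This is the Clifford relation for `vecMatrix`. -/
theorem _root_.Matrix.cliffordBlock_mul_self {A : Type*} [Ring A] [Algebra ℝ A] {a : A} {c : ℝ}
    (s : ℝ) (h : a * a = algebraMap ℝ A c) :
    !![a, -algebraMap ℝ A s; algebraMap ℝ A s, -a] *
      !![a, -algebraMap ℝ A s; algebraMap ℝ A s, -a] =
      algebraMap ℝ (Matrix (Fin 2) (Fin 2) A) (c - s * s) := by
  have h2 := Algebra.commutes s a
  rw [Matrix.mul_fin_two, neg_mul_neg, neg_mul, mul_neg, mul_neg, neg_mul, ← h2, add_neg_cancel,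
    neg_add_cancel, h, ← map_mul, neg_add_eq_sub, ← sub_eq_add_neg, ← map_sub]
  ext i j
  fin_cases i <;> fin_cases j <;> simp [Matrix.algebraMap_matrix_apply, h]

theorem vecMatrix_mul_self {n : ℕ} (v : Euc (n + 1)) :
    vecMatrix n v * vecMatrix n v =
      algebraMap ℝ (Matrix (Fin 2) (Fin 2) (Cl n)) (negSq (n + 1) v) := by
  have h : negSq (n + 1) v = -‖dropLast n v‖ ^ 2 - v (Fin.last n) * v (Fin.last n) := by
    rw [negSq_apply, norm_sq_eq_dropLast]; ring
  rw [h]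
  exact Matrix.cliffordBlock_mul_self _ (ι_mul_self _)

/-- The representation of `C_(n+1)` by `2 × 2`-matrices over `C_n`. -/
def clMatrix (n : ℕ) : Cl (n + 1) →ₐ[ℝ] Matrix (Fin 2) (Fin 2) (Cl n) :=
  CliffordAlgebra.lift (negSq (n + 1)) ⟨vecMatrix n, vecMatrix_mul_self⟩

/-- On C_n the matrix representation is diagonal, and its upper left entry recovers x. This yields
the left inverse `clProj`, hence injectivity of C_n → C_(n+1). -/
theorem clMatrix_clIncl {n : ℕ} (x : Cl n) :
    clMatrix n (clIncl n x) = !![x, 0; 0, CliffordAlgebra.involute x] := by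
  induction x using CliffordAlgebra.induction with
  | algebraMap c =>
    rw [AlgHom.commutes, AlgHom.commutes, AlgHom.commutes]
    ext i j; fin_cases i <;> fin_cases j <;> simp [Matrix.algebraMap_matrix_apply]
  | ι a =>
    rw [clIncl_ι, clMatrix, CliffordAlgebra.lift_ι_apply]
    simp [vecMatrix]
  | mul a b ha hb => rw [map_mul, map_mul, ha, hb]; simp
  | add a b ha hb => rw [map_add, map_add, ha, hb]; simp

/-- A linear left inverse of `C_n → C_(n+1)`. -/
def clProj (n : ℕ) : Cl (n + 1) →ₗ[ℝ] Cl n where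
  toFun x := clMatrix n x 0 0
  map_add' x y := by simp
  map_smul' c x := by simp

theorem clProj_clIncl {n : ℕ} (x : Cl n) : clProj n (clIncl n x) = x := by
  simp [clProj, clMatrix_clIncl]

/-- A linear left inverse of `C_n ⊗ ℂ → C_(n+1) ⊗ ℂ`. -/
def clCProj (n : ℕ) : ClC (n + 1) →ₗ[ℝ] ClC n :=
  TensorProduct.map LinearMap.id (clProj n)

/-- The inclusion `C_n ⊗ ℂ → C_(n+1) ⊗ ℂ`. -/
def clCIncl (n : ℕ) : ClC n →ₐ[ℝ] ClC (n + 1) :=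
  Algebra.TensorProduct.map (AlgHom.id ℝ ℂ) (clIncl n)

theorem clCProj_clCIncl {n : ℕ} (x : ClC n) : clCProj n (clCIncl n x) = x := by
  induction x using TensorProduct.induction_on with
  | zero => simp
  | tmul a b => simp [clCProj, clCIncl, clProj_clIncl]
  | add a b ha hb => rw [map_add, map_add, ha, hb]

theorem toClC_spinCIncl {n : ℕ} (X : SpinC n) : toClC (spinCIncl n X) = clCIncl n (toClC X) := rfl

theorem spinCIncl_injective (n : ℕ) : Function.Injective (spinCIncl n) := by
  intro X Y h
  apply toClC_injective
  rw [← clCProj_clCIncl (toClC X), ← toClC_spinCIncl, h, toClC_spinCIncl, clCProj_clCIncl]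

theorem clCIncl_vecC {n : ℕ} (a : Euc n) : clCIncl n (vecC a) = vecC (appendZero n a) := by
  simp [clCIncl, vecC]

theorem rot_spinCIncl_appendZero {n : ℕ} (X : SpinC n) (a : Euc n) :
    rot (spinCIncl n X) (appendZero n a) = appendZero n (rot X a) := by
  apply rot_eq_of_mul
  rw [toClC_spinCIncl, ← clCIncl_vecC, ← clCIncl_vecC, ← map_mul, ← map_mul, vecC_rot_mul]

theorem spinCIncl_circleIncl {n : ℕ} (c : Circle) :
    spinCIncl n (circleIncl n c) = circleIncl (n + 1) c := by
  apply toClC_injective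
  rw [toClC_spinCIncl]
  change clCIncl n ((c : ℂ) ⊗ₜ[ℝ] 1) = (c : ℂ) ⊗ₜ[ℝ] 1
  simp [clCIncl]

theorem InSpin.spinCIncl {n : ℕ} {X : SpinC n} (h : InSpin X) : InSpin (spinCIncl n X) := by
  obtain ⟨x, hx, h⟩ := h
  exact ⟨clIncl n x, clIncl_mem_spinSet hx, by simp [toClC_spinCIncl, h, clCIncl]⟩

theorem ι_mul_ι_eLast {n : ℕ} (u : Euc (n + 1)) :
    CliffordAlgebra.ι (negSq (n + 1)) u * CliffordAlgebra.ι (negSq (n + 1)) (eLast n) +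
      CliffordAlgebra.ι (negSq (n + 1)) (eLast n) * CliffordAlgebra.ι (negSq (n + 1)) u =
      algebraMap ℝ _ (-(2 * u (Fin.last n))) := by
  rw [CliffordAlgebra.ι_mul_ι_add_swap, polar_negSq, inner_eLast]

/-- The vector e anticommutes with every vector of ℝ^n, so each factor that it passes contributes a
sign. -/
theorem clIncl_prod_mul_eLast {n : ℕ} (l : List (Euc n)) :
    clIncl n (l.map (CliffordAlgebra.ι (negSq n))).prod *
      CliffordAlgebra.ι (negSq (n + 1)) (eLast n) =
    (-1) ^ l.length * (CliffordAlgebra.ι (negSq (n + 1)) (eLast n) *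
      clIncl n (l.map (CliffordAlgebra.ι (negSq n))).prod) := by
  induction l with
  | nil => simp
  | cons v l ih =>
    have h := ι_mul_ι_eLast (appendZero n v)
    rw [appendZero_last, mul_zero, neg_zero, map_zero, add_eq_zero_iff_eq_neg] at h
    simp only [List.map_cons, List.prod_cons, map_mul, clIncl_ι, List.length_cons, mul_assoc] at ih ⊢
    rw [ih, pow_succ, mul_neg_one]
    rcases neg_one_pow_eq_or (Cl (n + 1)) l.length with h' | h' <;> rw [h'] <;>
      simp [← mul_assoc, h]

/-- The products in Spin^c(n) have even length, so the signs cancel and e commutes with them. -/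
theorem rot_spinCIncl_eLast {n : ℕ} (X : SpinC n) : rot (spinCIncl n X) (eLast n) = eLast n := by
  apply rot_eq_of_mul
  obtain ⟨u, c, x, ⟨l, hl, hl', rfl⟩, hu⟩ := X
  have h := clIncl_prod_mul_eLast l
  rw [hl'.neg_one_pow, one_mul] at h
  rw [toClC_spinCIncl, toClC, hu]
  simp [clCIncl, vecC, h]

/-- A product of two unit vectors of `ℝ^(n+1)` can be written with the second one in `ℝ^n`. -/
theorem exists_ι_mul_ι {n : ℕ} (hn : 1 ≤ n) {u v : Euc (n + 1)} (hu : ‖u‖ = 1) (hv : ‖v‖ = 1) :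
    ∃ (u' : Euc (n + 1)) (a : Euc n), ‖u'‖ = 1 ∧ ‖a‖ = 1 ∧
      CliffordAlgebra.ι (negSq (n + 1)) u * CliffordAlgebra.ι (negSq (n + 1)) v =
      CliffordAlgebra.ι (negSq (n + 1)) u' *
        CliffordAlgebra.ι (negSq (n + 1)) (appendZero n a) := by
  set ε := CliffordAlgebra.ι (negSq (n + 1)) with hε
  -- it suffices to find a unit vector `v'` in the plane of `u` and `v`, orthogonal to `e`
  have key : ∀ (v' w : Euc (n + 1)), ‖v'‖ = 1 → v' (Fin.last n) = 0 → ε u * ε v * ε v' = ε w →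
      ∃ (u' : Euc (n + 1)) (a : Euc n), ‖u'‖ = 1 ∧ ‖a‖ = 1 ∧
        ε u * ε v = ε u' * ε (appendZero n a) := by
    intro v' w hv' h0 hw
    have hsq : ∀ x : Euc (n + 1), ‖x‖ = 1 → ε x * ε x = -1 := fun x hx => by
      rw [hε, ι_mul_self, hx]; simp
    -- Reversal fixes vectors, so the vector u v v' equals its own reversal v' v u.
    have hrev : ε w = ε v' * ε v * ε u := by
      have := congrArg CliffordAlgebra.reverse hw
      simpa [hε, CliffordAlgebra.reverse_ι, mul_assoc] using this.symm
    have hww : ε w * ε w = -1 := by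
      nth_rw 1 [← hw]
      rw [hrev, show ε u * ε v * ε v' * (ε v' * ε v * ε u) =
        ε u * (ε v * (ε v' * ε v') * ε v) * ε u by simp only [mul_assoc], hsq v' hv']
      simp [hsq v hv, hsq u hu]
    have hw1 : ‖w‖ = 1 := by
      rw [hε, ι_mul_self, show (-1 : Cl (n + 1)) = algebraMap ℝ _ (-1) by simp] at hww
      have := (algebraMap ℝ (Cl (n + 1))).injective hww
      have h2 : ‖w‖ ^ 2 = 1 := neg_injective this
      exact by nlinarith [norm_nonneg w]
    -- Since v'² = -1, the relation u v v' = w gives u v = (-w) v'.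
    refine ⟨-w, dropLast n v', by rw [norm_neg, hw1], ?_, ?_⟩
    · rw [← norm_appendZero, appendZero_dropLast h0, hv']
    · rw [appendZero_dropLast h0, map_neg, ← hw, neg_mul, mul_assoc, hsq v' hv']
      simp
  -- The product of u v with any vector in the span of u and v is again a vector, since u v u is a
  -- reflection of v and v² = -1.
  have hmem : ∀ α β : ℝ, ε u * ε v * ε (α • u + β • v) =
      ε (α • refl u v - β • u) := by
    intro α β
    rw [map_add, mul_add, map_smul, mul_smul_comm, hε, ι_mul_ι_mul_ι_of_unit hu, map_smul,
      mul_smul_comm, mul_assoc, ι_mul_self, hv, map_sub, map_smul, map_smul]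
    simp [sub_eq_add_neg]
  -- The combination of u and v whose last coordinates cancel: it lies in their span and in ℝ^n.
  set w := v (Fin.last n) • u - u (Fin.last n) • v with hwdef
  have hwl : w (Fin.last n) = 0 := by simp [hwdef, mul_comm]
  by_cases hw : w = 0
  · by_cases hvl : v (Fin.last n) = 0
    · exact key v (-u) hv hvl (by simpa using hmem 0 1)
    -- Here u = c v, so u v is the scalar -c and any unit vector of ℝ^n can serve as v'. One exists
    -- because n ≥ 1.
    · have huv : u = (u (Fin.last n) / v (Fin.last n)) • v := by
        have := sub_eq_zero.1 hw
        rw [div_eq_inv_mul, mul_smul, ← this, smul_smul, inv_mul_cancel₀ hvl, one_smul]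
      set c := u (Fin.last n) / v (Fin.last n)
      refine key (appendZero n (EuclideanSpace.single ⟨0, hn⟩ 1))
        (-c • appendZero n (EuclideanSpace.single ⟨0, hn⟩ 1)) (by simp [norm_appendZero])
        (by simp) ?_
      rw [huv, map_smul, smul_mul_assoc, hε, ι_mul_self, hv]
      simp
  · have hw0 : ‖w‖ ≠ 0 := norm_ne_zero_iff.2 hw
    refine key (‖w‖⁻¹ • w)
      ((‖w‖⁻¹ * v (Fin.last n)) • refl u v - (-(‖w‖⁻¹ * u (Fin.last n))) • u)
      (by rw [norm_smul, norm_inv, norm_norm, inv_mul_cancel₀ hw0])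
      (by simp [hwl]) ?_
    have := hmem (‖w‖⁻¹ * v (Fin.last n)) (-(‖w‖⁻¹ * u (Fin.last n)))
    rw [← this, hwdef]
    congr 2
    module

/-- Starting from the right, each step rewrites a product of two unit vectors with its second factor
in ℝ^n. The single vector that may leave ℝ^n thus travels to the left end. -/
theorem exists_prod_eq {n : ℕ} (hn : 1 ≤ n) (v : Euc (n + 1)) (l : List (Euc (n + 1)))
    (hv : ‖v‖ = 1) (hl : ∀ w ∈ l, ‖w‖ = 1) :
    ∃ (u : Euc (n + 1)) (l' : List (Euc n)), ‖u‖ = 1 ∧ (∀ a ∈ l', ‖a‖ = 1) ∧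
      l'.length = l.length ∧ ((v :: l).map (CliffordAlgebra.ι (negSq (n + 1)))).prod =
        CliffordAlgebra.ι (negSq (n + 1)) u *
          clIncl n (l'.map (CliffordAlgebra.ι (negSq n))).prod := by
  induction l generalizing v with
  | nil => exact ⟨v, [], hv, by simp, rfl, by simp⟩
  | cons w l ih =>
    obtain ⟨u, l', hu, hl', hlen, h⟩ := ih w (hl w (by simp)) (fun x hx => hl x (by simp [hx]))
    obtain ⟨u', a, hu', ha, h'⟩ := exists_ι_mul_ι hn hv hu
    refine ⟨u', a :: l', hu', ?_, by simp [hlen], ?_⟩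
    · intro x hx
      rcases List.mem_cons.1 hx with rfl | hx
      exacts [ha, hl' x hx]
    · rw [List.map_cons, List.prod_cons, h, ← mul_assoc, h', List.map_cons, List.prod_cons,
        map_mul, clIncl_ι, mul_assoc]

/-- The stabilizer of the last basis vector in `Spin^c(n+1)` is `Spin^c(n)`. -/
theorem exists_spinCIncl_eq {n : ℕ} (hn : 1 ≤ n) {X : SpinC (n + 1)}
    (h : rot X (eLast n) = eLast n) : ∃ Y : SpinC n, spinCIncl n Y = X := by
  obtain ⟨X, c, x, ⟨l, hl, hl', rfl⟩, hX⟩ := X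
  -- it suffices to write the product as one of unit vectors of `ℝ^n`
  suffices H : ∃ l' : List (Euc n), (∀ a ∈ l', ‖a‖ = 1) ∧ Even l'.length ∧
      (l.map (CliffordAlgebra.ι (negSq (n + 1)))).prod =
        clIncl n (l'.map (CliffordAlgebra.ι (negSq n))).prod by
    obtain ⟨l', h1, h2, h3⟩ := H
    obtain ⟨y, hy, hxy, hyx⟩ := exists_inv_spinSet
      (x := (l'.map (CliffordAlgebra.ι (negSq n))).prod) ⟨l', h1, h2, rfl⟩
    refine ⟨⟨⟨(c : ℂ) ⊗ₜ[ℝ] (l'.map (CliffordAlgebra.ι (negSq n))).prod,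
      ((c⁻¹ : Circle) : ℂ) ⊗ₜ[ℝ] y, ?_, ?_⟩, c, _, ⟨l', h1, h2, rfl⟩, rfl⟩, ?_⟩
    · rw [Algebra.TensorProduct.tmul_mul_tmul, hxy, Algebra.TensorProduct.one_def]
      congr 1; simp
    · rw [Algebra.TensorProduct.tmul_mul_tmul, hyx, Algebra.TensorProduct.one_def]
      congr 1; simp
    · apply toClC_injective
      rw [toClC_spinCIncl]
      change clCIncl n ((c : ℂ) ⊗ₜ[ℝ] _) = (X : ClC (n + 1))
      rw [hX, h3]
      simp [clCIncl]
  -- That λ^c(X) fixes e means that X commutes with e in the Clifford algebra.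
  have hcomm := vecC_rot_mul _ _ ▸ congrArg (fun y => vecC y *
    toClC (⟨X, c, _, ⟨l, hl, hl', rfl⟩, hX⟩ : SpinC (n + 1))) h
  change (X : ClC (n + 1)) * _ = _ * (X : ClC (n + 1)) at hcomm
  rw [hX, vecC, Algebra.TensorProduct.tmul_mul_tmul, Algebra.TensorProduct.tmul_mul_tmul, mul_one,
    one_mul] at hcomm
  have hcomm' : (l.map (CliffordAlgebra.ι (negSq (n + 1)))).prod *
      CliffordAlgebra.ι (negSq (n + 1)) (eLast n) = CliffordAlgebra.ι (negSq (n + 1)) (eLast n) *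
      (l.map (CliffordAlgebra.ι (negSq (n + 1)))).prod := by
    -- The scalar c in U(1) is cancelled, which leaves an identity in the real Clifford algebra.
    have := congrArg (fun z => (((c⁻¹ : Circle) : ℂ) ⊗ₜ[ℝ] (1 : Cl (n + 1))) * z) hcomm
    simp only [Algebra.TensorProduct.tmul_mul_tmul, one_mul] at this
    rw [← Circle.coe_mul, inv_mul_cancel] at this
    refine Algebra.TensorProduct.includeRight_injective
      (FaithfulSMul.algebraMap_injective ℝ ℂ) (by simpa using this)
  cases l with
  | nil => exact ⟨[], by simp, by simp, by simp⟩
  | cons v l =>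
    obtain ⟨u, l', hu, hl₂, hlen, hprod⟩ := exists_prod_eq hn v l (hl v (by simp))
      (fun w hw => hl w (by simp [hw]))
    -- The product is u y, with y a product of an odd number of vectors of ℝ^n, so y e = -e y.
    -- Commuting with e then gives (u e + e u) y = 0, that is, -2 u_last y = 0. As y times its
    -- reversal is -1, y cancels and u_last = 0.
    have hodd : Odd l'.length := by
      rw [List.length_cons, Nat.even_add_one, Nat.not_even_iff_odd] at hl'
      rwa [hlen]
    rw [hprod, mul_assoc, clIncl_prod_mul_eLast, hodd.neg_one_pow, ← mul_assoc, ← mul_assoc,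
      mul_neg_one, neg_mul, neg_mul, ← mul_assoc, ← add_eq_zero_iff_neg_eq, ← add_mul,
      ι_mul_ι_eLast] at hcomm'
    have hunit := congrArg (clIncl n) (prod_mul_prod_reverse l' hl₂)
    rw [map_mul, hodd.neg_one_pow, map_neg, map_one] at hunit
    have h0 := congrArg (fun z => z * clIncl n
      (l'.reverse.map (CliffordAlgebra.ι (negSq n))).prod) hcomm'
    simp only [mul_assoc, zero_mul] at h0
    rw [hunit, mul_neg_one, neg_eq_zero,
      map_eq_zero_iff _ (algebraMap ℝ (Cl (n + 1))).injective] at h0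
    have hul : u (Fin.last n) = 0 := by linarith
    refine ⟨dropLast n u :: l', ?_, by simpa [Nat.even_add_one] using hodd, ?_⟩
    · intro a ha
      rcases List.mem_cons.1 ha with rfl | ha
      · rw [← norm_appendZero, appendZero_dropLast hul, hu]
      · exact hl₂ a ha
    · rw [hprod, List.map_cons, List.prod_cons, map_mul, clIncl_ι, appendZero_dropLast hul]

/-! #### Smoothness of the group operations -/

/-- The linear map of `C_k ⊗ ℂ` that restricts to the inverse on `Spin^c(k)`. -/
def clCStar (k : ℕ) : ClC k →ₗ[ℝ] ClC k :=
  TensorProduct.map Complex.conjAe.toLinearMap CliffordAlgebra.reverse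

/-- For even l, the reversed product inverts v₁⋯v_l, and conjugation inverts c on the unit circle.
Inversion on Spin^c(k) is thus the restriction of a linear map, which makes it smooth. -/
theorem toClC_inv {k : ℕ} (X : SpinC k) : toClC X⁻¹ = clCStar k (toClC X) := by
  obtain ⟨u, c, x, ⟨l, hl, hl', rfl⟩, hu⟩ := X
  change ((u⁻¹ : (ClC k)ˣ) : ClC k) = clCStar k (u : ClC k)
  refine Units.inv_eq_of_mul_eq_one_right ?_
  rw [hu, clCStar, TensorProduct.map_tmul, CliffordAlgebra.reverse_prod_map_ι,
    Algebra.TensorProduct.tmul_mul_tmul, ← List.map_reverse, prod_mul_prod_reverse l hl,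
    hl'.neg_one_pow, Algebra.TensorProduct.one_def]
  simp [Complex.mul_conj]

theorem _root_.LinearMap.contDiff_of_finiteDimensional {E F : Type*} [NormedAddCommGroup E]
    [NormedSpace ℝ E] [FiniteDimensional ℝ E] [NormedAddCommGroup F] [NormedSpace ℝ F]
    (f : E →ₗ[ℝ] F) {m : ℕ∞ω} : ContDiff ℝ m f :=
  f.toContinuousLinearMap.contDiff

theorem contDiff_mul_clC {k : ℕ} {m : ℕ∞ω} : ContDiff ℝ m (fun p : ClC k × ClC k => p.1 * p.2) :=
  ((LinearMap.mul ℝ (ClC k)).toContinuousBilinearMap).isBoundedBilinearMap.contDiff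

/-- The rotation `λ^c(X) y` as a function on `C_k ⊗ ℂ`. -/
def rotFun (k : ℕ) (x : ClC k) (y : Euc k) : Euc k :=
  ((vecCL k).exists_leftInverse_of_injective (LinearMap.ker_eq_bot.2 (vecCL_injective k))).choose
    (x * vecC y * clCStar k x)

theorem rotFun_toClC {k : ℕ} (X : SpinC k) (y : Euc k) : rotFun k (toClC X) y = rot X y := by
  rw [rotFun, ← toClC_inv, ← vecC_rot]
  exact LinearMap.congr_fun ((vecCL k).exists_leftInverse_of_injective
    (LinearMap.ker_eq_bot.2 (vecCL_injective k))).choose_spec (rot X y)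

theorem contDiff_rotFun {k : ℕ} {m : ℕ∞ω} (y : Euc k) : ContDiff ℝ m (fun x => rotFun k x y) := by
  refine (LinearMap.contDiff_of_finiteDimensional _).comp ?_
  exact contDiff_mul_clC.comp ((contDiff_mul_clC.comp (contDiff_id.prodMk contDiff_const)).prodMk
    (clCStar k).contDiff_of_finiteDimensional)

/-- `Spin^c(n+1)` acts transitively on the sphere, with smooth local sections. -/
theorem exists_rotor {n : ℕ} (hn : 1 ≤ n) {b₀ : Euc (n + 1)} :
    ∃ (V : Set (Euc (n + 1))) (X : Euc (n + 1) → SpinC (n + 1)), IsOpen V ∧ b₀ ∈ V ∧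
      ContDiffOn ℝ ∞ (fun b => toClC (X b)) V ∧ ∀ b ∈ V, ‖b‖ = 1 → rot (X b) (eLast n) = b := by
  -- The rotor is a product of two reflections: a fixed one takes e to a point c, and the one in the
  -- bisecting hyperplane takes c to b. The latter depends smoothly on b away from c, so c has to
  -- differ from b₀.
  obtain ⟨w, hw, hne⟩ : ∃ w : Euc (n + 1), ‖w‖ = 1 ∧ refl w (eLast n) ≠ b₀ := by
    by_contra! H
    have h1 := H (eLast n) (norm_eLast n)
    -- Reflecting in e gives -e, while reflecting in a unit vector of ℝ^n leaves e fixed, so b₀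
    -- cannot equal both results.
    have h2 := H (appendZero n (EuclideanSpace.single ⟨0, hn⟩ 1)) (by simp [norm_appendZero])
    have h3 := congrArg (fun y : Euc (n + 1) => y (Fin.last n)) (h1.trans h2.symm)
    simp [refl] at h3
  have hc : ‖refl w (eLast n)‖ = 1 := by
    have h : rot (vecPair w (eLast n) hw (norm_eLast n)) (eLast n) = -refl w (eLast n) := by
      have h1 : refl (eLast n) (eLast n) = -eLast n := by
        simp only [refl, inner_eLast, eLast_last]; module
      rw [rot_vecPair, h1]
      simp only [refl, inner_neg_right]
      module
    rw [← norm_neg, ← h, norm_rot, norm_eLast]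
  set c := refl w (eLast n)
  have hun : ∀ b, c ≠ b → ‖‖c - b‖⁻¹ • (c - b)‖ = 1 := fun b hb => by
    rw [norm_smul, norm_inv, norm_norm, inv_mul_cancel₀ (norm_ne_zero_iff.2 (sub_ne_zero.2 hb))]
  classical
  -- The value 1 at b = c is a filler outside the neighbourhood V.
  refine ⟨{b | c ≠ b}, fun b => if h : c ≠ b then vecPair _ w (hun b h) hw else 1,
    isOpen_ne_fun continuous_const continuous_id, hne, ?_, ?_⟩
  · have h : ContDiffOn ℝ ∞ (fun b => vecC (‖c - b‖⁻¹ • (c - b)) * vecC w) {b | c ≠ b} := by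
      refine contDiff_mul_clC.comp_contDiffOn (ContDiffOn.prodMk ?_ contDiffOn_const)
      refine (vecCL _).contDiff_of_finiteDimensional.comp_contDiffOn (ContDiffOn.fun_smul ?_ ?_)
      · refine ContDiffOn.inv (ContDiffOn.norm ℝ (contDiffOn_const.sub contDiffOn_id) ?_) ?_
        · exact fun b hb => sub_ne_zero.2 hb
        · exact fun b hb => norm_ne_zero_iff.2 (sub_ne_zero.2 hb)
      · exact contDiffOn_const.sub contDiffOn_id
    refine h.congr fun b hb => ?_
    simp only [dif_pos (show c ≠ b from hb)]
    rfl
  · intro b hb hb1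
    simp only [dif_pos (show c ≠ b from hb)]
    rw [rot_vecPair, refl_normalize_sub (by rw [hb1]; exact hc) hb]

/-! ### Submanifolds -/

section Submanifold

open Manifold Topology Set

/-- A smooth submersion between vector spaces, with a local section `σ`, is the second coordinate of
a smooth chart. -/
theorem exists_straightening {E F K : Type*} [NormedAddCommGroup E] [NormedSpace ℝ E]
    [FiniteDimensional ℝ E] [NormedAddCommGroup F] [NormedSpace ℝ F] [FiniteDimensional ℝ F]
    [NormedAddCommGroup K] [NormedSpace ℝ K] [FiniteDimensional ℝ K] (L : (K × F) ≃L[ℝ] E)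
    {H : E → F} {T : Set E} (hT : IsOpen T) (hH : ContDiffOn ℝ ∞ H T) {y₀ : E} (hy₀ : y₀ ∈ T)
    {σ : F → E} (hσ : DifferentiableAt ℝ σ (H y₀)) (hσ₀ : σ (H y₀) = y₀)
    (hHσ : ∀ᶠ a in 𝓝 (H y₀), H (σ a) = a) :
    ∃ Φ : OpenPartialHomeomorph E E, y₀ ∈ Φ.source ∧ Φ.source ⊆ T ∧ ContDiffOn ℝ ∞ Φ Φ.source ∧
      ContDiffOn ℝ ∞ Φ.symm Φ.target ∧ ∀ y ∈ Φ.source, (L.symm (Φ y)).2 = H y := by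
  have hHd : ∀ y ∈ T, ContDiffAt ℝ ∞ H y := fun y hy => hH.contDiffAt (hT.mem_nhds hy)
  have hdH : HasFDerivAt H (fderiv ℝ H y₀) (σ (H y₀)) := by
    rw [hσ₀]; exact ((hHd y₀ hy₀).differentiableAt (by simp)).hasFDerivAt
  set A : E →L[ℝ] F := fderiv ℝ H y₀
  set B : F →L[ℝ] E := fderiv ℝ σ (H y₀)
  -- Differentiating H ∘ σ = id shows that B is a right inverse of A, so H is a submersion at y₀.
  have hAB : ∀ a, A (B a) = a := by
    have h1 := hdH.comp (H y₀) hσ.hasFDerivAt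
    have h2 : HasFDerivAt (H ∘ σ) (ContinuousLinearMap.id ℝ F) (H y₀) :=
      (hasFDerivAt_id (H y₀)).congr_of_eventuallyEq hHσ
    exact fun a => congrArg (fun f : F →L[ℝ] F => f a) (h1.unique h2)
  have hrange : LinearMap.range A.toLinearMap = ⊤ :=
    LinearMap.range_eq_top.2 fun a => ⟨B a, hAB a⟩
  have hfin : Module.finrank ℝ (LinearMap.ker A.toLinearMap) = Module.finrank ℝ K := by
    have h1 := LinearMap.finrank_range_add_finrank_ker A.toLinearMap
    rw [hrange, finrank_top] at h1
    have h2 := L.toLinearEquiv.finrank_eq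
    rw [Module.finrank_prod] at h2
    omega
  let κ : LinearMap.ker A.toLinearMap ≃L[ℝ] K := ContinuousLinearEquiv.ofFinrankEq hfin
  -- The projection 1 - BA onto the kernel of A along the image of B. Together with A it gives
  -- linear coordinates on E, and Ψ replaces the second of these by H itself.
  let pr : E →L[ℝ] LinearMap.ker A.toLinearMap :=
    (ContinuousLinearMap.id ℝ E - B.comp A).codRestrict _ fun y => by
      simp [LinearMap.mem_ker, hAB]
  let D : E →L[ℝ] E := (L : (K × F) →L[ℝ] E).comp (((κ : _ →L[ℝ] K).comp pr).prod A)
  have hDinj : Function.Injective D := by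
    rw [injective_iff_map_eq_zero]
    intro y hy
    have h1 : ((κ (pr y), A y) : K × F) = 0 := L.injective (by rw [map_zero]; exact hy)
    rw [Prod.mk_eq_zero, map_eq_zero_iff _ κ.injective] at h1
    have h2 : y - B (A y) = 0 := congrArg Subtype.val h1.1
    rwa [h1.2, map_zero, sub_zero] at h2
  let De : E ≃L[ℝ] E :=
    (LinearEquiv.ofInjectiveEndo D.toLinearMap hDinj).toContinuousLinearEquiv
  have hDe : (De : E →L[ℝ] E) = D := by ext; rfl
  let Ψ : E → E := fun y => L (κ (pr y), H y)
  have hΨ : ContDiffOn ℝ ∞ Ψ T := L.contDiff.comp_contDiffOn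
    (((κ.contDiff.comp pr.contDiff).contDiffOn).prodMk hH)
  have hΨat : ∀ y ∈ T, ContDiffAt ℝ ∞ Ψ y := fun y hy => hΨ.contDiffAt (hT.mem_nhds hy)
  have hΨ₀ : HasFDerivAt Ψ (De : E →L[ℝ] E) y₀ := by
    rw [hDe]
    have h1 : HasFDerivAt (fun y => κ (pr y)) ((κ : _ →L[ℝ] K).comp pr) y₀ :=
      κ.hasFDerivAt.comp y₀ pr.hasFDerivAt
    rw [hσ₀] at hdH
    exact L.hasFDerivAt.comp y₀ (h1.prodMk hdH)
  let Φ₀ := (hΨat y₀ hy₀).toOpenPartialHomeomorph Ψ hΨ₀ (by simp)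
  -- Shrinking to the points where the derivative of Ψ is invertible makes the inverse smooth on the
  -- whole target, not merely at the image of y₀.
  let T' : Set E := T ∩ fderiv ℝ Ψ ⁻¹' range ((↑) : (E ≃L[ℝ] E) → (E →L[ℝ] E))
  have hT' : IsOpen T' :=
    (hΨ.continuousOn_fderiv_of_isOpen hT (by simp)).isOpen_inter_preimage hT
      ContinuousLinearEquiv.isOpen
  refine ⟨Φ₀.restrOpen T' hT', ?_, fun y hy => hy.2.1, ?_, ?_, ?_⟩
  · exact ⟨(hΨat y₀ hy₀).mem_toOpenPartialHomeomorph_source hΨ₀ (by simp), hy₀, De, hΨ₀.fderiv.symm⟩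
  · exact hΨ.mono fun y hy => hy.2.1
  · intro a ha
    have hmem := (Φ₀.restrOpen T' hT').map_target ha
    obtain ⟨C, hC⟩ := hmem.2.2
    refine (OpenPartialHomeomorph.contDiffAt_symm (Φ₀.restrOpen T' hT') (f₀' := C) ha ?_
      (hΨat _ hmem.2.1)).contDiffWithinAt
    rw [hC]
    exact ((hΨat _ hmem.2.1).differentiableAt (by simp)).hasFDerivAt
  · intro y _
    change (L.symm (L (κ (pr y), H y))).2 = H y
    rw [L.symm_apply_apply]

/-- A smooth submersion on a manifold, with a local section `σ`, is the second coordinate of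
a chart. -/
theorem exists_chart_of_submersion {D : ℕ} {F K : Type*} [NormedAddCommGroup F] [NormedSpace ℝ F]
    [FiniteDimensional ℝ F] [NormedAddCommGroup K] [NormedSpace ℝ K] [FiniteDimensional ℝ K]
    (L : (K × F) ≃L[ℝ] Euc D) {P : Type*} [TopologicalSpace P] [ChartedSpace (Euc D) P]
    [IsManifold (𝓡 D) ∞ P] {h : P → F} {W : Set P} (hW : IsOpen W)
    (hh : ContMDiffOn (𝓡 D) 𝓘(ℝ, F) ∞ h W) {p₀ : P} (hp₀ : p₀ ∈ W) {σ : F → P}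
    (hσ : ContMDiffAt 𝓘(ℝ, F) (𝓡 D) ∞ σ (h p₀)) (hσ₀ : σ (h p₀) = p₀)
    (hhσ : ∀ᶠ a in 𝓝 (h p₀), h (σ a) = a) :
    ∃ e ∈ IsManifold.maximalAtlas (𝓡 D) ∞ P, p₀ ∈ e.source ∧ e.source ⊆ W ∧
      ∀ p ∈ e.source, (L.symm (e p)).2 = h p := by
  set φ := chartAt (Euc D) p₀ with hφ
  have hφm : φ ∈ IsManifold.maximalAtlas (𝓡 D) ∞ P := IsManifold.chart_mem_maximalAtlas p₀
  have hp₀φ : p₀ ∈ φ.source := mem_chart_source _ p₀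
  have hφs := contMDiffOn_symm_of_mem_maximalAtlas hφm
  have hT : IsOpen (φ.target ∩ φ.symm ⁻¹' W) := φ.isOpen_inter_preimage_symm hW
  have hH : ContDiffOn ℝ ∞ (h ∘ φ.symm) (φ.target ∩ φ.symm ⁻¹' W) :=
    contMDiffOn_iff_contDiffOn.1 (hh.comp (hφs.mono inter_subset_left) fun y hy => hy.2)
  have h₀ : (h ∘ φ.symm) (φ p₀) = h p₀ := by simp [φ.left_inv hp₀φ]
  have hσφ : ContMDiffAt 𝓘(ℝ, F) (𝓡 D) ∞ (φ ∘ σ) (h p₀) :=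
    ContMDiffAt.comp (h p₀) (contMDiffAt_of_mem_maximalAtlas hφm (by rw [hσ₀]; exact hp₀φ)) hσ
  obtain ⟨Φ, hΦ₀, hΦT, hΦ, hΦs, hΦh⟩ := exists_straightening L hT hH (y₀ := φ p₀)
    ⟨φ.map_source hp₀φ, by rw [mem_preimage, φ.left_inv hp₀φ]; exact hp₀⟩ (σ := φ ∘ σ)
    (by rw [h₀]; exact (contMDiffAt_iff_contDiffAt.1 hσφ).differentiableAt (by simp))
    (by rw [h₀, Function.comp_apply, hσ₀]) (by
      rw [h₀]
      have : ∀ᶠ a in 𝓝 (h p₀), σ a ∈ φ.source :=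
        hσ.continuousAt.eventually_mem (by rw [hσ₀]; exact φ.open_source.mem_nhds hp₀φ)
      filter_upwards [hhσ, this] with a ha ha'
      simp [φ.left_inv ha', ha])
  refine ⟨φ.trans Φ, ?_, ?_, ?_, ?_⟩
  · apply OpenPartialHomeomorph.mem_maximalAtlas_of_contMDiffOn
    · rw [φ.coe_trans Φ, φ.trans_source Φ]
      exact (contMDiffOn_iff_contDiffOn.2 hΦ).comp
        ((contMDiffOn_of_mem_maximalAtlas hφm).mono inter_subset_left) fun p hp => hp.2
    · rw [φ.coe_trans_symm Φ, φ.trans_target Φ]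
      exact hφs.comp ((contMDiffOn_iff_contDiffOn.2 hΦs).mono inter_subset_left) fun p hp => hp.2
  · rw [φ.trans_source Φ]
    exact ⟨hp₀φ, hΦ₀⟩
  · intro p hp
    rw [φ.trans_source Φ] at hp
    have := (hΦT hp.2).2
    rwa [mem_preimage, φ.left_inv hp.1] at this
  · intro p hp
    rw [φ.trans_source Φ] at hp
    rw [φ.coe_trans Φ, Function.comp_apply, hΦh _ hp.2, Function.comp_apply, φ.left_inv hp.1]

variable {k D : ℕ} {F : Type*} [NormedAddCommGroup F] [NormedSpace ℝ F]
  (L : (Euc k × F) ≃L[ℝ] Euc D) {S P : Type*} [TopologicalSpace S] [TopologicalSpace P] {j : S → P}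

/-- The chart of a subspace `S` of `P` induced by a slice chart `e` of `P`. -/
def sliceChart (hj : IsEmbedding j) (e : OpenPartialHomeomorph P (Euc D))
    (he : ∀ p ∈ e.source, p ∈ range j ↔ (L.symm (e p)).2 = 0) (s₀ : S) :
    OpenPartialHomeomorph S (Euc k) :=
  -- The point s₀ only provides the nonemptiness that `Function.invFun` requires; on the slice this
  -- function is a genuine inverse of j.
  haveI : Nonempty S := ⟨s₀⟩
  have hinv : ∀ u : Euc k, L (u, 0) ∈ e.target →
      j (Function.invFun j (e.symm (L (u, 0)))) = e.symm (L (u, 0)) := fun u hu =>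
    Function.invFun_eq ((he _ (e.map_target hu)).2 (by simp [e.right_inv hu]))
  have hmem : ∀ s, j s ∈ e.source → L ((L.symm (e (j s))).1, 0) = e (j s) := fun s hs => by
    rw [← (he _ hs).1 ⟨s, rfl⟩, Prod.mk.eta, L.apply_symm_apply]
  { toFun := fun s => (L.symm (e (j s))).1
    invFun := fun u => Function.invFun j (e.symm (L (u, 0)))
    source := j ⁻¹' e.source
    target := {u | L (u, 0) ∈ e.target}
    map_source' := fun s hs => by
      rw [mem_ofPred_eq, hmem s hs]; exact e.map_source hs
    map_target' := fun u hu => by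
      rw [mem_preimage, hinv u hu]; exact e.map_target hu
    left_inv' := fun s hs => by
      apply hj.injective
      rw [hinv _ (by rw [hmem s hs]; exact e.map_source hs), hmem s hs, e.left_inv hs]
    right_inv' := fun u hu => by
      simp [hinv u hu, e.right_inv hu]
    open_source := e.open_source.preimage hj.continuous
    open_target := e.open_target.preimage (by fun_prop)
    continuousOn_toFun := continuous_fst.comp_continuousOn (L.symm.continuous.comp_continuousOn
      (e.continuousOn.comp hj.continuous.continuousOn fun s hs => hs))
    continuousOn_invFun := by
      rw [hj.continuousOn_iff]
      refine ContinuousOn.congr (f := fun u => e.symm (L (u, 0))) ?_ hinv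
      exact e.continuousOn_symm.comp (by fun_prop) fun u hu => hu }

theorem apply_sliceChart_symm (hj : IsEmbedding j) (e : OpenPartialHomeomorph P (Euc D))
    (he : ∀ p ∈ e.source, p ∈ range j ↔ (L.symm (e p)).2 = 0) (s₀ : S) {u : Euc k}
    (hu : u ∈ (sliceChart L hj e he s₀).target) :
    j ((sliceChart L hj e he s₀).symm u) = e.symm (L (u, 0)) :=
  haveI : Nonempty S := ⟨s₀⟩
  Function.invFun_eq ((he _ (e.map_target hu)).2 (by simp [e.right_inv hu]))

/-- A subspace of a manifold which is cut out by slice charts is a smoothly embedded manifold. -/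
theorem exists_isSmoothEmbedding_of_slices [ChartedSpace (Euc D) P] [IsManifold (𝓡 D) ∞ P]
    (hj : IsEmbedding j)
    (h : ∀ s, ∃ e ∈ IsManifold.maximalAtlas (𝓡 D) ∞ P, j s ∈ e.source ∧
      ∀ p ∈ e.source, p ∈ range j ↔ (L.symm (e p)).2 = 0) :
    ∃ (_ : ChartedSpace (Euc k) S) (_ : IsManifold (𝓡 k) ∞ S),
      IsSmoothEmbedding (𝓡 k) (𝓡 D) ∞ j := by
  choose e hem hes he using h
  let c : ∀ s, OpenPartialHomeomorph S (Euc k) := fun s => sliceChart L hj (e s) (he s) s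
  let _ : ChartedSpace (Euc k) S :=
    { atlas := range c
      chartAt := c
      mem_chart_source := hes
      chart_mem_atlas := fun s => ⟨s, rfl⟩ }
  have hmf : IsManifold (𝓡 k) ∞ S := by
    refine isManifold_of_contDiffOn _ _ _ ?_
    rintro _ _ ⟨s, rfl⟩ ⟨s', rfl⟩
    -- A transition map between slice charts is the transition map of the ambient charts, restricted
    -- to the slice and followed by the first projection.
    have key : ContMDiffOn 𝓘(ℝ, Euc k) 𝓘(ℝ, Euc k) ∞
        (fun u => (L.symm ((e s') ((e s).symm (L (u, 0))))).1) ((c s).symm ≫ₕ (c s')).source := by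
      have h1 : ContMDiff 𝓘(ℝ, Euc k) 𝓘(ℝ, Euc D) ∞ (fun u : Euc k => L (u, 0)) :=
        ContDiff.contMDiff (L.contDiff.comp (contDiff_id.prodMk contDiff_const))
      have h2 : ContMDiff 𝓘(ℝ, Euc D) 𝓘(ℝ, Euc k) ∞ (fun y : Euc D => (L.symm y).1) :=
        ContDiff.contMDiff (contDiff_fst.comp L.symm.contDiff)
      refine h2.comp_contMDiffOn ((contMDiffOn_of_mem_maximalAtlas (hem s')).comp
        ((contMDiffOn_symm_of_mem_maximalAtlas (hem s)).comp h1.contMDiffOn ?_) ?_)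
      · exact fun u hu => hu.1
      · intro u hu
        have hu2 : j ((c s).symm u) ∈ (e s').source := hu.2
        rwa [apply_sliceChart_symm L hj (e s) (he s) s hu.1] at hu2
    rw [contMDiffOn_iff_contDiffOn] at key
    simp only [modelWithCornersSelf_coe, modelWithCornersSelf_coe_symm, Function.comp_id,
      Function.id_comp, preimage_id, range_id, inter_univ]
    refine key.congr fun u hu => ?_
    change (L.symm (e s' (j ((c s).symm u)))).1 = _
    rw [apply_sliceChart_symm L hj (e s) (he s) s hu.1]
  refine ⟨inferInstance, hmf, ⟨?_, hj⟩⟩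
  refine IsImmersionOfComplement.isImmersion (F := F) fun s => ?_
  refine IsImmersionAtOfComplement.mk_of_charts L (c s) (e s) (hes s) (hes s)
    (IsManifold.subset_maximalAtlas ⟨s, rfl⟩) (hem s) (fun s' hs' => hs') ?_
  intro u hu
  have hu' : u ∈ (c s).target := by simpa using hu
  change (e s) (j ((c s).symm u)) = L (u, 0)
  rw [apply_sliceChart_symm L hj (e s) (he s) s hu', (e s).right_inv hu']

end Submanifold

/-! ### Pullbacks of differential forms -/

section Alternating

variable {E E' F : Type*} [NormedAddCommGroup E] [NormedSpace ℝ E] [NormedAddCommGroup E']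
  [NormedSpace ℝ E'] [NormedAddCommGroup F] [NormedSpace ℝ F] {q : ℕ}

/-- Alternatization as a continuous linear map. -/
def alternatizationCLM (E F : Type*) [NormedAddCommGroup E] [NormedSpace ℝ E]
    [NormedAddCommGroup F] [NormedSpace ℝ F] (q : ℕ) :
    ContinuousMultilinearMap ℝ (fun _ : Fin q => E) F →L[ℝ] E [⋀^Fin q]→L[ℝ] F :=
  LinearMap.mkContinuous
    { toFun := ContinuousMultilinearMap.alternatization
      map_add' := map_add _
      map_smul' := fun c f => by
        ext v
        simp [ContinuousMultilinearMap.alternatization_apply_apply, Finset.smul_sum, smul_comm c] }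
    (Fintype.card (Equiv.Perm (Fin q))) fun f => by
      refine ContinuousAlternatingMap.opNorm_le_bound _ (by positivity) fun v => ?_
      rw [LinearMap.coe_mk, AddHom.coe_mk,
        ContinuousMultilinearMap.alternatization_apply_apply]
      refine (norm_sum_le _ _).trans ?_
      refine (Finset.sum_le_card_nsmul _ _ (‖f‖ * ∏ i, ‖v i‖) fun σ _ => ?_).trans_eq ?_
      · have h1 : ‖Equiv.Perm.sign σ • f (v ∘ σ)‖ = ‖f (v ∘ σ)‖ := by
          rcases Int.units_eq_one_or (Equiv.Perm.sign σ) with h | h <;> rw [h] <;> simp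
        rw [h1, ← Equiv.prod_comp σ fun i => ‖v i‖]
        exact f.le_opNorm _
      · rw [Finset.card_univ, nsmul_eq_mul, mul_assoc]

/-- All q! signed permutations of an alternating form coincide with it. -/
theorem alternatizationCLM_apply_coe (w : E [⋀^Fin q]→L[ℝ] F) :
    alternatizationCLM E F q w.toContinuousMultilinearMap = (q.factorial : ℝ) • w := by
  ext v
  have h := congrArg (fun f => f v) (AlternatingMap.coe_alternatization w.toAlternatingMap)
  rw [Fintype.card_fin] at h
  rw [ContinuousAlternatingMap.smul_apply, Nat.cast_smul_eq_nsmul]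
  refine Eq.trans ?_ h
  change ContinuousMultilinearMap.alternatization _ v = _
  rw [ContinuousMultilinearMap.alternatization_apply_apply, MultilinearMap.alternatization_apply]
  rfl

/-- Composition is jointly smooth for multilinear maps. Alternatization divided by q! is a
continuous linear map that restores the alternating form, so it carries this smoothness over to
alternating maps. -/
theorem _root_.ContDiffWithinAt.alternating_comp {X : Type*} [NormedAddCommGroup X]
    [NormedSpace ℝ X] {m : ℕ∞ω} {s : Set X} {x : X} {w : X → E [⋀^Fin q]→L[ℝ] F}
    {A : X → E' →L[ℝ] E} (hw : ContDiffWithinAt ℝ m w s x) (hA : ContDiffWithinAt ℝ m A s x) :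
    ContDiffWithinAt ℝ m (fun y => (w y).compContinuousLinearMap (A y)) s x := by
  have h1 : ContDiffWithinAt ℝ m (fun y =>
      ContinuousMultilinearMap.compContinuousLinearMapContinuousMultilinear ℝ
        (fun _ : Fin q => E') (fun _ => E) F (fun _ => A y)
        (ContinuousAlternatingMap.toContinuousMultilinearMapCLM ℝ (w y))) s x :=
    ((ContinuousMultilinearMap.contDiff _).comp_contDiffWithinAt
      (contDiffWithinAt_pi.2 fun _ => hA)).clm_apply
      ((ContinuousLinearMap.contDiff (ContinuousAlternatingMap.toContinuousMultilinearMapCLM ℝ :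
        E [⋀^Fin q]→L[ℝ] F →L[ℝ] _)).comp_contDiffWithinAt hw)
  have h2 := ((alternatizationCLM E' F q).contDiff.comp_contDiffWithinAt h1).const_smul
    ((q.factorial : ℝ)⁻¹)
  have h3 : ∀ y, (w y).compContinuousLinearMap (A y) = (q.factorial : ℝ)⁻¹ •
      alternatizationCLM E' F q
        (ContinuousMultilinearMap.compContinuousLinearMapContinuousMultilinear ℝ
        (fun _ : Fin q => E') (fun _ => E) F (fun _ => A y)
        (ContinuousAlternatingMap.toContinuousMultilinearMapCLM ℝ (w y))) := by
    intro y
    rw [eq_inv_smul_iff₀ (by positivity), ← alternatizationCLM_apply_coe]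
    rfl
  exact h2.congr (fun y _ => h3 y) (h3 x)

end Alternating

/-! ### Naturality of forms, their smoothness and the exterior derivative -/

namespace Form

open Topology

variable {m m' m'' : ℕ} {X Y W : Type*} [TopologicalSpace X] [ChartedSpace (Euc m) X]
  [TopologicalSpace Y] [ChartedSpace (Euc m') Y] [TopologicalSpace W] [ChartedSpace (Euc m'') W]
  {q : ℕ} {F : Type*} [NormedAddCommGroup F] [NormedSpace ℝ F]

section Congr

variable {E : Type*} [NormedAddCommGroup E] [NormedSpace ℝ E]

/-- Tangent spaces at points that are only propositionally equal are distinct types; maps into them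
are compared in the common model `Euc m'`. -/
theorem comp_congr (η : Form m' Y q F) {p p' : Y} (h : p = p') (A : E →L[ℝ] TangentSpace (𝓡 m') p)
    (A' : E →L[ℝ] TangentSpace (𝓡 m') p') (hA : ∀ v, @Eq (Euc m') (A v) (A' v)) :
    (η p).compContinuousLinearMap A = (η p').compContinuousLinearMap A' := by
  subst h
  rw [show A = A' from ContinuousLinearMap.ext hA]

end Congr

theorem pullback_comp (η : Form m'' W q F) {f : X → Y} {h : Y → W}
    (hf : MDifferentiable (𝓡 m) (𝓡 m') f) (hh : MDifferentiable (𝓡 m') (𝓡 m'') h) :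
    pullback (m := m) (fun x => h (f x)) η = pullback f (pullback (m := m') h η) := by
  funext x
  have : mfderiv (𝓡 m) (𝓡 m'') (fun x => h (f x)) x = _ := mfderiv_comp x (hh (f x)) (hf x)
  rw [pullback, this]
  rfl

theorem pullback_negI (η : Form m' Y q ℝ) (f : X → Y) :
    pullback (m := m) f η.negI = (pullback f η).negI := rfl

theorem Smooth.differentiableAt {η : Form m X q F} (hη : η.Smooth) (x : X) :
    DifferentiableAt ℝ (η.inChart x) (extChartAt (𝓡 m) x x) :=
  ((hη x).contDiffAt (extChartAt_target_mem_nhds x)).differentiableAt (by simp)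

variable [IsManifold (𝓡 m) ∞ X] [IsManifold (𝓡 m') ∞ Y]

/-- This is the chain rule applied to ψ⁻¹ ∘ (ψ ∘ f ∘ φ⁻¹) = f ∘ φ⁻¹, valid near y. It reduces
pullbacks on manifolds to pullbacks between vector spaces. -/
theorem inChart_pullback (η : Form m' Y q F) {f : X → Y} (hf : MDifferentiable (𝓡 m) (𝓡 m') f)
    {x₀ : X} {y₀ : Y} {y : Euc m} (hy : y ∈ (extChartAt (𝓡 m) x₀).target)
    (hfy : f ((extChartAt (𝓡 m) x₀).symm y) ∈ (extChartAt (𝓡 m') y₀).source) :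
    (pullback (m := m) f η).inChart x₀ y =
      (η.inChart y₀ ((extChartAt (𝓡 m') y₀ ∘ f ∘ (extChartAt (𝓡 m) x₀).symm) y)
        ).compContinuousLinearMap
        (fderiv ℝ (extChartAt (𝓡 m') y₀ ∘ f ∘ (extChartAt (𝓡 m) x₀).symm) y) := by
  set φ := extChartAt (𝓡 m) x₀
  set ψ := extChartAt (𝓡 m') y₀
  have hφ : MDifferentiableAt 𝓘(ℝ, Euc m) (𝓡 m) φ.symm y :=
    ((contMDiffOn_extChartAt_symm (n := ∞) x₀).contMDiffAt
      ((isOpen_extChartAt_target x₀).mem_nhds hy)).mdifferentiableAt (by simp)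
  have hψ' : ψ (f (φ.symm y)) ∈ ψ.target := ψ.map_source hfy
  have hψs : MDifferentiableAt 𝓘(ℝ, Euc m') (𝓡 m') ψ.symm ((ψ ∘ f ∘ φ.symm) y) :=
    ((contMDiffOn_extChartAt_symm (n := ∞) y₀).contMDiffAt
      ((isOpen_extChartAt_target y₀).mem_nhds hψ')).mdifferentiableAt (by simp)
  have hψ : MDifferentiableAt (𝓡 m') 𝓘(ℝ, Euc m') ψ ((f ∘ φ.symm) y) :=
    (contMDiffAt_extChartAt' (n := ∞) (by simpa [ψ] using hfy)).mdifferentiableAt (by simp)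
  have hfφ : MDifferentiableAt 𝓘(ℝ, Euc m) (𝓡 m') (f ∘ φ.symm) y := (hf _).comp y hφ
  have hF : MDifferentiableAt 𝓘(ℝ, Euc m) 𝓘(ℝ, Euc m') (ψ ∘ f ∘ φ.symm) y := hψ.comp y hfφ
  have hev : (ψ.symm ∘ (ψ ∘ f ∘ φ.symm)) =ᶠ[𝓝 y] f ∘ φ.symm := by
    filter_upwards [hfφ.continuousAt.eventually_mem
      ((isOpen_extChartAt_source (I := 𝓡 m') y₀).mem_nhds hfy)] with z hz
    exact ψ.left_inv hz
  have h1 := hev.mfderiv_eq (I := 𝓘(ℝ, Euc m)) (I' := 𝓡 m')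
  rw [mfderiv_comp y hψs hF, mfderiv_comp y (hf _) hφ, mfderiv_eq_fderiv] at h1
  exact (comp_congr (E := Euc m) η (ψ.left_inv hfy) _ _ fun v => DFunLike.congr_fun h1 v).symm

theorem contDiffAt_chart {f : X → Y} (hf : ContMDiff (𝓡 m) (𝓡 m') ∞ f)
    {x₀ : X} {y₀ : Y} {y : Euc m} (hy : y ∈ (extChartAt (𝓡 m) x₀).target)
    (hfy : f ((extChartAt (𝓡 m) x₀).symm y) ∈ (extChartAt (𝓡 m') y₀).source) :
    ContDiffAt ℝ ∞ (extChartAt (𝓡 m') y₀ ∘ f ∘ (extChartAt (𝓡 m) x₀).symm) y := by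
  rw [← contMDiffAt_iff_contDiffAt]
  have h1 := (contMDiffOn_extChartAt_symm (I := 𝓡 m) (n := ∞) x₀).contMDiffAt
      ((isOpen_extChartAt_target x₀).mem_nhds hy)
  have h2 : ContMDiffAt (𝓡 m') 𝓘(ℝ, Euc m') ∞ (extChartAt (𝓡 m') y₀)
      (f ((extChartAt (𝓡 m) x₀).symm y)) := contMDiffAt_extChartAt' (by simpa using hfy)
  exact h2.comp y ((hf _).comp y h1)

theorem Smooth.pullback {η : Form m' Y q F} (hη : η.Smooth) {f : X → Y}
    (hf : ContMDiff (𝓡 m) (𝓡 m') ∞ f) : (pullback (m := m) f η).Smooth := by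
  intro x₀ y hy
  set y₀ := f ((extChartAt (𝓡 m) x₀).symm y) with hy₀
  have hfy := mem_extChartAt_source (I := 𝓡 m') y₀
  set U := {z | z ∈ (extChartAt (𝓡 m) x₀).target ∧
    f ((extChartAt (𝓡 m) x₀).symm z) ∈ (extChartAt (𝓡 m') y₀).source} with hU
  have hUnhds : ∀ z ∈ U, U ∈ 𝓝 z := fun z hz => by
    have hc : ContinuousAt (fun z => f ((extChartAt (𝓡 m) x₀).symm z)) z :=
      hf.continuous.continuousAt.comp
        ((continuousOn_extChartAt_symm x₀).continuousAt
          ((isOpen_extChartAt_target x₀).mem_nhds hz.1))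
    filter_upwards [(isOpen_extChartAt_target x₀).mem_nhds hz.1,
      hc.eventually_mem ((isOpen_extChartAt_source y₀).mem_nhds hz.2)] with w h1 h2
    exact ⟨h1, h2⟩
  have hyU : y ∈ U := ⟨hy, hfy⟩
  have hF : ContDiffAt ℝ ∞ (extChartAt (𝓡 m') y₀ ∘ f ∘ (extChartAt (𝓡 m) x₀).symm) y :=
    contDiffAt_chart hf hy hfy
  have hη' : ContDiffAt ℝ ∞ (η.inChart y₀)
      ((extChartAt (𝓡 m') y₀ ∘ f ∘ (extChartAt (𝓡 m) x₀).symm) y) :=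
    (hη y₀).contDiffAt (extChartAt_target_mem_nhds y₀)
  have key := ContDiffWithinAt.alternating_comp (s := Set.univ)
    (hη'.comp y hF).contDiffWithinAt
    (hF.fderiv_right (m := ∞) (by simp)).contDiffWithinAt
  rw [contDiffWithinAt_univ] at key
  refine (key.congr_of_eventuallyEq ?_).contDiffWithinAt
  filter_upwards [hUnhds y hyU] with z hz
  exact inChart_pullback η (hf.mdifferentiable (by simp)) hz.1 hz.2

/-- The charts at x and at f x are the ones by which d is defined at these points. In them the claim
is `extDeriv_pullback` for the coordinate expression of f. -/
theorem d_pullback {η : Form m' Y q F} (hη : η.Smooth) {f : X → Y}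
    (hf : ContMDiff (𝓡 m) (𝓡 m') ∞ f) : (Form.pullback (m := m) f η).d = Form.pullback f η.d := by
  funext x
  have hfd : MDifferentiable (𝓡 m) (𝓡 m') f := hf.mdifferentiable (by simp)
  set φ := extChartAt (𝓡 m) x with hφ
  set ψ := extChartAt (𝓡 m') (f x) with hψ
  have hx : φ x ∈ φ.target := mem_extChartAt_target x
  have hxs : φ.symm (φ x) = x := extChartAt_to_inv x
  have hfx : f (φ.symm (φ x)) ∈ ψ.source := by rw [hxs]; exact mem_extChartAt_source (f x)
  set F' := ψ ∘ f ∘ φ.symm with hF'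
  have hF'x : F' (φ x) = ψ (f x) := by simp [hF', hxs]
  have hev : (Form.pullback f η).inChart x =ᶠ[𝓝 (φ x)]
      fun y => (η.inChart (f x) (F' y)).compContinuousLinearMap (fderiv ℝ F' y) := by
    have hc : ContinuousAt (fun z => f (φ.symm z)) (φ x) :=
      hf.continuous.continuousAt.comp (continuousAt_extChartAt_symm x)
    filter_upwards [extChartAt_target_mem_nhds x, hc.eventually_mem
      ((isOpen_extChartAt_source (f x)).mem_nhds hfx)] with y h1 h2
    exact inChart_pullback η hfd h1 h2
  have hF : ContDiffAt ℝ ∞ F' (φ x) := contDiffAt_chart hf hx hfx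
  have hηd : DifferentiableAt ℝ (η.inChart (f x)) (F' (φ x)) := by
    rw [hF'x]
    exact hη.differentiableAt (f x)
  have hd := extDeriv_pullback hηd hF (by simp; exact ENat.LEInfty.out)
  have hφd : MDifferentiableAt (𝓡 m) 𝓘(ℝ, Euc m) φ x := mdifferentiableAt_extChartAt (by simp)
  have hψd : MDifferentiableAt (𝓡 m') 𝓘(ℝ, Euc m') ψ (f x) :=
    mdifferentiableAt_extChartAt (by simp)
  have hF'd : MDifferentiableAt 𝓘(ℝ, Euc m) 𝓘(ℝ, Euc m') F' (φ x) :=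
    (contMDiffAt_iff_contDiffAt.2 hF).mdifferentiableAt (by simp)
  have hev2 : F' ∘ φ =ᶠ[𝓝 x] ψ ∘ f := by
    filter_upwards [extChartAt_source_mem_nhds (I := 𝓡 m) x] with z hz
    simp only [hF', Function.comp_apply]
    rw [φ.left_inv hz]
  -- The identity dF' ∘ dφ = dψ ∘ df translates the coordinate result back to the manifolds.
  have h1 := hev2.mfderiv_eq (I := 𝓡 m) (I' := 𝓘(ℝ, Euc m'))
  rw [mfderiv_comp x hF'd hφd, mfderiv_comp x hψd (hfd x), mfderiv_eq_fderiv] at h1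
  rw [d, hev.extDeriv_eq, hd]
  have h2 := congrArg ((extDeriv (η.inChart (f x)) (ψ (f x))).compContinuousLinearMap) h1
  rw [hF'x]
  exact h2

end Form

/-! ### Slices and tangent maps of embeddings -/

section Embedding

open Manifold Topology Set

variable {m m' : ℕ} {X Y : Type*} [TopologicalSpace X] [ChartedSpace (Euc m) X]
  [TopologicalSpace Y] [ChartedSpace (Euc m') Y] {f : X → Y}

/-- Near a point of an embedded submanifold, there are a smooth retraction `r`, a smooth defining
function `k` and a smooth transversal `κ`. -/
theorem exists_slice (hf : IsSmoothEmbedding (𝓡 m) (𝓡 m') ∞ f) {c : ℕ} (hc : m + c = m') (x₀ : X) :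
    ∃ (W : Set Y) (r : Y → X) (k : Y → Euc c) (κ : Euc c → Y), IsOpen W ∧ f x₀ ∈ W ∧
      ContMDiffOn (𝓡 m') (𝓡 m) ∞ r W ∧ ContMDiffOn (𝓡 m') 𝓘(ℝ, Euc c) ∞ k W ∧
      (∀ x, f x ∈ W → r (f x) = x) ∧ (∀ y ∈ W, y ∈ range f ↔ k y = 0) ∧
      ContMDiffAt 𝓘(ℝ, Euc c) (𝓡 m') ∞ κ 0 ∧ κ 0 = f x₀ ∧ ∀ᶠ a in 𝓝 0, k (κ a) = a := by
  have h := hf.isImmersion.isImmersionAt x₀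
  set φ := h.domChart
  set ψ := h.codChart
  set L := h.equiv
  have hφm := h.domChart_mem_maximalAtlas
  have hψm := h.codChart_mem_maximalAtlas
  have hx₀ : x₀ ∈ φ.source := h.mem_domChart_source
  have hchart : ∀ x ∈ φ.source, ψ (f x) = L (φ x, 0) := fun x hx => by
    have := h.writtenInCharts (show φ x ∈ (φ.extend (𝓡 m)).target by simpa using φ.map_source hx)
    simp only [Function.comp_apply, mfld_simps] at this
    rwa [φ.left_inv hx] at this
  have : FiniteDimensional ℝ h.complement :=
    Module.Finite.of_surjective ((LinearMap.snd ℝ (Euc m) h.complement) ∘ₗ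
      L.symm.toLinearEquiv.toLinearMap) (Prod.snd_surjective.comp L.symm.surjective)
  have hfin : Module.finrank ℝ h.complement = Module.finrank ℝ (Euc c) := by
    have := L.toLinearEquiv.finrank_eq
    rw [Module.finrank_prod, finrank_euclideanSpace_fin, finrank_euclideanSpace_fin] at this
    rw [finrank_euclideanSpace_fin]
    omega
  let α : h.complement ≃L[ℝ] Euc c := ContinuousLinearEquiv.ofFinrankEq hfin
  -- That f is a topological embedding, not just an immersion, enters here: inside V the image of f
  -- comes only from the domain of φ, so no other sheet of X meets the slice.
  obtain ⟨V, hV, hVφ⟩ := hf.isEmbedding.isInducing.isOpen_iff.1 φ.open_source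
  -- On T the first slice coordinate lies in the target of φ, so the retraction y ↦ φ⁻¹((L⁻¹ ψ y)₁)
  -- makes sense.
  let T : Set (Euc m') := {y | (L.symm y).1 ∈ φ.target}
  have hT : IsOpen T := φ.open_target.preimage (continuous_fst.comp L.symm.continuous)
  have hpr : ContDiff ℝ ∞ fun y : Euc m' => (L.symm y).1 := contDiff_fst.comp L.symm.contDiff
  have hpr' : ContDiff ℝ ∞ fun y : Euc m' => α (L.symm y).2 :=
    α.contDiff.comp (contDiff_snd.comp L.symm.contDiff)
  have hWopen : IsOpen ((ψ.source ∩ ψ ⁻¹' T) ∩ V) := (ψ.isOpen_inter_preimage hT).inter hV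
  have hψW : ContMDiffOn (𝓡 m') (𝓡 m') ∞ ψ ((ψ.source ∩ ψ ⁻¹' T) ∩ V) :=
    (contMDiffOn_of_mem_maximalAtlas hψm).mono fun y hy => hy.1.1
  have hmem : ∀ x ∈ φ.source, f x ∈ (ψ.source ∩ ψ ⁻¹' T) ∩ V := fun x hx => by
    refine ⟨⟨h.source_subset_preimage_source hx, ?_⟩, ?_⟩
    · change (L.symm (ψ (f x))).1 ∈ φ.target
      rw [hchart x hx, L.symm_apply_apply]
      exact φ.map_source hx
    · change x ∈ f ⁻¹' V
      rw [hVφ]; exact hx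
  have hκ₀ : L (φ x₀, α.symm 0) = ψ (f x₀) := by rw [hchart x₀ hx₀, map_zero]
  refine ⟨(ψ.source ∩ ψ ⁻¹' T) ∩ V, fun y => φ.symm (L.symm (ψ y)).1, fun y => α (L.symm (ψ y)).2,
    fun a => ψ.symm (L (φ x₀, α.symm a)), hWopen, hmem x₀ hx₀, ?_, ?_, ?_, ?_, ?_, ?_, ?_⟩
  · exact (contMDiffOn_symm_of_mem_maximalAtlas hφm).comp
      (hpr.contMDiff.comp_contMDiffOn hψW) fun y hy => hy.1.2
  · exact hpr'.contMDiff.comp_contMDiffOn hψW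
  · intro x hx
    have hxφ : x ∈ φ.source := by rw [← hVφ]; exact hx.2
    dsimp only
    rw [hchart x hxφ, L.symm_apply_apply, φ.left_inv hxφ]
  · intro y hy
    dsimp only
    rw [map_eq_zero_iff _ α.injective]
    constructor
    · rintro ⟨x, rfl⟩
      have hxφ : x ∈ φ.source := by rw [← hVφ]; exact hy.2
      rw [hchart x hxφ, L.symm_apply_apply]
    · intro h0
      have hu := φ.map_target hy.1.2
      refine ⟨φ.symm (L.symm (ψ y)).1, ?_⟩
      apply ψ.injOn (h.source_subset_preimage_source hu) hy.1.1
      rw [hchart _ hu, φ.right_inv hy.1.2, ← h0, Prod.mk.eta, L.apply_symm_apply]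
  · have h1 : ContDiff ℝ ∞ fun a => L (φ x₀, α.symm a) :=
      L.contDiff.comp (contDiff_const.prodMk α.symm.contDiff)
    refine ContMDiffAt.comp (0 : Euc c) ?_ h1.contMDiff.contMDiffAt
    refine contMDiffAt_symm_of_mem_maximalAtlas hψm ?_
    rw [hκ₀]
    exact ψ.map_source (h.source_subset_preimage_source hx₀)
  · dsimp only
    rw [hκ₀, ψ.left_inv (h.source_subset_preimage_source hx₀)]
  · have h1 : Continuous fun a => L (φ x₀, α.symm a) := by fun_prop
    have h2 := h1.continuousAt.eventually_mem (x := 0) (ψ.open_target.mem_nhds (by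
      rw [hκ₀]; exact ψ.map_source (h.source_subset_preimage_source hx₀)))
    filter_upwards [h2] with a ha
    rw [ψ.right_inv ha, L.symm_apply_apply, α.apply_symm_apply]

theorem exists_retraction (hf : IsSmoothEmbedding (𝓡 m) (𝓡 m') ∞ f) (x₀ : X) :
    ∃ (W : Set Y) (r : Y → X), IsOpen W ∧ f x₀ ∈ W ∧ ContMDiffOn (𝓡 m') (𝓡 m) ∞ r W ∧
      ∀ x, f x ∈ W → r (f x) = x := by
  have h := hf.isImmersion.isImmersionAt x₀
  have hle : m ≤ m' := by
    have := LinearMap.finrank_le_finrank_of_injective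
      (f := h.equiv.toLinearEquiv.toLinearMap ∘ₗ LinearMap.inl ℝ (Euc m) h.complement)
      (h.equiv.injective.comp (LinearMap.inl_injective))
    simpa using this
  obtain ⟨W, r, k, κ, h1, h2, h3, -, h5, -⟩ := exists_slice hf (Nat.add_sub_of_le hle) x₀
  exact ⟨W, r, h1, h2, h3, h5⟩

/-- Differentiating r ∘ f = id shows that dr is a local left inverse of df. Injectivity, the
inducing property and the lifting of smoothness for df all follow from this. -/
theorem tangentMapWithin_tangentMap (hf : IsSmoothEmbedding (𝓡 m) (𝓡 m') ∞ f) {W : Set Y}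
    {r : Y → X} (hW : IsOpen W) (hr : ContMDiffOn (𝓡 m') (𝓡 m) ∞ r W)
    (hrf : ∀ x, f x ∈ W → r (f x) = x) (v : TangentBundle (𝓡 m) X) (hv : f v.proj ∈ W) :
    tangentMapWithin (𝓡 m') (𝓡 m) r W (tangentMap (𝓡 m) (𝓡 m') f v) = v := by
  have hfd : MDifferentiableAt (𝓡 m) (𝓡 m') f v.proj :=
    hf.contMDiff.mdifferentiable (by simp) v.proj
  have hrd : MDifferentiableAt (𝓡 m') (𝓡 m) r (f v.proj) :=
    (hr.contMDiffAt (hW.mem_nhds hv)).mdifferentiableAt (by simp)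
  have h1 : tangentMapWithin (𝓡 m') (𝓡 m) r W (tangentMap (𝓡 m) (𝓡 m') f v) =
      tangentMap (𝓡 m') (𝓡 m) r (tangentMap (𝓡 m) (𝓡 m') f v) :=
    tangentMapWithin_eq_tangentMap (hW.uniqueMDiffOn _ hv) hrd
  have hU : IsOpen (f ⁻¹' W) := hW.preimage hf.contMDiff.continuous
  have hun : UniqueMDiffWithinAt (𝓡 m) (f ⁻¹' W) v.proj := hU.uniqueMDiffOn _ hv
  rw [h1, ← tangentMap_comp_at v hrd hfd, ← tangentMapWithin_eq_tangentMap hun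
    (hrd.comp v.proj hfd), tangentMapWithin_congr (f := r ∘ f) (f₁ := id)
    (s := f ⁻¹' W) (fun x hx => hrf x hx) v hv, tangentMapWithin_id hun]

theorem tangentMap_injective (hf : IsSmoothEmbedding (𝓡 m) (𝓡 m') ∞ f) :
    Function.Injective (tangentMap (𝓡 m) (𝓡 m') f) := by
  intro v w hvw
  obtain ⟨W, r, hW, hvW, hr, hrf⟩ := exists_retraction hf v.proj
  have hwW : f w.proj ∈ W := by
    have : f v.proj = f w.proj := congrArg Bundle.TotalSpace.proj hvw
    rwa [← this]
  rw [← tangentMapWithin_tangentMap hf hW hr hrf v hvW, hvw,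
    tangentMapWithin_tangentMap hf hW hr hrf w hwW]

theorem mfderiv_injective (hf : IsSmoothEmbedding (𝓡 m) (𝓡 m') ∞ f) (x : X) :
    Function.Injective (mfderiv (𝓡 m) (𝓡 m') f x) := by
  intro u w huw
  have h : tangentMap (𝓡 m) (𝓡 m') f ⟨x, u⟩ = tangentMap (𝓡 m) (𝓡 m') f ⟨x, w⟩ := by
    simp only [tangentMap, huw]
  have := tangentMap_injective hf h
  simpa using this

variable [IsManifold (𝓡 m) ∞ X] [IsManifold (𝓡 m') ∞ Y]

/-- Near each image vector, df has the continuous left inverse dr, defined on the open set of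
tangent vectors over W. -/
theorem isInducing_tangentMap (hf : IsSmoothEmbedding (𝓡 m) (𝓡 m') ∞ f) :
    IsInducing (tangentMap (𝓡 m) (𝓡 m') f) := by
  have hc : Continuous (tangentMap (𝓡 m) (𝓡 m') f) :=
    hf.contMDiff.continuous_tangentMap (by simp)
  rw [isInducing_iff_nhds]
  intro v
  refine le_antisymm hc.continuousAt.tendsto.le_comap ?_
  obtain ⟨W, r, hW, hvW, hr, hrf⟩ := exists_retraction hf v.proj
  have hopen : IsOpen (Bundle.TotalSpace.proj ⁻¹' W : Set (TangentBundle (𝓡 m') Y)) :=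
    hW.preimage (FiberBundle.continuous_proj _ _)
  have h1 : ContinuousAt (tangentMapWithin (𝓡 m') (𝓡 m) r W) (tangentMap (𝓡 m) (𝓡 m') f v) :=
    (hr.continuousOn_tangentMapWithin (by simp) hW.uniqueMDiffOn).continuousAt
      (hopen.mem_nhds hvW)
  have h2 : Filter.Tendsto (tangentMapWithin (𝓡 m') (𝓡 m) r W ∘ tangentMap (𝓡 m) (𝓡 m') f)
      (Filter.comap (tangentMap (𝓡 m) (𝓡 m') f) (𝓝 (tangentMap (𝓡 m) (𝓡 m') f v))) (𝓝 v) := by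
    have h3 := h1.tendsto
    rw [tangentMapWithin_tangentMap hf hW hr hrf v hvW] at h3
    exact h3.comp Filter.tendsto_comap
  have h4 : tangentMapWithin (𝓡 m') (𝓡 m) r W ∘ tangentMap (𝓡 m) (𝓡 m') f
      =ᶠ[Filter.comap (tangentMap (𝓡 m) (𝓡 m') f) (𝓝 (tangentMap (𝓡 m) (𝓡 m') f v))] id := by
    filter_upwards [Filter.preimage_mem_comap (hopen.mem_nhds hvW)] with w hw
    exact tangentMapWithin_tangentMap hf hW hr hrf w hw
  exact (Filter.tendsto_congr' h4).1 h2

/-- A map to the tangent bundle of an embedded submanifold is smooth if it is smooth as a map to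
the tangent bundle of the ambient manifold. -/
theorem contMDiff_of_tangentMap (hf : IsSmoothEmbedding (𝓡 m) (𝓡 m') ∞ f) {d : ℕ} {N : Type*}
    [TopologicalSpace N] [ChartedSpace (Euc d) N] {h : N → TangentBundle (𝓡 m) X}
    (hh : ContMDiff (𝓡 d) (𝓡 m').tangent ∞ fun q => tangentMap (𝓡 m) (𝓡 m') f (h q)) :
    ContMDiff (𝓡 d) (𝓡 m).tangent ∞ h := by
  intro q₀
  obtain ⟨W, r, hW, hvW, hr, hrf⟩ := exists_retraction hf (h q₀).proj
  have hopen : IsOpen (Bundle.TotalSpace.proj ⁻¹' W : Set (TangentBundle (𝓡 m') Y)) :=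
    hW.preimage (FiberBundle.continuous_proj _ _)
  have h1 : ContMDiffAt (𝓡 m').tangent (𝓡 m).tangent ∞ (tangentMapWithin (𝓡 m') (𝓡 m) r W)
      (tangentMap (𝓡 m) (𝓡 m') f (h q₀)) :=
    (hr.contMDiffOn_tangentMapWithin (by simp) hW.uniqueMDiffOn).contMDiffAt
      (hopen.mem_nhds hvW)
  refine (h1.comp q₀ (hh q₀)).congr_of_eventuallyEq ?_
  filter_upwards [(hh q₀).continuousAt.eventually_mem (hopen.mem_nhds hvW)] with q hq
  exact (tangentMapWithin_tangentMap hf hW hr hrf (h q) hq).symm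

end Embedding

/-! ### Frames -/

section Frames

open Manifold Topology Set

instance {m : ℕ} {M : Type*} [TopologicalSpace M] [ChartedSpace (Euc m) M] (x : M) :
    FiniteDimensional ℝ (TangentSpace (𝓡 m) x) :=
  inferInstanceAs (FiniteDimensional ℝ (Euc m))

theorem finrank_tangentSpace {m : ℕ} {M : Type*} [TopologicalSpace M] [ChartedSpace (Euc m) M]
    (x : M) : Module.finrank ℝ (TangentSpace (𝓡 m) x) = m :=
  finrank_euclideanSpace_fin (𝕜 := ℝ)

namespace SOF

variable {m : ℕ} {M : Type*} [TopologicalSpace M] [ChartedSpace (Euc m) M] {g : Metric m M}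
  {o : Orient m M}

/-- Comparing values in the total space of TM avoids equations between frames in different fibres.
-/
theorem ext_vec {f f' : SOF g o} (h : ∀ a, f.vec a = f'.vec a) : f = f' := by
  obtain ⟨x, fr, _, _⟩ := f
  obtain ⟨x', fr', _, _⟩ := f'
  obtain rfl : x = x' := congrArg Bundle.TotalSpace.proj (h 0)
  obtain rfl : fr = fr' := by
    ext1 a
    simpa [vec] using h a
  rfl

theorem frame_injective (f : SOF g o) : Function.Injective f.frame := by
  rw [injective_iff_map_eq_zero]
  intro a ha
  have h := f.isometry a a
  rw [ha, map_zero, eq_comm] at h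
  exact inner_self_eq_zero.1 h

theorem frame_surjective (f : SOF g o) : Function.Surjective f.frame :=
  (LinearMap.injective_iff_surjective_of_finrank_eq_finrank (by
    rw [finrank_tangentSpace, finrank_euclideanSpace_fin])).1 f.frame_injective

/-- The coordinates of a tangent vector with respect to a frame. -/
def coord (f : SOF g o) (v : TangentSpace (𝓡 m) f.base) : Euc m :=
  WithLp.toLp 2 fun i => g f.base v (f.frame (EuclideanSpace.basisFun (Fin m) ℝ i))

theorem coord_frame (f : SOF g o) (a : Euc m) : f.coord (f.frame a) = a := by
  ext i
  simp only [coord, f.isometry]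
  simp [EuclideanSpace.inner_single_right]

theorem frame_coord (f : SOF g o) (v : TangentSpace (𝓡 m) f.base) : f.frame (f.coord v) = v := by
  obtain ⟨a, rfl⟩ := f.frame_surjective v
  rw [coord_frame]

theorem norm_coord (f : SOF g o) {v : TangentSpace (𝓡 m) f.base} (hv : g f.base v v = 1) :
    ‖f.coord v‖ = 1 := by
  have h := f.isometry (f.coord v) (f.coord v)
  rw [frame_coord, hv, real_inner_self_eq_norm_sq] at h
  exact (sq_eq_sq₀ (norm_nonneg _) zero_le_one).1 (by rw [← h, one_pow])

end SOF

/-- A smooth section of the bundle of bilinear forms, pulled back along b, is evaluated on smooth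
fields along b. Fields along a map are needed because ν lives only along ι. -/
theorem IsRiemannianMetric.contMDiffWithinAt {m d : ℕ} {M N : Type*} [TopologicalSpace M]
    [ChartedSpace (Euc m) M] [IsManifold (𝓡 m) ∞ M] [TopologicalSpace N] [ChartedSpace (Euc d) N]
    {g : Metric m M} (hg : IsRiemannianMetric g) {b : N → M}
    {v w : ∀ q, TangentSpace (𝓡 m) (b q)} {s : Set N} {q : N}
    (hv : ContMDiffWithinAt (𝓡 d) (𝓡 m).tangent ∞
      (fun q => (⟨b q, v q⟩ : TangentBundle (𝓡 m) M)) s q)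
    (hw : ContMDiffWithinAt (𝓡 d) (𝓡 m).tangent ∞
      (fun q => (⟨b q, w q⟩ : TangentBundle (𝓡 m) M)) s q) :
    ContMDiffWithinAt (𝓡 d) 𝓘(ℝ, ℝ) ∞ (fun q => g (b q) (v q) (w q)) s q := by
  obtain ⟨γ, hγ⟩ := hg
  have hb : ContMDiffWithinAt (𝓡 d) (𝓡 m) ∞ b s q := by
    rw [Bundle.contMDiffWithinAt_totalSpace] at hv
    exact hv.1
  have h : ContMDiffWithinAt (𝓡 d) ((𝓡 m).prod 𝓘(ℝ)) ∞
      (fun q ↦ Bundle.TotalSpace.mk' ℝ (E := Bundle.Trivial M ℝ) (b q)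
        (γ.inner (b q) (v q) (w q))) s q := by
    apply ContMDiffWithinAt.clm_bundle_apply₂ (F₁ := Euc m) (F₂ := Euc m)
    · exact ContMDiffAt.comp_contMDiffWithinAt q γ.contMDiff.contMDiffAt hb
    · exact hv
    · exact hw
  rw [Bundle.contMDiffWithinAt_totalSpace] at h
  refine h.2.congr (fun q' _ => ?_) ?_ <;> rw [← hγ] <;> rfl

end Frames

/-! ### Frames of hypersurfaces -/

section Hypersurface

open Manifold Topology Set

theorem basisFun_last (n : ℕ) :
    EuclideanSpace.basisFun (Fin (n + 1)) ℝ (Fin.last n) = eLast n := by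
  simp [eLast]

theorem basisFun_castSucc {n : ℕ} (i : Fin n) :
    EuclideanSpace.basisFun (Fin (n + 1)) ℝ i.castSucc =
      appendZero n (EuclideanSpace.basisFun (Fin n) ℝ i) := by
  ext j
  refine Fin.lastCases ?_ (fun j => ?_) j <;> simp [Fin.castSucc_ne_last]

theorem appendZero_injective (n : ℕ) : Function.Injective (appendZero n) :=
  Function.LeftInverse.injective (g := dropLast n) dropLast_appendZero

theorem inner_appendZero {n : ℕ} (a b : Euc n) : ⟪appendZero n a, appendZero n b⟫ = ⟪a, b⟫ := by
  simp [PiLp.inner_apply, Fin.sum_univ_castSucc]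

variable {n : ℕ} {M Z : Type*} [TopologicalSpace M] [ChartedSpace (Euc (n + 1)) M]
  [IsManifold (𝓡 (n + 1)) ∞ M] [TopologicalSpace Z] [ChartedSpace (Euc n) Z]
  {g : Metric (n + 1) M} {o : Orient (n + 1) M} {ι : Z → M}
  {ν : ∀ z, TangentSpace (𝓡 (n + 1)) (ι z)}

theorem frameInclusion_vec_appendZero (hg : IsRiemannianMetric g) (hν : IsUnitNormalField g ι ν)
    (f : SOF (inducedMetric g ι) (inducedOrient o ι ν)) (a : Euc n) :
    (frameInclusion hg hν f).vec (appendZero n a) = tangentMap (𝓡 n) (𝓡 (n + 1)) ι (f.vec a) := by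
  change (⟨ι f.base, extendFrame f (appendZero n a)⟩ : TangentBundle (𝓡 (n + 1)) M) = _
  rw [extendFrame_apply, dropLast_appendZero, appendZero_last, zero_smul, add_zero]
  rfl

theorem frameInclusion_vec_eLast (hg : IsRiemannianMetric g) (hν : IsUnitNormalField g ι ν)
    (f : SOF (inducedMetric g ι) (inducedOrient o ι ν)) :
    (frameInclusion hg hν f).vec (eLast n) = ⟨ι f.base, ν f.base⟩ := by
  change (⟨ι f.base, extendFrame f (eLast n)⟩ : TangentBundle (𝓡 (n + 1)) M) = _
  rw [extendFrame_apply, dropLast_eLast, map_zero, map_zero, eLast_last, one_smul, zero_add]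

theorem frameInclusion_injective (hg : IsRiemannianMetric g) (hν : IsUnitNormalField g ι ν)
    (hι : IsSmoothEmbedding (𝓡 n) (𝓡 (n + 1)) ∞ ι) :
    Function.Injective (frameInclusion (o := o) hg hν) := by
  intro f f' h
  refine SOF.ext_vec fun a => tangentMap_injective hι ?_
  rw [← frameInclusion_vec_appendZero hg hν, h, frameInclusion_vec_appendZero]

/-- The frames of `M` that come from frames of `Z`: those with last vector `ν`. -/
theorem exists_frameInclusion_eq (hg : IsRiemannianMetric g) (hν : IsUnitNormalField g ι ν)
    (hι : IsSmoothEmbedding (𝓡 n) (𝓡 (n + 1)) ∞ ι) {Φ : SOF g o} {z : Z}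
    (h : Φ.vec (eLast n) = ⟨ι z, ν z⟩) :
    ∃ f : SOF (inducedMetric g ι) (inducedOrient o ι ν), f.base = z ∧
      frameInclusion hg hν f = Φ := by
  obtain ⟨x, fr, hiso, hpos⟩ := Φ
  obtain rfl : x = ι z := congrArg Bundle.TotalSpace.proj h
  have hν' : fr (eLast n) = ν z := by simpa [SOF.vec] using h
  set A : TangentSpace (𝓡 n) z →ₗ[ℝ] TangentSpace (𝓡 (n + 1)) (ι z) :=
    (mfderiv (𝓡 n) (𝓡 (n + 1)) ι z).toLinearMap
  have hA : Function.Injective A := mfderiv_injective hι z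
  have hfr : Function.Injective fr := SOF.frame_injective ⟨ι z, fr, hiso, hpos⟩
  have hfrs : Function.Surjective fr := SOF.frame_surjective ⟨ι z, fr, hiso, hpos⟩
  -- The image of dι is orthogonal to ν = fr(e), hence contained in fr(ℝ^n), and both spaces have
  -- dimension n.
  have hrange : LinearMap.range A = LinearMap.range (fr ∘ₗ appendZero n) := by
    refine Submodule.eq_of_le_of_finrank_eq ?_ ?_
    · rintro _ ⟨u, rfl⟩
      obtain ⟨y, hy⟩ := hfrs (A u)
      have h0 : g (ι z) (A u) (ν z) = 0 := hν.orthogonal z u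
      rw [← hy, ← hν', hiso, inner_eLast] at h0
      exact ⟨dropLast n y, by rw [LinearMap.comp_apply, appendZero_dropLast h0, hy]⟩
    · have h2 : Function.Injective (fr ∘ₗ appendZero n) := by
        rw [LinearMap.coe_comp]
        exact hfr.comp (appendZero_injective n)
      rw [LinearMap.finrank_range_of_inj hA, LinearMap.finrank_range_of_inj h2,
        finrank_tangentSpace, finrank_euclideanSpace_fin]
  -- K inverts dι on fr(ℝ^n), so K ∘ fr restricted to ℝ^n is the required frame of Z.
  obtain ⟨K, hK⟩ := A.exists_leftInverse_of_injective (LinearMap.ker_eq_bot.2 hA)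
  have hAK : ∀ a, A (K (fr (appendZero n a))) = fr (appendZero n a) := fun a => by
    obtain ⟨u, hu⟩ : fr (appendZero n a) ∈ LinearMap.range A := by rw [hrange]; exact ⟨a, rfl⟩
    rw [← hu, show K (A u) = u from LinearMap.congr_fun hK u]
  have hsnoc : (fun i => fr (EuclideanSpace.basisFun (Fin (n + 1)) ℝ i)) =
      Fin.snoc (α := fun _ => TangentSpace (𝓡 (n + 1)) (ι z))
        (fun i => A ((K ∘ₗ fr ∘ₗ appendZero n) (EuclideanSpace.basisFun (Fin n) ℝ i))) (ν z) := by
    funext i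
    refine Fin.lastCases ?_ (fun j => ?_) i
    · rw [Fin.snoc_last, basisFun_last, hν']
    · rw [Fin.snoc_castSucc, basisFun_castSucc]
      exact (hAK _).symm
  -- The contracted form is nonzero on the frame under construction, so the induced orientation at z
  -- is not the junk value.
  have hne : contractLast (o (ι z)).someVector A (ν z) ≠ 0 := by
    intro h0
    have h1 := congrArg (fun F => F fun i =>
      (K ∘ₗ fr ∘ₗ appendZero n) (EuclideanSpace.basisFun (Fin n) ℝ i)) h0
    have h2 := hpos
    have ho : o (ι z) = rayOfNeZero ℝ (o (ι z)).someVector (o (ι z)).someVector_ne_zero :=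
      (o (ι z)).someVector_ray.symm
    rw [ho, positiveTuple_rayOfNeZero, hsnoc] at h2
    exact h2.ne' h1
  let f : SOF (inducedMetric g ι) (inducedOrient o ι ν) :=
    { base := z
      frame := K ∘ₗ fr ∘ₗ appendZero n
      isometry := fun a b => by
        change g (ι z) (A (K (fr (appendZero n a)))) (A (K (fr (appendZero n b)))) = _
        rw [hAK, hAK, hiso, inner_appendZero]
      positive := by
        refine (positiveTuple_inducedOrientation _ _ _ _ hne _).2 ?_
        rw [← hsnoc]
        exact hpos }
  refine ⟨f, rfl, SOF.ext_vec fun a => ?_⟩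
  change (⟨ι z, extendFrame f a⟩ : TangentBundle (𝓡 (n + 1)) M) = ⟨ι z, fr a⟩
  rw [extendFrame_apply]
  change (⟨ι z, A (K (fr (appendZero n (dropLast n a)))) + a (Fin.last n) • ν z⟩ :
    TangentBundle (𝓡 (n + 1)) M) = _
  rw [hAK, ← hν', ← map_smul, ← map_add, appendZero_dropLast_add]

variable [IsManifold (𝓡 n) ∞ Z] {P : Type*}

/-- This turns membership in P_Z into a condition on the last frame vector alone, the form in which
invariance and slice equations are checked. -/
theorem mem_range_snd_iff (hg : IsRiemannianMetric g) (hν : IsUnitNormalField g ι ν)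
    (hι : IsSmoothEmbedding (𝓡 n) (𝓡 (n + 1)) ∞ ι) {Λ : P → SOF g o} {p : P} :
    p ∈ range (fun q : PullbackSpace hg hν Λ => q.1.2) ↔
      ∃ z, (Λ p).vec (eLast n) = ⟨ι z, ν z⟩ := by
  constructor
  · rintro ⟨⟨⟨f, p⟩, h⟩, rfl⟩
    exact ⟨f.base, by rw [← h, frameInclusion_vec_eLast]⟩
  · rintro ⟨z, hz⟩
    obtain ⟨f, -, hf⟩ := exists_frameInclusion_eq hg hν hι hz
    exact ⟨⟨⟨f, p⟩, hf⟩, rfl⟩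

/-- `P_Z → P` is a topological embedding. -/
theorem isEmbedding_snd [TopologicalSpace P] (hg : IsRiemannianMetric g) (hν : IsUnitNormalField g ι ν)
    (hι : IsSmoothEmbedding (𝓡 n) (𝓡 (n + 1)) ∞ ι) {Λ : P → SOF g o}
    (hΛ : ∀ a, Continuous fun p => (Λ p).vec a) :
    IsEmbedding (fun q : PullbackSpace hg hν Λ => q.1.2) := by
  refine ⟨⟨le_antisymm ?_ ?_⟩, ?_⟩
  · rw [← continuous_iff_le_induced]
    exact continuous_snd.comp continuous_subtype_val
  · let _ : TopologicalSpace (PullbackSpace hg hν Λ) :=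
      TopologicalSpace.induced (fun q : PullbackSpace hg hν Λ => q.1.2) inferInstance
    have h2 : Continuous fun q : PullbackSpace hg hν Λ => q.1.2 := continuous_induced_dom
    -- The frame depends continuously on p because dι(f(a)) = Λ(p)(a, 0) and dι is inducing.
    have h1 : Continuous fun q : PullbackSpace hg hν Λ => q.1.1 := by
      refine continuous_induced_rng.2 (continuous_pi fun a => ?_)
      rw [(isInducing_tangentMap hι).continuous_iff]
      refine ((hΛ (appendZero n a)).comp h2).congr fun q => ?_
      rw [Function.comp_apply, ← q.2, frameInclusion_vec_appendZero]
      rfl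
    rw [← continuous_id_iff_le]
    exact continuous_induced_rng.2 (h1.prodMk h2)
  · rintro ⟨⟨f, p⟩, h⟩ ⟨⟨f', p'⟩, h'⟩ (rfl : p = p')
    obtain rfl : f = f' := frameInclusion_injective hg hν hι (h.trans h'.symm)
    rfl

end Hypersurface

/-! ### Local trivializations of principal bundles -/

section Trivializations

open Manifold Topology Set

/-- `s` and `τ` trivialize the principal bundle `π : P → M` over the open set `U`. -/
structure IsLocalTrivialization {m d : ℕ} {M P : Type*} [TopologicalSpace M]
    [ChartedSpace (Euc m) M] [TopologicalSpace P] [ChartedSpace (Euc d) P] {k : ℕ}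
    [MulAction (SpinC k)ᵐᵒᵖ P] (π : P → M) (U : Set M) (s : M → P) (τ : P → SpinC k) : Prop where
  isOpen : IsOpen U
  section_smooth : ContMDiffOn (𝓡 m) (𝓡 d) ∞ s U
  smooth : ContMDiffOn (𝓡 d) 𝓘(ℝ, ClC k) ∞ (fun p => toClC (τ p)) (π ⁻¹' U)
  proj_section : ∀ x ∈ U, π (s x) = x
  smul_section : ∀ p, π p ∈ U → MulOpposite.op (τ p) • s (π p) = p
  apply_smul_section : ∀ x ∈ U, ∀ X : SpinC k, τ (MulOpposite.op X • s x) = X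

theorem toClC_mul_contMDiffWithinAt {k : ℕ} {E H N : Type*} [NormedAddCommGroup E]
    [NormedSpace ℝ E] [TopologicalSpace H] {I : ModelWithCorners ℝ E H} [TopologicalSpace N]
    [ChartedSpace H N] {X Y : N → SpinC k} {S : Set N} {q : N}
    (hX : ContMDiffWithinAt I 𝓘(ℝ, ClC k) ∞ (fun q => toClC (X q)) S q)
    (hY : ContMDiffWithinAt I 𝓘(ℝ, ClC k) ∞ (fun q => toClC (Y q)) S q) :
    ContMDiffWithinAt I 𝓘(ℝ, ClC k) ∞ (fun q => toClC (X q * Y q)) S q := by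
  have h : ContMDiffAt 𝓘(ℝ, ClC k × ClC k) 𝓘(ℝ, ClC k) ∞ (fun p : ClC k × ClC k => p.1 * p.2)
      (toClC (X q), toClC (Y q)) := contDiff_mul_clC.contMDiff.contMDiffAt
  exact ContMDiffAt.comp_contMDiffWithinAt
    (f := fun q => ((toClC (X q), toClC (Y q)) : ClC k × ClC k)) q h (hX.prodMk_space hY)

variable {m d : ℕ} {M P : Type*} [TopologicalSpace M] [ChartedSpace (Euc m) M]
  [TopologicalSpace P] [ChartedSpace (Euc d) P] {k : ℕ} [MulAction (SpinC k)ᵐᵒᵖ P] {π : P → M}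

theorem toClC_inv_contMDiffWithinAt {E H N : Type*} [NormedAddCommGroup E]
    [NormedSpace ℝ E] [TopologicalSpace H] {I : ModelWithCorners ℝ E H} [TopologicalSpace N]
    [ChartedSpace H N] {X : N → SpinC k} {S : Set N} {q : N}
    (hX : ContMDiffWithinAt I 𝓘(ℝ, ClC k) ∞ (fun q => toClC (X q)) S q) :
    ContMDiffWithinAt I 𝓘(ℝ, ClC k) ∞ (fun q => toClC (X q)⁻¹) S q := by
  simp only [toClC_inv]
  exact ((clCStar k).contDiff_of_finiteDimensional (m := ∞)).contMDiff.contMDiffAt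
    |>.comp_contMDiffWithinAt q hX

theorem IsPrincipalSpinCBundle.contMDiffWithinAt_smul
    (hB : IsPrincipalSpinCBundle (m := m) (d := d) k π) {E H N : Type*} [NormedAddCommGroup E]
    [NormedSpace ℝ E] [TopologicalSpace H] {I : ModelWithCorners ℝ E H} [TopologicalSpace N]
    [ChartedSpace H N] {X : N → SpinC k} {b : N → P} {S : Set N} {q : N}
    (hX : ContMDiffWithinAt I 𝓘(ℝ, ClC k) ∞ (fun q => toClC (X q)) S q)
    (hb : ContMDiffWithinAt I (𝓡 d) ∞ b S q) :
    ContMDiffWithinAt I (𝓡 d) ∞ (fun q => MulOpposite.op (X q) • b q) S q := by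
  obtain ⟨F, hF, hFX⟩ := hB.smooth_action
  have h := (hF (b q, toClC (X q)) ⟨mem_univ _, mem_range_self _⟩).comp
    (f := fun q => (b q, toClC (X q))) q (hb.prodMk hX)
    (fun q' _ => mk_mem_prod (mem_univ _) (mem_range_self _))
  exact h.congr (fun q' _ => (hFX _ _).symm) (hFX _ _).symm

theorem IsPrincipalSpinCBundle.contMDiff_smul
    (hB : IsPrincipalSpinCBundle (m := m) (d := d) k π) (X : SpinC k) :
    ContMDiff (𝓡 d) (𝓡 d) ∞ (fun p : P => MulOpposite.op X • p) := fun _ =>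
  hB.contMDiffWithinAt_smul (X := fun _ => X) contMDiff_const.contMDiffAt contMDiff_id.contMDiffAt

/-- When the section s is replaced by s·X, the fibre coordinate of p = s·τ becomes X⁻¹τ. -/
theorem IsLocalTrivialization.gauge (hB : IsPrincipalSpinCBundle (m := m) (d := d) k π)
    {U : Set M} {s : M → P} {τ : P → SpinC k}
    (h : IsLocalTrivialization (m := m) (d := d) π U s τ) {V : Set M} (hV : IsOpen V) (hVU : V ⊆ U)
    {X : M → SpinC k} (hX : ContMDiffOn (𝓡 m) 𝓘(ℝ, ClC k) ∞ (fun x => toClC (X x)) V) :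
    IsLocalTrivialization (m := m) (d := d) π V (fun x => MulOpposite.op (X x) • s x)
      (fun p => (X (π p))⁻¹ * τ p) where
  isOpen := hV
  section_smooth x hx := hB.contMDiffWithinAt_smul (hX x hx) (h.section_smooth.mono hVU x hx)
  smooth p hp := toClC_mul_contMDiffWithinAt
    (toClC_inv_contMDiffWithinAt ((hX (π p) hp).comp p (hB.smooth_proj p).contMDiffWithinAt
      (fun _ hq => hq)))
    (h.smooth.mono (preimage_mono hVU) p hp)
  proj_section x hx := by rw [hB.proj_action, h.proj_section x (hVU hx)]
  smul_section p hp := by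
    rw [← mul_smul, ← MulOpposite.op_mul, mul_inv_cancel_left, h.smul_section p (hVU hp)]
  apply_smul_section x hx Y := by
    rw [← mul_smul, ← MulOpposite.op_mul, h.apply_smul_section x (hVU hx), hB.proj_action,
      h.proj_section x (hVU hx), inv_mul_cancel_left]

end Trivializations

/-! ### Trivializations adapted to a hypersurface -/

section Adapted

open Manifold Topology Set

variable {n d : ℕ} {M Z P : Type*} [TopologicalSpace M] [ChartedSpace (Euc (n + 1)) M]
  [IsManifold (𝓡 (n + 1)) ∞ M] [TopologicalSpace Z] [ChartedSpace (Euc n) Z]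
  {g : Metric (n + 1) M} {o : Orient (n + 1) M} {ι : Z → M}
  {ν : ∀ z, TangentSpace (𝓡 (n + 1)) (ι z)}
  [TopologicalSpace P] [ChartedSpace (Euc d) P]
  [MulAction (SpinC (n + 1))ᵐᵒᵖ P] {Λ : P → SOF g o}

/-- In the frame of an arbitrary section s over Z, the normal ν has coordinates β(z) on the unit
sphere. A rotor taking e to β(z), extended off Z through the retraction r, corrects s so that its
last frame vector along Z is ν. -/
theorem exists_adapted_trivialization (hn : 1 ≤ n) (hg : IsRiemannianMetric g)
    (hν : IsUnitNormalField g ι ν) (hι : IsSmoothEmbedding (𝓡 n) (𝓡 (n + 1)) ∞ ι)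
    (hΛ : SOF.SmoothMap (d := d) Λ)
    (hB : IsPrincipalSpinCBundle (m := n + 1) (d := d) (n + 1) (fun p => (Λ p).base))
    (hΛX : ∀ (p : P) (X : SpinC (n + 1)) (y : Euc (n + 1)),
      (Λ (MulOpposite.op X • p)).vec y = (Λ p).vec (rot X y)) (z₀ : Z) :
    ∃ (U : Set M) (s : M → P) (τ : P → SpinC (n + 1)),
      IsLocalTrivialization (m := n + 1) (d := d) (fun p => (Λ p).base) U s τ ∧ ι z₀ ∈ U ∧
      ∀ z, ι z ∈ U → (Λ (s (ι z))).vec (eLast n) = ⟨ι z, ν z⟩ := by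
  obtain ⟨U, hU, hzU, s, τ, hs, hτ, hs1, hs2, hs3⟩ := hB.locally_trivial (ι z₀)
  have hT : IsLocalTrivialization (m := n + 1) (d := d) (fun p => (Λ p).base) U s τ :=
    ⟨hU, hs, hτ, hs1, hs2, hs3⟩
  obtain ⟨W, r, hW, hzW, hr, hrι⟩ := exists_retraction hι z₀
  have hιs : ContMDiff (𝓡 n) (𝓡 (n + 1)) ∞ ι := hι.isImmersion.contMDiff
  -- The base point of Λ(s(ι z)) is ι z only over U, so ν(z) is transported through the model space.
  let ν' : ∀ z, TangentSpace (𝓡 (n + 1)) (Λ (s (ι z))).base := fun z => (ν z : Euc (n + 1))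
  have hν' : ∀ z, ι z ∈ U → (⟨(Λ (s (ι z))).base, ν' z⟩ : TangentBundle (𝓡 (n + 1)) M) =
      ⟨ι z, ν z⟩ := fun z hz =>
    congrArg (fun x => (⟨x, (ν z : Euc (n + 1))⟩ : TangentBundle (𝓡 (n + 1)) M)) (hs1 _ hz)
  let β : Z → Euc (n + 1) := fun z => (Λ (s (ι z))).coord (ν' z)
  have hβ1 : ∀ z, ι z ∈ U → ‖β z‖ = 1 := fun z hz => by
    refine SOF.norm_coord _ ?_
    have h := congrArg (fun v : TangentBundle (𝓡 (n + 1)) M => g v.1 v.2 v.2) (hν' z hz)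
    exact h.trans (hν.unit z)
  have hβ : ContMDiffOn (𝓡 n) 𝓘(ℝ, Euc (n + 1)) ∞ β (ι ⁻¹' U) := by
    intro z hz
    refine (EuclideanSpace.equiv (Fin (n + 1)) ℝ).symm.contDiff.contMDiff.contMDiffAt
      |>.comp_contMDiffWithinAt z (contMDiffWithinAt_pi_space.2 fun i => ?_)
    refine hg.contMDiffWithinAt ?_ ?_
    · exact hν.smooth.contMDiffAt.contMDiffWithinAt.congr hν' (hν' z hz)
    · exact (hΛ (EuclideanSpace.basisFun _ ℝ i)).contMDiffAt.comp_contMDiffWithinAt z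
        ((hs _ hz).comp z hιs.contMDiffAt.contMDiffWithinAt fun _ h => h)
  obtain ⟨V, X, hV, hzV, hX, hXr⟩ := exists_rotor hn (b₀ := β z₀)
  -- The points of U whose retraction to Z lies where β is defined by the section and takes values
  -- in the domain of the rotor.
  set U' : Set M := U ∩ (W ∩ r ⁻¹' (ι ⁻¹' U ∩ β ⁻¹' V))
  have hO : IsOpen (ι ⁻¹' U ∩ β ⁻¹' V) :=
    hβ.continuousOn.isOpen_inter_preimage (hU.preimage hιs.continuous) hV
  have hU' : IsOpen U' := hU.inter (hr.continuousOn.isOpen_inter_preimage hW hO)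
  have hz₀ : ι z₀ ∈ U' := ⟨hzU, hzW, by rw [mem_preimage, hrι _ hzW]; exact ⟨hzU, hzV⟩⟩
  have hXβ : ContMDiffOn (𝓡 (n + 1)) 𝓘(ℝ, ClC (n + 1)) ∞ (fun x => toClC (X (β (r x)))) U' :=
    (hX.contMDiffOn.comp (hβ.mono inter_subset_left) inter_subset_right).comp
      (hr.mono fun x hx => hx.2.1) fun x hx => hx.2.2
  refine ⟨U', _, _, hT.gauge hB hU' inter_subset_left hXβ, hz₀, fun z hz => ?_⟩
  have hzU := hz.1
  rw [hΛX, hrι z hz.2.1, hXr _ (by simpa [hrι z hz.2.1] using hz.2.2.2) (hβ1 z hz.1)]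
  rw [← hν' z hz.1]
  exact congrArg (fun v => (⟨_, v⟩ : TangentBundle (𝓡 (n + 1)) M)) (SOF.frame_coord _ _)

variable [IsManifold (𝓡 n) ∞ Z]

/-- In an adapted trivialization, `i'(P_Z)` consists of the points over `Z` whose `τ`-component
fixes the last basis vector. -/
theorem mem_range_snd_iff_of_adapted (hg : IsRiemannianMetric g)
    (hν : IsUnitNormalField g ι ν) (hι : IsSmoothEmbedding (𝓡 n) (𝓡 (n + 1)) ∞ ι)
    (hΛX : ∀ (p : P) (X : SpinC (n + 1)) (y : Euc (n + 1)),
      (Λ (MulOpposite.op X • p)).vec y = (Λ p).vec (rot X y))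
    {U : Set M} {s : M → P} {τ : P → SpinC (n + 1)}
    (hT : IsLocalTrivialization (m := n + 1) (d := d) (fun p => (Λ p).base) U s τ)
    (hsν : ∀ z, ι z ∈ U → (Λ (s (ι z))).vec (eLast n) = ⟨ι z, ν z⟩) {p : P}
    (hp : (Λ p).base ∈ U) :
    p ∈ range (fun q : PullbackSpace hg hν Λ => q.1.2) ↔
      (Λ p).base ∈ range ι ∧ rot (τ p) (eLast n) = eLast n := by
  rw [mem_range_snd_iff hg hν hι]
  have hv : ∀ y, (Λ p).vec y = (Λ (s (Λ p).base)).vec (rot (τ p) y) := fun y => by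
    rw [← hΛX, hT.smul_section p hp]
  constructor
  · rintro ⟨z, hz⟩
    have hb : (Λ p).base = ι z := congrArg Bundle.TotalSpace.proj hz
    refine ⟨⟨z, hb.symm⟩, ?_⟩
    have hb' := hb ▸ hp
    have h1 : (Λ (s (ι z))).vec (rot (τ p) (eLast n)) = (Λ (s (ι z))).vec (eLast n) := by
      rw [hsν z hb', ← hz, hv, hb]
    refine SOF.frame_injective (Λ (s (ι z))) ?_
    simpa [SOF.vec] using h1
  · rintro ⟨⟨z, hz⟩, hrot⟩
    refine ⟨z, ?_⟩
    rw [hv, hrot, ← hz]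
    exact hsν z (hz ▸ hp)

/-- Vanishing of the first n coordinates leaves e and -e; positivity of the last coordinate selects
e. -/
theorem eq_eLast_of_norm {y : Euc (n + 1)} (hy : ‖y‖ = 1) (h0 : dropLast n y = 0)
    (hpos : 0 < y (Fin.last n)) : y = eLast n := by
  have h := norm_sq_eq_dropLast y
  rw [hy, h0, norm_zero] at h
  have h1 : y (Fin.last n) = 1 := by nlinarith
  rw [← appendZero_dropLast_add y, h0, h1, map_zero, one_smul, zero_add]

/-- The point of the upper half sphere over `a`. -/
def hemisphere (n : ℕ) (a : Euc n) : Euc (n + 1) :=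
  appendZero n a + √(1 - ‖a‖ ^ 2) • eLast n

theorem dropLast_hemisphere (a : Euc n) : dropLast n (hemisphere n a) = a := by
  rw [hemisphere, map_add, map_smul, dropLast_appendZero, dropLast_eLast, smul_zero, add_zero]

theorem norm_hemisphere {a : Euc n} (ha : ‖a‖ < 1) : ‖hemisphere n a‖ = 1 := by
  have h := norm_sq_eq_dropLast (hemisphere n a)
  have h1 : hemisphere n a (Fin.last n) = √(1 - ‖a‖ ^ 2) := by
    simp [hemisphere, appendZero_last, eLast_last]
  have h2 : 0 ≤ 1 - ‖a‖ ^ 2 := by nlinarith [norm_nonneg a]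
  rw [dropLast_hemisphere, h1, Real.sq_sqrt h2, add_sub_cancel] at h
  exact (sq_eq_sq₀ (norm_nonneg _) zero_le_one).1 (by rw [h, one_pow])

theorem hemisphere_zero : hemisphere n 0 = eLast n := by simp [hemisphere]

theorem contDiffAt_hemisphere : ContDiffAt ℝ ∞ (hemisphere n) 0 := by
  have h : ContDiffAt ℝ ∞ (fun a : Euc n => 1 - ‖a‖ ^ 2) 0 :=
    contDiffAt_const.sub (contDiff_norm_sq ℝ).contDiffAt
  have h0 : ContDiffAt ℝ ∞ (fun a : Euc n => appendZero n a) 0 :=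
    (appendZero n).contDiff_of_finiteDimensional.contDiffAt
  exact h0.add ((h.sqrt (by simp)).smul contDiffAt_const)

/-- A rotor near the last basis vector, trivial there. -/
theorem exists_rotor_eLast (hn : 1 ≤ n) :
    ∃ (V : Set (Euc (n + 1))) (X : Euc (n + 1) → SpinC (n + 1)), IsOpen V ∧ eLast n ∈ V ∧
      ContDiffOn ℝ ∞ (fun b => toClC (X b)) V ∧ X (eLast n) = 1 ∧
      ∀ b ∈ V, ‖b‖ = 1 → rot (X b) (eLast n) = b := by
  obtain ⟨V, X, hV, heV, hX, hXr⟩ := exists_rotor hn (b₀ := eLast n)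
  -- X(e) fixes e, so multiplying by its inverse normalizes the rotor to 1 at e without changing the
  -- image of e.
  refine ⟨V, fun b => X b * (X (eLast n))⁻¹, hV, heV, ?_, mul_inv_cancel _, fun b hb hb1 => ?_⟩
  · exact contDiff_mul_clC.comp_contDiffOn (hX.prodMk contDiffOn_const)
  · have h := rot_inv_rot (X (eLast n)) (eLast n)
    rw [hXr _ heV (norm_eLast n)] at h
    rw [rot_mul, h, hXr b hb hb1]

/-- The image of `P_Z` in `P` is cut out by a submersion near each of its points. -/
theorem exists_slice_chart (hn : 1 ≤ n) [IsManifold (𝓡 d) ∞ P] (hg : IsRiemannianMetric g)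
    (hν : IsUnitNormalField g ι ν) (hι : IsSmoothEmbedding (𝓡 n) (𝓡 (n + 1)) ∞ ι)
    (hΛ : SOF.SmoothMap (d := d) Λ)
    (hB : IsPrincipalSpinCBundle (m := n + 1) (d := d) (n + 1) (fun p => (Λ p).base))
    (hΛX : ∀ (p : P) (X : SpinC (n + 1)) (y : Euc (n + 1)),
      (Λ (MulOpposite.op X • p)).vec y = (Λ p).vec (rot X y)) {K : Type*} [NormedAddCommGroup K]
    [NormedSpace ℝ K] [FiniteDimensional ℝ K] (L : (K × (Euc 1 × Euc n)) ≃L[ℝ] Euc d)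
    (q₀ : PullbackSpace hg hν Λ) :
    ∃ e ∈ IsManifold.maximalAtlas (𝓡 d) ∞ P, q₀.1.2 ∈ e.source ∧ ∀ p ∈ e.source,
      p ∈ range (fun q : PullbackSpace hg hν Λ => q.1.2) ↔ (L.symm (e p)).2 = 0 := by
  obtain ⟨U, s, τ, hT, hz₀, hsν⟩ :=
    exists_adapted_trivialization hn hg hν hι hΛ hB hΛX q₀.1.1.base
  obtain ⟨W, -, k, κ, hW, hzW, -, hk, -, hkι, hκ, hκ0, hkκ⟩ := exists_slice hι rfl q₀.1.1.base
  obtain ⟨V, X, hV, heV, hX, hX1, hXr⟩ := exists_rotor_eLast hn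
  set p₀ := q₀.1.2 with hp₀
  have hπ : (Λ p₀).base = ι q₀.1.1.base := by rw [← q₀.2]; rfl
  have hrange := fun p hp => mem_range_snd_iff_of_adapted (p := p) hg hν hι hΛX hT hsν hp
  have hfix : rot (τ p₀) (eLast n) = eLast n :=
    ((hrange p₀ (hπ ▸ hz₀)).1 ⟨q₀, rfl⟩).2
  let π : P → M := fun p => (Λ p).base
  have hπs : ContMDiff (𝓡 d) (𝓡 (n + 1)) ∞ π := hB.smooth_proj
  -- The image of e under the fibre coordinate, a point of the unit sphere. Using `rotFun` makes its
  -- smoothness visible.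
  let y : P → Euc (n + 1) := fun p => rotFun (n + 1) (toClC (τ p)) (eLast n)
  have hyr : ∀ p, y p = rot (τ p) (eLast n) := fun p => rotFun_toClC _ _
  have hy1 : ∀ p, ‖y p‖ = 1 := fun p => by rw [hyr, norm_rot, norm_eLast]
  have hy : ContMDiffOn (𝓡 d) 𝓘(ℝ, Euc (n + 1)) ∞ y (π ⁻¹' U) :=
    (contDiff_rotFun (eLast n)).contMDiff.comp_contMDiffOn hT.smooth
  have hO : IsOpen (π ⁻¹' U ∩ y ⁻¹' {b | 0 < b (Fin.last n)}) :=
    hy.continuousOn.isOpen_inter_preimage (hT.isOpen.preimage hπs.continuous)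
      (isOpen_lt continuous_const (EuclideanSpace.proj (𝕜 := ℝ) (Fin.last n)).continuous)
  -- On the open upper hemisphere the first n coordinates determine a unit vector.
  let W' : Set P := (π ⁻¹' U ∩ y ⁻¹' {b | 0 < b (Fin.last n)}) ∩ π ⁻¹' W
  -- The first component vanishes where the base point is in Z, the second where the fibre
  -- coordinate fixes e.
  let h : P → Euc 1 × Euc n := fun p => (k (π p), dropLast n (y p))
  have hh : ContMDiffOn (𝓡 d) 𝓘(ℝ, Euc 1 × Euc n) ∞ h W' :=
    (hk.comp hπs.contMDiffOn fun p hp => hp.2).prodMk_space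
      ((dropLast n).contDiff_of_finiteDimensional.contMDiff.comp_contMDiffOn
        (hy.mono fun p hp => hp.1.1))
  have hy₀ : y p₀ = eLast n := (hyr _).trans hfix
  have hp₀W : p₀ ∈ W' := by
    refine ⟨⟨?_, ?_⟩, ?_⟩
    · rw [mem_preimage, show π p₀ = _ from hπ]; exact hz₀
    · rw [mem_preimage, hy₀]; simp [eLast_last]
    · rw [mem_preimage, show π p₀ = _ from hπ]; exact hzW
  have hh₀ : h p₀ = 0 := by
    have h1 : k (π p₀) = 0 := (hkι _ hp₀W.2).1 ⟨q₀.1.1.base, hπ.symm⟩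
    simp only [h, h1, hy₀, dropLast_eLast, Prod.mk_zero_zero]
  -- A local section of h through p₀: the base point moves along the transversal κ, and the rotor
  -- moves e to the prescribed point of the hemisphere. The factor τ(p₀) stands on the right because
  -- it fixes e.
  let σ : Euc 1 × Euc n → P := fun c =>
    MulOpposite.op (X (hemisphere n c.2) * τ p₀) • s (κ c.1)
  have hσ₀ : σ (h p₀) = p₀ := by
    simp only [σ, hh₀, Prod.fst_zero, Prod.snd_zero, hemisphere_zero, hX1, one_mul, hκ0]
    rw [← hπ]
    exact hT.smul_section p₀ hp₀W.1.1
  have hκU : ∀ᶠ c in 𝓝 (0 : Euc 1), κ c ∈ U :=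
    hκ.continuousAt.eventually (hκ0.symm ▸ hT.isOpen.mem_nhds hz₀)
  have hVe : ∀ᶠ a in 𝓝 (0 : Euc n), hemisphere n a ∈ V :=
    contDiffAt_hemisphere.continuousAt.eventually (hemisphere_zero (n := n) ▸ hV.mem_nhds heV)
  have hσ : ContMDiffAt 𝓘(ℝ, Euc 1 × Euc n) (𝓡 d) ∞ σ (h p₀) := by
    rw [hh₀]
    have h1 : ContMDiffAt 𝓘(ℝ, Euc 1 × Euc n) 𝓘(ℝ, Euc 1) ∞ Prod.fst 0 :=
      contDiffAt_fst.contMDiffAt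
    have h2 : ContMDiffAt 𝓘(ℝ, Euc 1 × Euc n) 𝓘(ℝ, Euc n) ∞ Prod.snd 0 :=
      contDiffAt_snd.contMDiffAt
    have h3 : ContMDiffAt 𝓘(ℝ, Euc (n + 1)) 𝓘(ℝ, ClC (n + 1)) ∞ (fun b => toClC (X b))
        (hemisphere n 0) :=
      (hX.contDiffAt (hV.mem_nhds (hemisphere_zero (n := n) ▸ heV))).contMDiffAt
    have h4 : ContMDiffAt (𝓡 (n + 1)) (𝓡 d) ∞ s (κ 0) :=
      (hT.section_smooth _ (hκ0 ▸ hz₀)).contMDiffAt (hT.isOpen.mem_nhds (hκ0 ▸ hz₀))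
    refine hB.contMDiffWithinAt_smul (toClC_mul_contMDiffWithinAt ?_ contMDiffWithinAt_const) ?_
    · have h5 : ContMDiffAt 𝓘(ℝ, Euc n) 𝓘(ℝ, ClC (n + 1)) ∞ (fun a => toClC (X (hemisphere n a)))
          0 := h3.comp (x := (0 : Euc n)) contDiffAt_hemisphere.contMDiffAt
      exact ContMDiffAt.comp (f := Prod.snd) (x := (0 : Euc 1 × Euc n)) h5 h2
    · have h5 : ContMDiffAt 𝓘(ℝ, Euc 1) (𝓡 d) ∞ (fun c => s (κ c)) 0 :=
        h4.comp (x := (0 : Euc 1)) hκ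
      exact ContMDiffAt.comp (f := Prod.fst) (x := (0 : Euc 1 × Euc n)) h5 h1
  have hhσ : ∀ᶠ c in 𝓝 (h p₀), h (σ c) = c := by
    rw [hh₀]
    have hfst := (continuous_fst (X := Euc 1) (Y := Euc n)).tendsto 0
    have hsnd := (continuous_snd (X := Euc 1) (Y := Euc n)).tendsto 0
    have hball : ∀ᶠ a in 𝓝 (0 : Euc n), ‖a‖ < 1 :=
      (continuous_norm (E := Euc n)).continuousAt.eventually_lt continuousAt_const (by simp)
    filter_upwards [hfst.eventually hκU, hfst.eventually hkκ, hsnd.eventually hVe,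
      hsnd.eventually hball] with c h1 h2 h3 h4
    have h5 : π (σ c) = κ c.1 := by
      rw [← hT.proj_section _ h1]
      exact hB.proj_action _ _
    have h6 : y (σ c) = hemisphere n c.2 := by
      rw [hyr, hT.apply_smul_section _ h1, rot_mul, hfix, hXr _ h3 (norm_hemisphere h4)]
    simp only [h, h5, h6, h2, dropLast_hemisphere]
  obtain ⟨e, he, hpe, heW, heh⟩ :=
    exists_chart_of_submersion L (hO.inter (hW.preimage hπs.continuous)) hh hp₀W hσ hσ₀ hhσ
  refine ⟨e, he, hpe, fun p hp => ?_⟩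
  obtain ⟨⟨hpU, hpy⟩, hpW⟩ := heW hp
  rw [heh p hp, hrange p hpU, hkι _ hpW, Prod.ext_iff]
  refine and_congr_right fun _ => ⟨fun H => ?_, fun H => ?_⟩
  · simp only [h, hyr, H, dropLast_eLast, Prod.snd_zero]
  · rw [← hyr]
    exact eq_eLast_of_norm (hy1 p) H hpy

end Adapted

/-! ### Smooth maps into embedded submanifolds -/

section Lift

open Manifold Topology Set

/-- Locally h = r ∘ (f ∘ h) for a smooth retraction r onto the submanifold. -/
theorem contMDiffWithinAt_of_comp {m m' : ℕ} {X Y : Type*} [TopologicalSpace X]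
    [ChartedSpace (Euc m) X] [TopologicalSpace Y] [ChartedSpace (Euc m') Y]
    [IsManifold (𝓡 m') ∞ Y] {f : X → Y}
    (hf : IsSmoothEmbedding (𝓡 m) (𝓡 m') ∞ f) {E H N : Type*} [NormedAddCommGroup E]
    [NormedSpace ℝ E] [TopologicalSpace H] {I : ModelWithCorners ℝ E H} [TopologicalSpace N]
    [ChartedSpace H N] {h : N → X} {S : Set N} {q : N}
    (hh : ContMDiffWithinAt I (𝓡 m') ∞ (fun q => f (h q)) S q) :
    ContMDiffWithinAt I (𝓡 m) ∞ h S q := by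
  obtain ⟨W, r, hW, hqW, hr, hrf⟩ := exists_retraction hf (h q)
  refine ((hr.contMDiffAt (hW.mem_nhds hqW)).comp_contMDiffWithinAt q hh).congr_of_eventuallyEq
    ?_ (hrf _ hqW).symm
  filter_upwards [hh.continuousWithinAt.eventually_mem (hW.mem_nhds hqW)] with q' hq'
  exact (hrf _ hq').symm

theorem contMDiff_of_comp {m m' : ℕ} {X Y : Type*} [TopologicalSpace X]
    [ChartedSpace (Euc m) X] [TopologicalSpace Y] [ChartedSpace (Euc m') Y]
    [IsManifold (𝓡 m') ∞ Y] {f : X → Y}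
    (hf : IsSmoothEmbedding (𝓡 m) (𝓡 m') ∞ f) {E H N : Type*} [NormedAddCommGroup E]
    [NormedSpace ℝ E] [TopologicalSpace H] {I : ModelWithCorners ℝ E H} [TopologicalSpace N]
    [ChartedSpace H N] {h : N → X} (hh : ContMDiff I (𝓡 m') ∞ (fun q => f (h q))) :
    ContMDiff I (𝓡 m) ∞ h := fun q =>
  contMDiffWithinAt_of_comp hf (hh q)

/-- The axioms of an action can be checked after j. The ambient action is a bare function, so that
Spin^c(n) may act on P through Spin^c(n+1). -/
theorem exists_mulAction_of_injective {A S P : Type*} [Monoid A] {j : S → P}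
    (hj : Function.Injective j) (act : A → P → P) (h1 : ∀ p, act 1 p = p)
    (hmul : ∀ a b p, act (a * b) p = act a (act b p)) (h : ∀ a q, act a (j q) ∈ range j) :
    ∃ _ : MulAction A S, ∀ (a : A) (q : S), j (a • q) = act a (j q) := by
  choose F hF using h
  exact ⟨{ smul := F
           one_smul := fun q => hj ((hF 1 q).trans (h1 _))
           mul_smul := fun a b q => hj (by
            change j (F (a * b) q) = j (F a (F b q))
            rw [hF, hF, hF, hmul]) }, hF⟩

/-- In a finite basis b, the map φ(q) is the sum of the coordinate functionals times the smooth
vectors φ(q)(b i). -/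
theorem contMDiffAt_clm_of_forall {E F G N : Type*} [NormedAddCommGroup E] [NormedSpace ℝ E]
    [FiniteDimensional ℝ E] [NormedAddCommGroup F] [NormedSpace ℝ F] [NormedAddCommGroup G]
    [NormedSpace ℝ G] {H : Type*} [TopologicalSpace H] {I : ModelWithCorners ℝ G H}
    [TopologicalSpace N] [ChartedSpace H N] {φ : N → E →L[ℝ] F} {x : N}
    (h : ∀ y, ContMDiffAt I 𝓘(ℝ, F) ∞ (fun q => φ q y) x) :
    ContMDiffAt I 𝓘(ℝ, E →L[ℝ] F) ∞ φ x := by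
  let b := Module.finBasis ℝ E
  have hφ : φ = fun q => ∑ i, ContinuousLinearMap.smulRightL ℝ E F
      (b.coord i).toContinuousLinearMap (φ q (b i)) := by
    funext q
    ext y
    conv_lhs => rw [← b.sum_repr y, map_sum]
    simp [-Module.Basis.sum_repr]
  rw [hφ]
  exact contMDiffAt_finsetSum fun i _ =>
    (ContinuousLinearMap.contDiff _).contMDiff.contMDiffAt.comp x (h (b i))

end Lift

/-! ### The induced metric -/

section InducedMetric

open Manifold Topology Set Bundle

/-- The coefficients of B in a trivialization are its values on the local fields with constant
coordinates, and these fields are smooth. -/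
theorem contMDiff_bilin_section {m : ℕ} {Z : Type*} [TopologicalSpace Z] [ChartedSpace (Euc m) Z]
    [IsManifold (𝓡 m) ∞ Z]
    {B : ∀ z : Z, TangentSpace (𝓡 m) z →L[ℝ] TangentSpace (𝓡 m) z →L[ℝ] ℝ}
    (h : ∀ (z₀ : Z) (v w : ∀ z, TangentSpace (𝓡 m) z),
      ContMDiffAt (𝓡 m) (𝓡 m).tangent ∞ (fun z => (⟨z, v z⟩ : TangentBundle (𝓡 m) Z)) z₀ →
      ContMDiffAt (𝓡 m) (𝓡 m).tangent ∞ (fun z => (⟨z, w z⟩ : TangentBundle (𝓡 m) Z)) z₀ →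
      ContMDiffAt (𝓡 m) 𝓘(ℝ, ℝ) ∞ (fun z => B z (v z) (w z)) z₀) :
    ContMDiff (𝓡 m) ((𝓡 m).prod 𝓘(ℝ, Euc m →L[ℝ] Euc m →L[ℝ] ℝ)) ∞
      (fun z => TotalSpace.mk' (Euc m →L[ℝ] Euc m →L[ℝ] ℝ)
        (E := fun z : Z => TangentSpace (𝓡 m) z →L[ℝ] TangentSpace (𝓡 m) z →L[ℝ] ℝ) z (B z)) := by
  intro z₀
  rw [contMDiffAt_hom_bundle]
  refine ⟨contMDiffAt_id, contMDiffAt_clm_of_forall fun y => contMDiffAt_clm_of_forall fun y' => ?_⟩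
  set e := trivializationAt (Euc m) (TangentSpace (𝓡 m) : Z → Type _) z₀
  have hz₀ : z₀ ∈ e.baseSet := mem_baseSet_trivializationAt _ _ _
  have hsec : ∀ y : Euc m, ContMDiffAt (𝓡 m) (𝓡 m).tangent ∞
      (fun z => (⟨z, e.symm z y⟩ : TangentBundle (𝓡 m) Z)) z₀ := fun y => by
    have hy : (z₀, y) ∈ e.target := e.mem_target.2 hz₀
    refine (((e.contMDiffOn_symm (n := ∞) (IB := 𝓡 m)).contMDiffAt
      (e.open_target.mem_nhds hy)).comp z₀ (contMDiffAt_id.prodMk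
        contMDiffAt_const)).congr_of_eventuallyEq ?_
    filter_upwards [e.open_baseSet.mem_nhds hz₀] with z hz
    exact e.mk_symm hz y
  refine (h z₀ _ _ (hsec y) (hsec y')).congr_of_eventuallyEq ?_
  filter_upwards [e.open_baseSet.mem_nhds hz₀] with z hz
  rw [inCoordinates_apply_eq₂ hz hz (mem_univ _)]
  exact congrFun ((trivializationAt ℝ (Trivial Z ℝ) z₀).coe_linearMapAt_of_mem (mem_univ z)) _

variable {n : ℕ} {M Z : Type*} [TopologicalSpace M] [ChartedSpace (Euc (n + 1)) M]
  [IsManifold (𝓡 (n + 1)) ∞ M] [TopologicalSpace Z] [ChartedSpace (Euc n) Z]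
  [IsManifold (𝓡 n) ∞ Z] {g : Metric (n + 1) M} {ι : Z → M}

theorem IsRiemannianMetric.inducedMetric (hg : IsRiemannianMetric g)
    (hι : IsSmoothEmbedding (𝓡 n) (𝓡 (n + 1)) ∞ ι) :
    IsRiemannianMetric (inducedMetric g ι) := by
  have hg' := hg
  obtain ⟨γ, hγ⟩ := hg
  let A : ∀ z, TangentSpace (𝓡 n) z →L[ℝ] TangentSpace (𝓡 (n + 1)) (ι z) := fun z =>
    mfderiv (𝓡 n) (𝓡 (n + 1)) ι z
  have hA : ∀ z, Function.Injective (A z) := mfderiv_injective hι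
  let B : ∀ z, TangentSpace (𝓡 n) z →L[ℝ] TangentSpace (𝓡 n) z →L[ℝ] ℝ := fun z =>
    ContinuousLinearMap.bilinearComp (E := Euc (n + 1)) (F := Euc (n + 1)) (E' := Euc n)
      (F' := Euc n) (γ.inner (ι z)) (A z) (A z)
  refine ⟨{ inner := B
            symm := fun z v w => γ.symm _ _ _
            pos := fun z v hv => γ.pos (ι z) (A z v) fun h => hv (hA z (h.trans (map_zero _).symm))
            isVonNBounded := fun z => ?_
            contMDiff := contMDiff_bilin_section fun z₀ v w hv hw => ?_ }, fun z u w => ?_⟩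
  -- The unit ball of the induced metric is contained in the image, under a left inverse of dι, of
  -- the bounded unit ball of the ambient metric.
  · obtain ⟨K, hK⟩ := (A z).toLinearMap.exists_leftInverse_of_injective
      (LinearMap.ker_eq_bot.2 (hA z))
    let K' : Euc (n + 1) →L[ℝ] Euc n :=
      LinearMap.toContinuousLinearMap (K : Euc (n + 1) →ₗ[ℝ] Euc n)
    refine ((γ.isVonNBounded (ι z)).image
      (K' : TangentSpace (𝓡 (n + 1)) (ι z) →L[ℝ] TangentSpace (𝓡 n) z)).subset ?_
    intro v hv
    exact ⟨A z v, hv, LinearMap.congr_fun hK v⟩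
  · have ht : ContMDiff (𝓡 n).tangent (𝓡 (n + 1)).tangent ∞ (tangentMap (𝓡 n) (𝓡 (n + 1)) ι) :=
      hι.contMDiff.contMDiff_tangentMap (by simp)
    have hB := hg'.contMDiffWithinAt (b := ι) (v := fun z => A z (v z)) (w := fun z => A z (w z))
      (s := univ) (q := z₀) (ht.contMDiffAt.comp z₀ hv) (ht.contMDiffAt.comp z₀ hw)
    refine ContMDiffAt.congr_of_eventuallyEq hB (Filter.Eventually.of_forall fun z => ?_)
    exact hγ _ _ _
  · exact hγ _ _ _

end InducedMetric

/-! ### The restriction of a spin^c structure to a hypersurface -/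

section Restriction

open Manifold Topology Set

variable {n d d' r : ℕ} {M Z P S : Type*} [TopologicalSpace M] [ChartedSpace (Euc (n + 1)) M]
  [IsManifold (𝓡 (n + 1)) ∞ M] [TopologicalSpace Z] [ChartedSpace (Euc n) Z]
  {g : Metric (n + 1) M} {o : Orient (n + 1) M} {ι : Z → M}
  {ν : ∀ z, TangentSpace (𝓡 (n + 1)) (ι z)}
  [TopologicalSpace P] [ChartedSpace (Euc d) P]
  {Λ : P → SOF g o}
  [TopologicalSpace S] [ChartedSpace (Euc d') S]

/-- `j : S → P` is a smooth model of the inclusion `P_Z → P`, with structure map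
`Φ : S → SOF(Z)`. -/
structure IsRestriction (hg : IsRiemannianMetric g) (hν : IsUnitNormalField g ι ν)
    (Λ : P → SOF g o) (j : S → P)
    (Φ : S → SOF (inducedMetric g ι) (inducedOrient o ι ν)) : Prop where
  base : IsSmoothEmbedding (𝓡 n) (𝓡 (n + 1)) ∞ ι
  total : IsSmoothEmbedding (𝓡 d') (𝓡 d) ∞ j
  frame : ∀ q, frameInclusion hg hν (Φ q) = Λ (j q)
  range : ∀ p z, (Λ p).vec (eLast n) = ⟨ι z, ν z⟩ → p ∈ range j

namespace IsRestriction

variable {hg : IsRiemannianMetric g} {hν : IsUnitNormalField g ι ν} {j : S → P}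
  {Φ : S → SOF (inducedMetric g ι) (inducedOrient o ι ν)}

theorem base_eq (h : IsRestriction (d := d) (d' := d') hg hν Λ j Φ) (q : S) :
    (Λ (j q)).base = ι (Φ q).base := by
  rw [← h.frame q]; rfl

theorem tangentMap_vec (h : IsRestriction (d := d) (d' := d') hg hν Λ j Φ) (q : S) (a : Euc n) :
    tangentMap (𝓡 n) (𝓡 (n + 1)) ι ((Φ q).vec a) = (Λ (j q)).vec (appendZero n a) := by
  rw [← h.frame q, frameInclusion_vec_appendZero]

theorem vec_eLast (h : IsRestriction (d := d) (d' := d') hg hν Λ j Φ) (q : S) :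
    (Λ (j q)).vec (eLast n) = ⟨ι (Φ q).base, ν (Φ q).base⟩ := by
  rw [← h.frame q, frameInclusion_vec_eLast]

theorem smooth_base (h : IsRestriction (d := d) (d' := d') hg hν Λ j Φ)
    (hΛ : ContMDiff (𝓡 d) (𝓡 (n + 1)) ∞ fun p => (Λ p).base) :
    ContMDiff (𝓡 d') (𝓡 n) ∞ fun q => (Φ q).base := by
  refine contMDiff_of_comp h.base ?_
  simp only [← h.base_eq]
  exact hΛ.comp h.total.contMDiff

theorem smoothMap [IsManifold (𝓡 n) ∞ Z] (h : IsRestriction (d := d) (d' := d') hg hν Λ j Φ)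
    (hΛ : SOF.SmoothMap (d := d) Λ) : SOF.SmoothMap (d := d') Φ := fun a => by
  refine contMDiff_of_tangentMap h.base ?_
  simp only [h.tangentMap_vec]
  exact (hΛ _).comp h.total.contMDiff

variable [IsManifold (𝓡 d) ∞ P] [MulAction (SpinC (n + 1))ᵐᵒᵖ P]

/-- Local trivializations of `P` that restrict to local trivializations of `P_Z`. -/
theorem exists_adapted (h : IsRestriction (d := d) (d' := d') hg hν Λ j Φ) (hn : 1 ≤ n)
    (hΛ : SOF.SmoothMap (d := d) Λ)
    (hB : IsPrincipalSpinCBundle (m := n + 1) (d := d) (n + 1) (fun p => (Λ p).base))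
    (hΛX : ∀ (p : P) (X : SpinC (n + 1)) (y : Euc (n + 1)),
      (Λ (MulOpposite.op X • p)).vec y = (Λ p).vec (rot X y)) (z₀ : Z) :
    ∃ (U : Set M) (s : M → P) (τ : P → SpinC (n + 1)) (sZ : Z → S) (τZ : S → SpinC n),
      IsLocalTrivialization (m := n + 1) (d := d) (fun p => (Λ p).base) U s τ ∧ ι z₀ ∈ U ∧
      (∀ z, ι z ∈ U → j (sZ z) = s (ι z)) ∧ (∀ z, ι z ∈ U → (Φ (sZ z)).base = z) ∧
      (∀ q, ι (Φ q).base ∈ U → spinCIncl n (τZ q) = τ (j q)) ∧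
      ContMDiffOn (𝓡 n) (𝓡 d') ∞ sZ (ι ⁻¹' U) := by
  obtain ⟨U, s, τ, hT, hz₀, hsν⟩ :=
    exists_adapted_trivialization hn hg hν h.base hΛ hB hΛX z₀
  have h1 : ∀ z, ∃ q, ι z ∈ U → j q = s (ι z) := fun z => by
    by_cases hz : ι z ∈ U
    · obtain ⟨q, hq⟩ := h.range _ z (hsν z hz)
      exact ⟨q, fun _ => hq⟩
    -- Outside U any point of S will do as a value; there is one because the section passes through
    -- P_Z over z₀.
    · obtain ⟨q, -⟩ := h.range _ z₀ (hsν z₀ hz₀)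
      exact ⟨q, fun hz' => absurd hz' hz⟩
  have h2 : ∀ q, ∃ Y, ι (Φ q).base ∈ U → spinCIncl n Y = τ (j q) := fun q => by
    by_cases hq : ι (Φ q).base ∈ U
    -- Both j q and s(ι z) have last frame vector ν, so the element of Spin^c(n+1) relating them
    -- fixes e and belongs to Spin^c(n).
    · obtain ⟨Y, hY⟩ := exists_spinCIncl_eq hn (X := τ (j q)) (by
        have hq' : (Λ (j q)).base ∈ U := by rwa [h.base_eq]
        have h3 : (Λ (s (ι (Φ q).base))).vec (rot (τ (j q)) (eLast n)) =
            (Λ (s (ι (Φ q).base))).vec (eLast n) := by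
          rw [← hΛX, ← h.base_eq, hT.smul_section _ hq', h.vec_eLast, h.base_eq, hsν _ hq]
        refine SOF.frame_injective (Λ (s (ι (Φ q).base))) ?_
        simpa [SOF.vec] using h3)
      exact ⟨Y, fun _ => hY⟩
    · exact ⟨1, fun hq' => absurd hq' hq⟩
  choose sZ hsZ using h1
  choose τZ hτZ using h2
  refine ⟨U, s, τ, sZ, τZ, hT, hz₀, hsZ, fun z hz => ?_, hτZ, fun z hz => ?_⟩
  · refine h.base.isEmbedding.injective ?_
    rw [← h.base_eq, hsZ z hz]
    exact hT.proj_section _ hz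
  · refine contMDiffWithinAt_of_comp h.total ?_
    refine ((hT.section_smooth _ hz).comp (s := ι ⁻¹' U) z
      h.base.contMDiff.contMDiffAt.contMDiffWithinAt fun _ h => h).congr hsZ (hsZ z hz)

variable [MulAction (SpinC n)ᵐᵒᵖ S]

/-- Over Z an adapted section takes values in P_Z and its fibre coordinate takes values in
Spin^c(n), so the trivializations of P restrict. Equations are verified after the injections j, ι
and Spin^c(n) → Spin^c(n+1). -/
theorem principal (h : IsRestriction (d := d) (d' := d') hg hν Λ j Φ) (hn : 1 ≤ n)
    (hjX : ∀ (X : SpinC n) (q : S), j (MulOpposite.op X • q) =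
      MulOpposite.op (spinCIncl n X) • j q)
    (hΛ : SOF.SmoothMap (d := d) Λ)
    (hB : IsPrincipalSpinCBundle (m := n + 1) (d := d) (n + 1) (fun p => (Λ p).base))
    (hΛX : ∀ (p : P) (X : SpinC (n + 1)) (y : Euc (n + 1)),
      (Λ (MulOpposite.op X • p)).vec y = (Λ p).vec (rot X y)) :
    IsPrincipalSpinCBundle (m := n) (d := d') n (fun q => (Φ q).base) where
  smooth_proj := h.smooth_base hB.smooth_proj
  smooth_action := by
    classical
    obtain ⟨F, hF, hFX⟩ := hB.smooth_action
    -- Away from Spin^c(n) the value is a filler; smoothness is asked only on P_Z × Spin^c(n).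
    let F' : S × ClC n → S := fun w =>
      if hX : ∃ X : SpinC n, toClC X = w.2 then MulOpposite.op hX.choose • w.1 else w.1
    have hF' : ∀ (q : S) (X : SpinC n), F' (q, toClC X) = MulOpposite.op X • q := fun q X => by
      have hX : ∃ X' : SpinC n, toClC X' = toClC X := ⟨X, rfl⟩
      simp only [F', dif_pos hX, toClC_injective n hX.choose_spec]
    refine ⟨F', fun w hw => contMDiffWithinAt_of_comp h.total ?_, hF'⟩
    have hjF : ∀ w ∈ univ ×ˢ Set.range toClC, j (F' w) = F (j w.1, clCIncl n w.2) := by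
      rintro ⟨q, _⟩ ⟨-, X, rfl⟩
      rw [hF', hjX, ← toClC_spinCIncl, hFX]
    have hc : ContMDiff 𝓘(ℝ, ClC n) 𝓘(ℝ, ClC (n + 1)) ∞ (clCIncl n) :=
      ((clCIncl n).toLinearMap.contDiff_of_finiteDimensional).contMDiff
    have hw' : ∀ w ∈ (univ : Set S) ×ˢ Set.range (toClC (k := n)),
        (j w.1, clCIncl n w.2) ∈ (univ : Set P) ×ˢ Set.range (toClC (k := n + 1)) := by
      rintro ⟨q, _⟩ ⟨-, X, rfl⟩
      exact ⟨mem_univ _, spinCIncl n X, toClC_spinCIncl X⟩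
    exact ((hF _ (hw' w hw)).comp (f := fun w : S × ClC n => (j w.1, clCIncl n w.2)) w
      ((h.total.contMDiff.comp contMDiff_fst).prodMk
        (hc.comp contMDiff_snd)).contMDiffAt.contMDiffWithinAt hw').congr hjF (hjF w hw)
  proj_action q X := h.base.isEmbedding.injective (by
    rw [← h.base_eq, ← h.base_eq, hjX]
    exact hB.proj_action _ _)
  locally_trivial z₀ := by
    obtain ⟨U, s, τ, sZ, τZ, hT, hz₀, hs, hsb, hτ, hss⟩ := h.exists_adapted hn hΛ hB hΛX z₀
    have hb := h.smooth_base hB.smooth_proj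
    refine ⟨ι ⁻¹' U, hT.isOpen.preimage h.base.contMDiff.continuous, hz₀, sZ, τZ, hss, ?_, hsb,
      fun q hq => ?_, fun z hz X => ?_⟩
    -- The linear left inverse of C_n ⊗ ℂ → C_(n+1) ⊗ ℂ recovers the fibre coordinate of P_Z
    -- smoothly from that of P.
    · have h1 : ContMDiffOn (𝓡 d') 𝓘(ℝ, ClC n) ∞ (fun q => clCProj n (toClC (τ (j q))))
          ((fun q => (Φ q).base) ⁻¹' (ι ⁻¹' U)) :=
        (clCProj n).contDiff_of_finiteDimensional.contMDiff.comp_contMDiffOn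
          (hT.smooth.comp h.total.contMDiff.contMDiffOn fun q hq => by
            rw [mem_preimage, mem_preimage, h.base_eq]; exact hq)
      refine h1.congr fun q hq => ?_
      rw [← hτ q hq, toClC_spinCIncl, clCProj_clCIncl]
    · refine h.total.isEmbedding.injective ?_
      rw [hjX, hτ q hq, hs _ hq, ← h.base_eq]
      exact hT.smul_section _ (by rw [h.base_eq]; exact hq)
    · refine spinCIncl_injective n ?_
      rw [hτ, hjX, hs z hz, hT.apply_smul_section _ hz]
      rw [← h.base_eq, hjX, hs z hz, hB.proj_action, hT.proj_section _ hz]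
      exact hz

end IsRestriction

end Restriction

/-! ### Smooth actions and embeddings -/

section SmoothActions

open Manifold

theorem tangentMap_smul {G : Type*} [Group G] {m m' : ℕ} {X Y : Type*} [TopologicalSpace X]
    [ChartedSpace (Euc m) X] [TopologicalSpace Y] [ChartedSpace (Euc m') Y] [MulAction G X]
    [MulAction G Y] {f : X → Y} (hf : MDifferentiable (𝓡 m) (𝓡 m') f)
    (hfG : ∀ (a : G) (x : X), f (a • x) = a • f x) {a : G}
    (hX : MDifferentiable (𝓡 m) (𝓡 m) fun x : X => a • x)
    (hY : MDifferentiable (𝓡 m') (𝓡 m') fun y : Y => a • y) (v : TangentBundle (𝓡 m) X) :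
    tangentMap (𝓡 m) (𝓡 m') f (tangentMap (𝓡 m) (𝓡 m) (fun x : X => a • x) v) =
      tangentMap (𝓡 m') (𝓡 m') (fun y : Y => a • y) (tangentMap (𝓡 m) (𝓡 m') f v) := by
  have h1 := tangentMap_comp_at v (hf (a • v.proj)) (hX v.proj)
  have h2 := tangentMap_comp_at v (hY (f v.proj)) (hf v.proj)
  rw [← h1, ← h2]
  congr 1
  funext x
  exact hfG a x

variable {r : ℕ} {G : Type*} [TopologicalSpace G] [ChartedSpace (Euc r) G] [Group G]

theorem contMDiff_smul_left {m : ℕ} {X : Type*} [TopologicalSpace X] [ChartedSpace (Euc m) X]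
    [MulAction G X] [ContMDiffSMul (𝓡 r) (𝓡 m) ∞ G X] (a : G) :
    ContMDiff (𝓡 m) (𝓡 m) ∞ fun x : X => a • x :=
  (contMDiff_smul (I := 𝓡 r) (I' := 𝓡 m) (n := ∞) (G := G) (M := X)).comp
    (contMDiff_const.prodMk contMDiff_id)

theorem contMDiffSMul_of_embedding {m m' : ℕ} {X Y : Type*} [TopologicalSpace X]
    [ChartedSpace (Euc m) X] [TopologicalSpace Y] [ChartedSpace (Euc m') Y]
    [IsManifold (𝓡 m') ∞ Y] [MulAction G X] [MulAction G Y] {f : X → Y}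
    (hf : IsSmoothEmbedding (𝓡 m) (𝓡 m') ∞ f) (hfG : ∀ (a : G) (x : X), f (a • x) = a • f x)
    (h : ContMDiffSMul (𝓡 r) (𝓡 m') ∞ G Y) : ContMDiffSMul (𝓡 r) (𝓡 m) ∞ G X where
  contMDiff_smul := by
    refine contMDiff_of_comp hf ?_
    simp only [hfG]
    exact h.contMDiff_smul.comp (contMDiff_fst.prodMk (hf.contMDiff.comp contMDiff_snd))

end SmoothActions

/-! ### The induced orientation and the action on a hypersurface -/

section HypersurfaceAction

open Manifold Topology Set

variable {n r : ℕ} {G : Type*} [TopologicalSpace G] [ChartedSpace (Euc r) G] [Group G]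
  {M Z : Type*} [TopologicalSpace M] [ChartedSpace (Euc (n + 1)) M]
  [IsManifold (𝓡 (n + 1)) ∞ M] [TopologicalSpace Z] [ChartedSpace (Euc n) Z]
  {g : Metric (n + 1) M} {o : Orient (n + 1) M} {ι : Z → M}
  {ν : ∀ z, TangentSpace (𝓡 (n + 1)) (ι z)}

/-- The extension of a frame of Z at the point is a positive tuple of M, on which the volume form
does not vanish. So the induced orientation there is not the junk value. -/
theorem contractLast_ne_zero (hg : IsRiemannianMetric g) (hν : IsUnitNormalField g ι ν)
    (f : SOF (inducedMetric g ι) (inducedOrient o ι ν)) :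
    contractLast (o (ι f.base)).someVector (mfderiv (𝓡 n) (𝓡 (n + 1)) ι f.base).toLinearMap
      (ν f.base) ≠ 0 := by
  intro h0
  have h1 := congrArg (fun F => F fun i => f.frame (EuclideanSpace.basisFun (Fin n) ℝ i)) h0
  have h2 := extendFrame_positive hg hν f
  have ho : o (ι f.base) = rayOfNeZero ℝ (o (ι f.base)).someVector
    (o (ι f.base)).someVector_ne_zero := (o (ι f.base)).someVector_ray.symm
  rw [ho, positiveTuple_rayOfNeZero, extendFrame_basis] at h2
  exact h2.ne' h1

theorem positiveTuple_inducedOrient (hg : IsRiemannianMetric g) (hν : IsUnitNormalField g ι ν)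
    (hf : ∀ z, ∃ f : SOF (inducedMetric g ι) (inducedOrient o ι ν), f.base = z) (z : Z)
    (w : Fin n → TangentSpace (𝓡 n) z) :
    PositiveTuple (inducedOrient o ι ν z) w ↔ PositiveTuple (o (ι z))
      (Fin.snoc (α := fun _ => TangentSpace (𝓡 (n + 1)) (ι z))
        (fun i => mfderiv (𝓡 n) (𝓡 (n + 1)) ι z (w i)) (ν z)) := by
  obtain ⟨f, rfl⟩ := hf z
  exact positiveTuple_inducedOrientation _ _ _ _ (contractLast_ne_zero hg hν f) w

variable [MulAction G M] [MulAction G Z] [IsManifold (𝓡 n) ∞ Z]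

/-- Equivariance of ι makes dι intertwine the two actions, so isometry is inherited. For the
orientation, a preserves the positive tuple (dι w₁, …, dι w_n, ν), and its last entry goes to ν
again. -/
theorem IsOrientedRiemannianAction.restrict
    (h : IsOrientedRiemannianAction (r := r) G g o)
    (hι : IsSmoothEmbedding (𝓡 n) (𝓡 (n + 1)) ∞ ι)
    (hιG : ∀ (a : G) (z : Z), ι (a • z) = a • ι z) (hν : IsUnitNormalField g ι ν)
    (hνG : ∀ (a : G) (z : Z), tangentMap (𝓡 (n + 1)) (𝓡 (n + 1)) (fun x : M => a • x)
      (⟨ι z, ν z⟩ : TangentBundle (𝓡 (n + 1)) M) = ⟨ι (a • z), ν (a • z)⟩)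
    (ho : IsManifoldOrientation (inducedOrient o ι ν))
    (hf : ∀ z, ∃ f : SOF (inducedMetric g ι) (inducedOrient o ι ν), f.base = z) :
    IsOrientedRiemannianAction (r := r) G (inducedMetric g ι) (inducedOrient o ι ν) := by
  have hGM := h.smooth_smul
  have hGZ : ContMDiffSMul (𝓡 r) (𝓡 n) ∞ G Z := contMDiffSMul_of_embedding hι hιG h.smooth_smul
  have ht : ∀ (a : G) (v : TangentBundle (𝓡 n) Z), _ := fun a v =>
    tangentMap_smul (hι.contMDiff.mdifferentiable (by simp)) hιG (a := a)
      ((contMDiff_smul_left (r := r) a).mdifferentiable (by simp))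
      ((contMDiff_smul_left (r := r) a).mdifferentiable (by simp)) v
  refine ⟨h.riemannian.inducedMetric hι, ho, hGZ, fun a z u w => ?_, fun a z w hw => ?_⟩
  · have hg : ∀ v w v' w' : TangentBundle (𝓡 (n + 1)) M, v = v' → w = w' →
        g v.1 v.2 (w.2 : Euc (n + 1)) = g v'.1 v'.2 (w'.2 : Euc (n + 1)) := by
      rintro v w _ _ rfl rfl; rfl
    exact (hg _ _ _ _ (ht a ⟨z, u⟩) (ht a ⟨z, w⟩)).trans (h.isometry a (ι z) _ _)
  · rw [positiveTuple_inducedOrient h.riemannian hν hf] at hw ⊢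
    have h1 := h.preserves_orientation a (ι z) _ hw
    -- Positivity is transported along equality in TM, because a • ι z and ι (a • z) are equal only
    -- propositionally.
    have hp : ∀ (x y : M) (v w : Fin (n + 1) → Euc (n + 1)),
        (∀ i, (⟨x, v i⟩ : TangentBundle (𝓡 (n + 1)) M) = ⟨y, w i⟩) →
        PositiveTuple (V := TangentSpace (𝓡 (n + 1)) x) (o x) v →
        PositiveTuple (V := TangentSpace (𝓡 (n + 1)) y) (o y) w := by
      intro x y v w hvw
      obtain rfl : x = y := congrArg Bundle.TotalSpace.proj (hvw 0)
      obtain rfl : v = w := funext fun i => eq_of_heq (Bundle.TotalSpace.mk.inj (hvw i)).2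
      exact id
    refine hp _ _ _ _ (fun i => ?_) h1
    refine Fin.lastCases ?_ (fun i => ?_) i
    · simp only [Fin.snoc_last]
      exact hνG a z
    · simp only [Fin.snoc_castSucc]
      exact (ht a ⟨z, w i⟩).symm

end HypersurfaceAction

/-! ### Orbit velocities, orientation and equivariance of the restricted structure -/

section Restriction

open Manifold Topology Set

/-- The map `P_Z → P` maps the orbit velocities of `P_Z` to those of `P`. -/
theorem tangentMap_orbitVelocity {n d d' : ℕ} {Z P S : Type*} [TopologicalSpace Z]
    [ChartedSpace (Euc n) Z] [TopologicalSpace P] [ChartedSpace (Euc d) P] [TopologicalSpace S]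
    [ChartedSpace (Euc d') S] [MulAction (SpinC (n + 1))ᵐᵒᵖ P] [MulAction (SpinC n)ᵐᵒᵖ S]
    {j : S → P}
    (hj : MDifferentiable (𝓡 d') (𝓡 d) j)
    (hjX : ∀ (X : SpinC n) (q : S), j (MulOpposite.op X • q) =
      MulOpposite.op (spinCIncl n X) • j q) {π : S → Z}
    (hB : IsPrincipalSpinCBundle (m := n) (d := d') n π) {γ : ℝ → SpinC n}
    (hγ : ContDiff ℝ ∞ fun t => toClC (γ t)) (q : S) :
    tangentMap (𝓡 d') (𝓡 d) j
        (⟨_, orbitVelocity (d := d') q γ⟩ : TangentBundle (𝓡 d') S) =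
      ⟨_, orbitVelocity (d := d) (j q) (fun t => spinCIncl n (γ t))⟩ := by
  have h1 : ContMDiffAt 𝓘(ℝ, ℝ) (𝓡 d') ∞ (fun t => MulOpposite.op (γ t) • q) 0 :=
    hB.contMDiffWithinAt_smul hγ.contMDiff.contMDiffAt contMDiffAt_const
  have h2 := tangentMap_comp_at (I := 𝓘(ℝ, ℝ)) (⟨0, (1 : ℝ)⟩ : TangentBundle 𝓘(ℝ, ℝ) ℝ)
    (hj (MulOpposite.op (γ 0) • q)) (h1.mdifferentiableAt (by simp))
  refine h2.symm.trans ?_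
  have h3 : j ∘ (fun t => MulOpposite.op (γ t) • q) =
      fun t => MulOpposite.op (spinCIncl n (γ t)) • j q := funext fun t => hjX _ _
  rw [h3]
  rfl

variable {n d d' r : ℕ} {M Z P S : Type*} [TopologicalSpace M] [ChartedSpace (Euc (n + 1)) M]
  [IsManifold (𝓡 (n + 1)) ∞ M] [TopologicalSpace Z] [ChartedSpace (Euc n) Z]
  [IsManifold (𝓡 n) ∞ Z] {g : Metric (n + 1) M} {o : Orient (n + 1) M} {ι : Z → M}
  {ν : ∀ z, TangentSpace (𝓡 (n + 1)) (ι z)}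
  [TopologicalSpace P] [ChartedSpace (Euc d) P] [IsManifold (𝓡 d) ∞ P]
  {Λ : P → SOF g o}
  [TopologicalSpace S] [ChartedSpace (Euc d') S] [MulAction (SpinC (n + 1))ᵐᵒᵖ P]
  {hg : IsRiemannianMetric g} {hν : IsUnitNormalField g ι ν} {j : S → P}
  {Φ : S → SOF (inducedMetric g ι) (inducedOrient o ι ν)}

namespace IsRestriction

/-- The frames attached to a smooth local section of P_Z are smooth and positive. -/
theorem isManifoldOrientation (h : IsRestriction (d := d) (d' := d') hg hν Λ j Φ) (hn : 1 ≤ n)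
    (hΛ : SOF.SmoothMap (d := d) Λ)
    (hB : IsPrincipalSpinCBundle (m := n + 1) (d := d) (n + 1) (fun p => (Λ p).base))
    (hΛX : ∀ (p : P) (X : SpinC (n + 1)) (y : Euc (n + 1)),
      (Λ (MulOpposite.op X • p)).vec y = (Λ p).vec (rot X y)) :
    IsManifoldOrientation (inducedOrient o ι ν) := by
  intro z₀
  obtain ⟨U, s, τ, sZ, τZ, hT, hz₀, -, hsb, -, hss⟩ := h.exists_adapted hn hΛ hB hΛX z₀
  let b := EuclideanSpace.basisFun (Fin n) ℝ
  refine ⟨ι ⁻¹' U, hT.isOpen.preimage h.base.contMDiff.continuous, hz₀,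
    fun i z => ((Φ (sZ z)).frame (b i) : Euc n), fun i => ?_, fun z hz => ?_⟩
  · refine ((h.smoothMap hΛ (b i)).comp_contMDiffOn hss).congr fun z hz => ?_
    exact congrArg (fun x => (⟨x, ((Φ (sZ z)).frame (b i) : Euc n)⟩ : TangentBundle (𝓡 n) Z))
      (hsb z hz).symm
  · have hpos : ∀ (x y : Z) (w : Fin n → Euc n), x = y →
        PositiveTuple (V := TangentSpace (𝓡 n) x) (inducedOrient o ι ν x) w →
        PositiveTuple (V := TangentSpace (𝓡 n) y) (inducedOrient o ι ν y) w := by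
      rintro x _ w rfl
      exact id
    exact hpos _ _ _ (hsb z hz) (Φ (sZ z)).positive

variable [MulAction (SpinC n)ᵐᵒᵖ S] {G : Type*} [TopologicalSpace G] [ChartedSpace (Euc r) G]
  [Group G] [MulAction G M] [MulAction G Z] [MulAction G P] [MulAction G S]

/-- Each identity holds after the injective maps j or dι, where it becomes the corresponding one for
P. For the frame action this uses that λ^c of Spin^c(n+1) restricts on ℝ^n to λ^c of Spin^c(n). -/
theorem equivariantSpinCStructure (h : IsRestriction (d := d) (d' := d') hg hν Λ j Φ)
    (hn : 1 ≤ n)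
    (hjX : ∀ (X : SpinC n) (q : S), j (MulOpposite.op X • q) =
      MulOpposite.op (spinCIncl n X) • j q)
    (hjG : ∀ (a : G) (q : S), j (a • q) = a • j q)
    (hιG : ∀ (a : G) (z : Z), ι (a • z) = a • ι z)
    (hM : ContMDiffSMul (𝓡 r) (𝓡 (n + 1)) ∞ G M)
    (hP : IsEquivariantSpinCStructure (r := r) (d := d) G Λ) :
    IsEquivariantSpinCStructure (r := r) (d := d') G Φ where
  smooth := h.smoothMap hP.smooth
  principal := h.principal hn hjX hP.smooth hP.principal hP.map_action
  map_action q X y := tangentMap_injective h.base (by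
    rw [h.tangentMap_vec, h.tangentMap_vec, hjX, hP.map_action, rot_spinCIncl_appendZero])
  smooth_smul := contMDiffSMul_of_embedding h.total hjG hP.smooth_smul
  map_smul a q y := tangentMap_injective h.base (by
    have hZ : ContMDiffSMul (𝓡 r) (𝓡 n) ∞ G Z := contMDiffSMul_of_embedding h.base hιG hM
    rw [h.tangentMap_vec, hjG, hP.map_smul, tangentMap_smul
      (h.base.contMDiff.mdifferentiable (by simp)) hιG
      ((contMDiff_smul_left (r := r) a).mdifferentiable (by simp))
      ((contMDiff_smul_left (r := r) a).mdifferentiable (by simp)), h.tangentMap_vec])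
  commute a q X := h.total.isEmbedding.injective (by
    rw [hjG, hjX, hjX, hjG, hP.commute])

end IsRestriction

end Restriction

/-! ### The restriction of a spin^c prequantization -/

section Prequantization

open Manifold Topology Set

theorem Form.pullback_invariant {m m' : ℕ} {X Y : Type*} [TopologicalSpace X]
    [ChartedSpace (Euc m) X] [TopologicalSpace Y] [ChartedSpace (Euc m') Y] {q : ℕ} {F : Type*}
    [NormedAddCommGroup F] [NormedSpace ℝ F] {η : Form m' Y q F} {f : X → Y} {φ : X → X}
    {ψ : Y → Y} (hf : MDifferentiable (𝓡 m) (𝓡 m') f) (hφ : MDifferentiable (𝓡 m) (𝓡 m) φ)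
    (hψ : MDifferentiable (𝓡 m') (𝓡 m') ψ) (h : ∀ x, f (φ x) = ψ (f x))
    (hη : Form.pullback (m := m') ψ η = η) :
    Form.pullback (m := m) φ (Form.pullback (m := m) f η) = Form.pullback (m := m) f η := by
  rw [← Form.pullback_comp η hφ hf, funext h, Form.pullback_comp η hf hψ, hη]

theorem contDiff_toClC_circleIncl (k : ℕ) (b : ℝ) :
    ContDiff ℝ ∞ fun t : ℝ => toClC (circleIncl k (Circle.exp (t * b))) := by
  have h1 : ContDiff ℝ ∞ fun t : ℝ => ((Circle.exp (t * b) : Circle) : ℂ) := by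
    simp only [Circle.coe_exp]
    exact ((Complex.ofRealCLM.contDiff.comp (contDiff_id.mul contDiff_const)).mul
      contDiff_const).cexp
  exact (LinearMap.contDiff_of_finiteDimensional
    ((TensorProduct.mk ℝ ℂ (Cl k)).flip 1)).comp h1

theorem IsSpinOneParameterSubgroup.spinCIncl {n : ℕ} {γ : ℝ → SpinC n}
    (h : IsSpinOneParameterSubgroup γ) :
    IsSpinOneParameterSubgroup fun t => spinCIncl n (γ t) where
  map_add s t := by rw [h.map_add, map_mul]
  smooth := ((clCIncl n).toLinearMap.contDiff_of_finiteDimensional).comp h.smooth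
  inSpin t := (h.inSpin t).spinCIncl

variable {n d d' r : ℕ} {M Z P S : Type*} [TopologicalSpace M] [ChartedSpace (Euc (n + 1)) M]
  [IsManifold (𝓡 (n + 1)) ∞ M] [TopologicalSpace Z] [ChartedSpace (Euc n) Z]
  [IsManifold (𝓡 n) ∞ Z] {g : Metric (n + 1) M} {o : Orient (n + 1) M} {ι : Z → M}
  {ν : ∀ z, TangentSpace (𝓡 (n + 1)) (ι z)}
  [TopologicalSpace P] [ChartedSpace (Euc d) P] [IsManifold (𝓡 d) ∞ P]
  {Λ : P → SOF g o}
  [TopologicalSpace S] [ChartedSpace (Euc d') S] [IsManifold (𝓡 d') ∞ S]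
  [MulAction (SpinC (n + 1))ᵐᵒᵖ P] [MulAction (SpinC n)ᵐᵒᵖ S]
  {hg : IsRiemannianMetric g} {hν : IsUnitNormalField g ι ν} {j : S → P}
  {Φ : S → SOF (inducedMetric g ι) (inducedOrient o ι ν)}
  {G : Type*} [TopologicalSpace G] [ChartedSpace (Euc r) G]
  [Group G] [MulAction G M] [MulAction G Z] [MulAction G P] [MulAction G S]

/-- The conditions on θ concern its values on orbit velocities, which j preserves, its invariance
under maps that j intertwines, and its curvature. For the latter, d commutes with j^* and π ∘ j = ι
∘ π_Z. -/
theorem IsSpinCPrequantization.restrict {Ω : Form (n + 1) M 2 ℝ} {θ : Form d P 1 ℂ} (hn : 1 ≤ n)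
    (hP : IsSpinCPrequantization (r := r) (d := d) G g o Ω Λ θ)
    (h : IsRestriction (d := d) (d' := d') hg hν Λ j Φ)
    (hjX : ∀ (X : SpinC n) (q : S), j (MulOpposite.op X • q) =
      MulOpposite.op (spinCIncl n X) • j q)
    (hjG : ∀ (a : G) (q : S), j (a • q) = a • j q)
    (hιG : ∀ (a : G) (z : Z), ι (a • z) = a • ι z)
    (hνG : ∀ (a : G) (z : Z), tangentMap (𝓡 (n + 1)) (𝓡 (n + 1)) (fun x : M => a • x)
      (⟨ι z, ν z⟩ : TangentBundle (𝓡 (n + 1)) M) = ⟨ι (a • z), ν (a • z)⟩) :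
    IsSpinCPrequantization (r := r) (d := d') G (inducedMetric g ι) (inducedOrient o ι ν)
      (Form.pullback ι Ω) Φ (Form.pullback (m := d') j θ) := by
  have hGM := hP.action.smooth_smul
  have hGP := hP.spinC.smooth_smul
  have hGZ : ContMDiffSMul (𝓡 r) (𝓡 n) ∞ G Z := contMDiffSMul_of_embedding h.base hιG hGM
  have hGS : ContMDiffSMul (𝓡 r) (𝓡 d') ∞ G S := contMDiffSMul_of_embedding h.total hjG hGP
  have hι := h.base.contMDiff
  have hj := h.total.contMDiff
  have hιd := hι.mdifferentiable (by simp)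
  have hjd := hj.mdifferentiable (by simp)
  have hspin := h.equivariantSpinCStructure hn hjX hjG hιG hGM hP.spinC
  have hvel := fun {γ : ℝ → SpinC n} (hγ : ContDiff ℝ ∞ fun t => toClC (γ t)) (q : S) =>
    tangentMap_orbitVelocity hjd hjX hspin.principal hγ q
  -- Values of θ are compared at equal points of the tangent bundle TP, since the velocities to be
  -- identified have different types.
  have hθ : ∀ v w : TangentBundle (𝓡 d) P, v = w → θ v.1 ![v.2] = θ w.1 ![w.2] := by
    rintro v _ rfl; rfl
  have hθ' : ∀ v : TangentBundle (𝓡 d') S, Form.pullback (m := d') j θ v.1 ![v.2] =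
      θ (tangentMap (𝓡 d') (𝓡 d) j v).1 ![(tangentMap (𝓡 d') (𝓡 d) j v).2] := fun v => by
    refine congrArg (θ (j v.1)) (funext fun i => ?_)
    rw [Subsingleton.elim i 0]
    rfl
  refine
    { action := hP.action.restrict h.base hιG hν hνG
        (h.isManifoldOrientation hn hP.spinC.smooth hP.spinC.principal hP.spinC.map_action)
        fun z => ?_
      smooth_omega := hP.smooth_omega.pullback hι
      closed_omega := ?_
      invariant_omega := fun a => Form.pullback_invariant hιd
        ((contMDiff_smul_left (r := r) a).mdifferentiable (by simp))
        ((contMDiff_smul_left (r := r) a).mdifferentiable (by simp)) (hιG a)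
        (hP.invariant_omega a)
      spinC := hspin
      smooth_theta := hP.smooth_theta.pullback hj
      imaginary := fun q u => hP.imaginary _ _
      connection := fun q b => ?_
      invariant_G := fun a => Form.pullback_invariant hjd
        ((contMDiff_smul_left (r := r) a).mdifferentiable (by simp))
        ((contMDiff_smul_left (r := r) a).mdifferentiable (by simp)) (hjG a)
        (hP.invariant_G a)
      invariant_spinC := fun X => Form.pullback_invariant hjd
        ((hspin.principal.contMDiff_smul X).mdifferentiable (by simp))
        ((hP.spinC.principal.contMDiff_smul _).mdifferentiable (by simp)) (hjX X)
        (hP.invariant_spinC _)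
      vanishes_spin := fun q γ hγ => ?_
      curvature := ?_ }
  -- A local section of P_Z supplies a frame of Z at every point, so the induced orientation is
  -- nowhere the junk value.
  · obtain ⟨U, s, τ, sZ, τZ, -, hz, -, hsb, -⟩ := h.exists_adapted hn hP.spinC.smooth
      hP.spinC.principal hP.spinC.map_action z
    exact ⟨Φ (sZ z), hsb z hz⟩
  · rw [Form.d_pullback hP.smooth_omega hι, hP.closed_omega]
    rfl
  · refine ((hθ' ⟨_, _⟩).trans (hθ _ _ (hvel (contDiff_toClC_circleIncl n b) q))).trans ?_
    have hc : ∀ γ γ' : ℝ → SpinC (n + 1), γ = γ' →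
        θ (MulOpposite.op (γ 0) • j q) ![orbitVelocity (d := d) (j q) γ] =
          θ (MulOpposite.op (γ' 0) • j q) ![orbitVelocity (d := d) (j q) γ'] := by
      rintro γ _ rfl; rfl
    exact (hc _ _ (funext fun t => spinCIncl_circleIncl (Circle.exp (t * b)))).trans
      (hP.connection (j q) b)
  · exact ((hθ' ⟨_, _⟩).trans (hθ _ _ (hvel hγ.smooth q))).trans
      (hP.vanishes_spin (j q) _ hγ.spinCIncl)
  · have hb := hspin.principal.smooth_proj
    have hbP := hP.spinC.principal.smooth_proj
    rw [Form.d_pullback hP.smooth_theta hj, hP.curvature,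
      ← Form.pullback_comp _ hjd (hbP.mdifferentiable (by simp)), ← Form.pullback_negI,
      ← Form.pullback_comp _ (hb.mdifferentiable (by simp)) hιd]
    simp only [h.base_eq]

end Prequantization

end SpinCPreq

end

open SpinCPreq in
theorem claim3p2 {n r : ℕ} (hn : 1 ≤ n)
    {G : Type*} [TopologicalSpace G] [ChartedSpace (Euc r) G] [Group G] [LieGroup (𝓡 r) ∞ G]
    -- the manifold `M` of dimension `n + 1`, with its `G`-action
    {M : Type*} [TopologicalSpace M] [T2Space M] [SecondCountableTopology M]
    [ChartedSpace (Euc (n + 1)) M] [IsManifold (𝓡 (n + 1)) ∞ M] [MulAction G M]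
    {P : Type*} [TopologicalSpace P] [T2Space P] [SecondCountableTopology P]
    [ChartedSpace (Euc (spinCBundleDim (n + 1))) P]
    [IsManifold (𝓡 (spinCBundleDim (n + 1))) ∞ P]
    [MulAction G P] [MulAction (SpinC (n + 1))ᵐᵒᵖ P]
    (g : Metric (n + 1) M) (o : Orient (n + 1) M) (Ω : Form (n + 1) M 2 ℝ)
    (Λ : P → SOF g o) (θ : Form (spinCBundleDim (n + 1)) P 1 ℂ)
    -- `(P, θ)` is a `G`-equivariant spin^c prequantization for `(M, Ω)`
    (hP : IsSpinCPrequantization (r := r) (d := spinCBundleDim (n + 1)) G g o Ω Λ θ)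
    -- `Z` is an embedded `G`-invariant hypersurface
    {Z : Type*} [TopologicalSpace Z] [ChartedSpace (Euc n) Z] [IsManifold (𝓡 n) ∞ Z]
    [MulAction G Z] (ι : Z → M) (hι : Manifold.IsSmoothEmbedding (𝓡 n) (𝓡 (n + 1)) ∞ ι)
    (hιG : ∀ (a : G) (z : Z), ι (a • z) = a • ι z)
    -- with a `G`-invariant co-orientation
    (ν : ∀ z, TangentSpace (𝓡 (n + 1)) (ι z)) (hν : IsUnitNormalField g ι ν)
    (hνG : ∀ (a : G) (z : Z), tangentMap (𝓡 (n + 1)) (𝓡 (n + 1)) (fun x : M => a • x)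
      (⟨ι z, ν z⟩ : TangentBundle (𝓡 (n + 1)) M) = ⟨ι (a • z), ν (a • z)⟩) :
    -- the pullback `P_Z`, as a space, is a smooth manifold with a `G`-action and a right action of
    -- `Spin^c(n)`, such that the map `i' : P_Z → P` is a smooth equivariant embedding
    ∃ (_ : ChartedSpace (Euc (spinCBundleDim n)) (PullbackSpace hP.action.riemannian hν Λ))
      (_ : IsManifold (𝓡 (spinCBundleDim n)) ∞ (PullbackSpace hP.action.riemannian hν Λ))
      (_ : MulAction G (PullbackSpace hP.action.riemannian hν Λ))
      (_ : MulAction (SpinC n)ᵐᵒᵖ (PullbackSpace hP.action.riemannian hν Λ)),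
      Manifold.IsSmoothEmbedding (𝓡 (spinCBundleDim n)) (𝓡 (spinCBundleDim (n + 1))) ∞
        (fun q : PullbackSpace hP.action.riemannian hν Λ => q.1.2) ∧
      (∀ (a : G) (q : PullbackSpace hP.action.riemannian hν Λ), (a • q).1.2 = a • q.1.2) ∧
      (∀ (X : SpinC n) (q : PullbackSpace hP.action.riemannian hν Λ),
        (MulOpposite.op X • q).1.2 = MulOpposite.op (spinCIncl n X) • q.1.2) ∧
      -- and `(P_Z, (i')^* θ)` is a `G`-equivariant spin^c prequantization for `(Z, Ω|_Z)`
      IsSpinCPrequantization (r := r) (d := spinCBundleDim n) G (inducedMetric g ι) (inducedOrient o ι ν)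
        (Form.pullback ι Ω) (fun q : PullbackSpace hP.action.riemannian hν Λ => q.1.1)
        (Form.pullback (m := spinCBundleDim n)
          (fun q : PullbackSpace hP.action.riemannian hν Λ => q.1.2) θ) := by

  have hX := hP.spinC.map_action
  have hg := hP.action.riemannian
  have hj := isEmbedding_snd hg hν hι (fun a => (hP.spinC.smooth a).continuous)
  -- The codimension of P_Z in P is n + 1: one for Z in M, and n for the sphere
  -- Spin^c(n+1)/Spin^c(n). Numerically, this is Pascal's rule for (n+1 choose 2).
  have hdim : Module.finrank ℝ (Euc (spinCBundleDim n) × (Euc 1 × Euc n)) =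
      Module.finrank ℝ (Euc (spinCBundleDim (n + 1))) := by
    have h : (n + 1).choose 2 = n.choose 1 + n.choose 2 := Nat.choose_succ_succ' n 1
    rw [Nat.choose_one_right] at h
    simp only [Module.finrank_prod, finrank_euclideanSpace_fin]
    unfold spinCBundleDim
    omega
  obtain ⟨c, hc, hjs⟩ := exists_isSmoothEmbedding_of_slices
    (ContinuousLinearEquiv.ofFinrankEq hdim) hj fun q =>
      exists_slice_chart hn hg hν hι hP.spinC.smooth hP.spinC.principal hX _ q
  have hrange := fun p => mem_range_snd_iff hg hν hι (Λ := Λ) (p := p)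
  obtain ⟨aG, haG⟩ := exists_mulAction_of_injective hj.injective (fun (a : G) (p : P) => a • p)
    (one_smul G) mul_smul fun a q => by
      obtain ⟨z, hz⟩ := (hrange _).1 ⟨q, rfl⟩
      -- Invariance of ν: a takes a frame ending in ν(z) to one ending in ν(a • z).
      exact (hrange _).2 ⟨a • z, by rw [hP.spinC.map_smul, hz, hνG]⟩
  obtain ⟨aX, haX⟩ := exists_mulAction_of_injective (A := (SpinC n)ᵐᵒᵖ) hj.injective
    (fun X (p : P) => MulOpposite.op (spinCIncl n X.unop) • p)
    (fun p => by simp) (fun X Y p => by simp [mul_smul]) fun X q => by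
      obtain ⟨z, hz⟩ := (hrange _).1 ⟨q, rfl⟩
      -- Spin^c(n) fixes e, so the last frame vector is unchanged.
      exact (hrange _).2 ⟨z, by rw [hX, rot_spinCIncl_eLast, hz]⟩
  refine ⟨c, hc, aG, aX, hjs, haG, fun X q => haX _ q, ?_⟩
  exact hP.restrict hn ⟨hι, hjs, fun q => q.2, fun p z hz => (hrange p).2 ⟨z, hz⟩⟩
    (fun X q => haX _ q) haG hιG hνG
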